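/- **Setting.** Let $d\ge 2$ and $K\ge 2$ be integers and $\alpha>\beta>0$ reals with $\frac{(\sqrt\alpha-\sqrt\beta)^2}{K^{d-1}(d-1)!}>1$. For $n$ divisible by $K$ put $m=n/K$; let $\mathbb M_{n,K}$ be the set of $n\times K$ matrices with entries in $\{0,1\}$ and exactly one $1$ in each row, $\mathcal H\subset\mathbb M_{n,K}$ the subset of those whose columns all sum to $m$, and $\Pi_K$ the set of $K\times K$ permutation matrices. Fix $H^*\in\mathcal H$ and let $\mathcal A$ be the random symmetric order-$d$ adjacency tensor of the symmetric $d$-uniform hypergraph stochastic block model: the entries $\mathcal A_{i_1\dots i_d}$ with $i_1<\dots<i_d$ are independent Bernoulli variables, with parameter $p=\alpha\log n/n^{d-1}$ if the $d$ nodes are in the same community (given by $H^*$) and $q=\beta\log n/n^{d-1}$ otherwise ($p,q\in(0,1]$), and entries with a repeated index are $0$. Write $(\mathcal A[H^{\otimes(d-1)}])_{ik}=\sum_{i_2,\dots,i_d}\mathcal A_{i,i_2,\dots,i_d}H_{i_2k}\cdots H_{i_dk}$ and $\mathcal T(X)=\arg\min_{H\in\mathcal H}\|H-X\|_F$. The projected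 tensor power method (PTPM) with $N$ iterations takes $H^1\in\mathcal T(H^0)$ and $H^{t+1}\in\mathcal T(\mathcal A[(H^t)^{\otimes(d-1)}])$ for $t=1,\dots,N$ (arbitrary choices from the sets $\mathcal T(\cdot)$), and outputs $H^{N+1}$. **Constants.** There is a constant $C>0$, depending only on $d,K,\alpha,\beta$, such that the following three assertions hold. (a) For every $n\ge 2$ and $H^*\in\mathcal H$, with probability at least $1-n^{-10}$: for all $\varepsilon\in(0,1/\sqrt{K(d-1)})$, $H\in\mathcal H$ and $Q\in\Pi_K$ with $\|H-H^*Q\|_F\le\varepsilon\sqrt n$, $$\big\|\mathcal A[H^{\otimes(d-1)}]-\mathcal A[(H^*Q)^{\otimes(d-1)}]\big\|_F\le\Big(\tfrac{4(d-1)m^{d-2}\varepsilon n}{\sqrt K}(p-q)+C\sqrt{\log n}\Big)\|H-H^*Q\|_F .$$ (b) For $\gamma>0$, let $\mathrm{Sep}_\gamma$ be the event that $X=\mathcal A[(H^*)^{\otimes(d-1)}]$ satisfies $X_{ik}-X_{i\ell}\ge\gamma\log n$ for all nodes $i$, all $\ell\ne k$ with $H^*_{ik}=1$. There are constants $\gamma>0$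 and $c>0$, depending only on $d,K,\alpha,\beta$, such that $\Pr[\mathrm{Sep}_\gamma]\ge 1-n^{-c}$ for all sufficiently large $n$ and all $H^*\in\mathcal H$. (c) Let $\gamma>0$ and $c_1>0$ be arbitrary and denote $$\phi=\frac{C K^{d-3/2}}{64(d-1)(\alpha-\beta)},\qquad \theta=\frac14\min\Big\{\frac1{\sqrt{K(d-1)}},\frac{\gamma K^{d-3/2}}{16(d-1)(\alpha-\beta)}\Big\}.$$ There is $c>0$, depending only on $d,K,\alpha,\beta,\gamma,c_1$ (and $C$), such that for all $n$ with $$n>\exp\Big(\max\Big\{\frac{64C^2}{\gamma^2},\frac{\gamma^2}{C^2},\frac{\phi^2}{\theta^2},2\phi^2,\frac{256C^4}{\gamma^4}\Big\}\Big)$$ and all $H^*\in\mathcal H$ for which $\Pr[\mathrm{Sep}_\gamma]\ge1-n^{-c_1}$ (by (b), for a suitable $\gamma$ this is true for all large $n$), the following holds with probability at least $1-n^{-c}$: for every $H^0\in\mathbb M_{n,K}$ with $\min_{Q\in\Pi_K}\|H^0-H^*Q\|_F\le\theta\sqrt n$, and every $Q\in\Pi_K$ with $\|H^0-H^*Q\|_F\le\theta\sqrt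 n$, PTPM started at $H^0$ outputs exactly $H^*Q$ within $$\lceil 2\log\log n\rceil+\Big\lceil\frac{2\log n}{\log\log n}\Big\rceil+2$$ projected tensor power iterations, i.e. $H^{N+1}=H^*Q$ whenever $N$ is at least this number. -/

import Mathlib

open MeasureTheory ProbabilityTheory Matrix

universe u

attribute [local instance] Matrix.frobeniusNormedAddCommGroup

noncomputable section

namespace HSBM

/-- Real tensors of order `d` and dimension `n`. -/
abbrev Tensor (d n : ℕ) : Type := (Fin d → Fin n) → ℝ

/-- Membership matrices: `n × K` matrices with entries in `{0,1}`
whose rows each have exactly one entry equal to `1`. -/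
def membership (n K : ℕ) : Set (Matrix (Fin n) (Fin K) ℝ) :=
  {H | (∀ i k, H i k = 0 ∨ H i k = 1) ∧ ∀ i, ∑ k, H i k = 1}

/-- Balanced membership matrices: every one of the `K` communities has `n / K` nodes.
(This set is empty unless `K` divides `n`.) -/
def balanced (n K : ℕ) : Set (Matrix (Fin n) (Fin K) ℝ) :=
  {H | H ∈ membership n K ∧ ∀ k, ∑ i, H i k = (n : ℝ) / K}

/-- The multilinear operation: the `(i, k)` entry is the sum over all `i₂, …, i_d` of
`A (i, i₂, …, i_d) * H i₂ k * ⋯ * H i_d k`. -/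
def multilinearOp {d n K : ℕ} [NeZero d] (A : Tensor d n) (H : Matrix (Fin n) (Fin K) ℝ) :
    Matrix (Fin n) (Fin K) ℝ :=
  Matrix.of fun i k =>
    ∑ j : Fin d → Fin n with j 0 = i, A j * ∏ r ∈ Finset.univ.erase (0 : Fin d), H (j r) k

/-- The set-valued projection onto the balanced membership matrices (Frobenius norm). -/
def proj {n K : ℕ} (X : Matrix (Fin n) (Fin K) ℝ) : Set (Matrix (Fin n) (Fin K) ℝ) :=
  {V | V ∈ balanced n K ∧ ∀ W ∈ balanced n K, ‖V - X‖ ≤ ‖W - X‖}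

/-- `H 0, …, H (N + 1)` are the iterates of a run of the projected tensor power method on `A` with
`N` projected tensor power iterations, for some selection from each set-valued projection.
The initial point is `H 0` and the output is `H (N + 1)`. -/
structure IsPTPMRun {d n K : ℕ} [NeZero d] (A : Tensor d n) (N : ℕ)
    (H : ℕ → Matrix (Fin n) (Fin K) ℝ) : Prop where
  init : H 1 ∈ proj (H 0)
  step : ∀ t, 1 ≤ t → t ≤ N → H (t + 1) ∈ proj (multilinearOp A (H t))

open Classical in
/-- The probability of the hyperedge `{j 0, …, j (d - 1)}`: it is `p` if all these nodes are in the
same community, i.e. if the entries of the Hadamard product of their rows sum to `1`,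
and `q` otherwise. -/
def edgeProb {d n K : ℕ} (p q : unitInterval) (Hstar : Matrix (Fin n) (Fin K) ℝ) (j : Fin d → Fin n) :
    unitInterval :=
  if ∑ k, ∏ r, Hstar (j r) k = 1 then p else q

/-- `A` is the random adjacency tensor of the symmetric `d`-uniform hypergraph stochastic block
model with planted partition `Hstar` and probability parameters `p, q`. -/
structure IsHSBM {d n K : ℕ} (p q : unitInterval) (Hstar : Matrix (Fin n) (Fin K) ℝ)
    {Ω : Type u} [MeasurableSpace Ω] (P : Measure Ω) (A : Ω → Tensor d n) : Prop where
  p_pos : 0 < p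
  q_pos : 0 < q
  planted : Hstar ∈ balanced n K
  measurable : ∀ j, Measurable fun ω => A ω j
  symm : ∀ ω j (σ : Equiv.Perm (Fin d)), A ω (j ∘ σ) = A ω j
  diag : ∀ ω j, ¬ Function.Injective j → A ω j = 0
  indep : iIndepFun (fun (j : {j : Fin d → Fin n // StrictMono j}) ω => A ω j.1) P
  law : ∀ j : Fin d → Fin n, StrictMono j →
    HasLaw (fun ω => A ω j) (bernoulliMeasure (1 : ℝ) 0 (edgeProb p q Hstar j)) P

/-- The model in the logarithmic degree regime, `p = α log n / n ^ (d - 1)` and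
`q = β log n / n ^ (d - 1)` (which presupposes that these two numbers are at most `1`). -/
def IsLogHSBM {d n K : ℕ} (α β : ℝ) (Hstar : Matrix (Fin n) (Fin K) ℝ)
    {Ω : Type u} [MeasurableSpace Ω] (P : Measure Ω) (A : Ω → Tensor d n) : Prop :=
  ∃ p q : unitInterval, (p : ℝ) = α * Real.log n / (n : ℝ) ^ (d - 1) ∧
    (q : ℝ) = β * Real.log n / (n : ℝ) ^ (d - 1) ∧ IsHSBM p q Hstar P A

/-- The matrix `Hstar * Q`, where `Q` is the permutation matrix of `σ`. -/
def relabel {n K : ℕ} (Hstar : Matrix (Fin n) (Fin K) ℝ) (σ : Equiv.Perm (Fin K)) :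
    Matrix (Fin n) (Fin K) ℝ :=
  Hstar * σ.permMatrix ℝ

/-- The event that `X = A[Hstar ^ ⊗(d-1)]` satisfies `X i k - X i l ≥ γ log n` for all nodes `i`
in community `k` and all `l ≠ k`. -/
def separationEvent {d n K : ℕ} [NeZero d] (γ : ℝ) (Hstar : Matrix (Fin n) (Fin K) ℝ)
    {Ω : Type u} (A : Ω → Tensor d n) : Set Ω :=
  {ω | ∀ i k l, Hstar i k = 1 → l ≠ k →
    γ * Real.log n ≤ multilinearOp (A ω) Hstar i k - multilinearOp (A ω) Hstar i l}

/-- The event that the multilinear operation is Lipschitz near every `Hstar * Q`, with constant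
`4 (d - 1) m ^ (d - 2) ε n (p - q) / √K + C √(log n)` on the balanced membership matrices within
distance `ε √n`, where `m = n / K` and `p - q = (α - β) log n / n ^ (d - 1)`. -/
def lipschitzEvent {d n K : ℕ} [NeZero d] (α β C : ℝ) (Hstar : Matrix (Fin n) (Fin K) ℝ)
    {Ω : Type u} (A : Ω → Tensor d n) : Set Ω :=
  {ω | ∀ ε : ℝ, 0 < ε → ε < 1 / √(K * ((d : ℝ) - 1)) →
    ∀ H ∈ balanced n K, ∀ σ : Equiv.Perm (Fin K), ‖H - relabel Hstar σ‖ ≤ ε * √n →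
      ‖multilinearOp (A ω) H - multilinearOp (A ω) (relabel Hstar σ)‖ ≤
        (4 * ((d : ℝ) - 1) * ((n : ℝ) / K) ^ (d - 2) * ε * n / √K *
            ((α - β) * Real.log n / (n : ℝ) ^ (d - 1)) + C * √(Real.log n)) *
          ‖H - relabel Hstar σ‖}

/-- `φ = C K ^ (d - 3/2) / (64 (d - 1) (α - β))`. -/
def phi (d K : ℕ) (α β C : ℝ) : ℝ :=
  C * (K : ℝ) ^ ((d : ℝ) - 3 / 2) / (64 * ((d : ℝ) - 1) * (α - β))

/-- `θ = 1/4 min {1 / √(K (d - 1)), γ K ^ (d - 3/2) / (16 (d - 1) (α - β))}`. -/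
def theta (d K : ℕ) (α β γ : ℝ) : ℝ :=
  1 / 4 * min (1 / √(K * ((d : ℝ) - 1)))
    (γ * (K : ℝ) ^ ((d : ℝ) - 3 / 2) / (16 * ((d : ℝ) - 1) * (α - β)))

/-- The explicit lower bound on `log n`. -/
def logThreshold (d K : ℕ) (α β γ C : ℝ) : ℝ :=
  max (64 * C ^ 2 / γ ^ 2) (max (γ ^ 2 / C ^ 2)
    (max (phi d K α β C ^ 2 / theta d K α β γ ^ 2)
      (max (2 * phi d K α β C ^ 2) (256 * C ^ 4 / γ ^ 4))))

/-- The number of iterations `⌈2 log log n⌉ + ⌈2 log n / log log n⌉ + 2`. -/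
def iterBound (n : ℕ) : ℕ :=
  ⌈2 * Real.log (Real.log n)⌉₊ + ⌈2 * Real.log n / Real.log (Real.log n)⌉₊ + 2

/-- The event that, simultaneously for all initial points within distance `θ √n` of some
`Hstar * Q`, every run of the projected tensor power method with at least `iterBound n` projected
tensor power iterations outputs exactly this `Hstar * Q`. -/
def recoveryEvent {d n K : ℕ} [NeZero d] (α β γ : ℝ) (Hstar : Matrix (Fin n) (Fin K) ℝ)
    {Ω : Type u} (A : Ω → Tensor d n) : Set Ω :=
  {ω | ∀ H₀ ∈ membership n K, ∀ σ : Equiv.Perm (Fin K),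
    ‖H₀ - relabel Hstar σ‖ ≤ theta d K α β γ * √n →
      ∀ N ≥ iterBound n, ∀ H : ℕ → Matrix (Fin n) (Fin K) ℝ,
        H 0 = H₀ → IsPTPMRun (A ω) N H → H (N + 1) = relabel Hstar σ}

end HSBM

end

namespace HSBM

section OneVariable

lemma exp_sub_one_sub_le {x : ℝ} (hx0 : 0 ≤ x) (hx : x ≤ 1) : Real.exp x - 1 - x ≤ x ^ 2 := by
  have h := Real.abs_exp_sub_one_sub_id_le (x := x) (by rwa [abs_of_nonneg hx0])
  exact (le_abs_self _).trans h

lemma exp_sub_one_sub_nonneg (x : ℝ) : 0 ≤ Real.exp x - 1 - x := by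
  linarith [Real.add_one_le_exp x]

lemma exp_neg_sub_one_add_le {x : ℝ} (hx : 0 ≤ x) :
    Real.exp (-x) - 1 - (-x) ≤ Real.exp x - 1 - x := by
  have h := Real.self_le_sinh_iff.2 hx
  rw [Real.sinh_eq] at h
  linarith

lemma exp_sub_one_le_mul_exp {x y : ℝ} (hx : 0 ≤ x) (hxy : x ≤ y) :
    Real.exp x - 1 ≤ x * Real.exp y := by
  have h1 : 1 - x ≤ Real.exp (-x) := by linarith [Real.add_one_le_exp (-x)]
  have h2 : Real.exp x * (1 - x) ≤ 1 := by
    calc Real.exp x * (1 - x) ≤ Real.exp x * Real.exp (-x) := by gcongr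
      _ = 1 := by rw [← Real.exp_add]; simp
  have h3 : x * Real.exp x ≤ x * Real.exp y := by gcongr
  linarith

lemma sq_le_exp_add_exp_neg (x : ℝ) : x ^ 2 ≤ Real.exp x + Real.exp (-x) - 2 := by
  have h : Real.exp x + Real.exp (-x) - 2 = 4 * Real.sinh (x / 2) ^ 2 := by
    rw [Real.sinh_eq, show x = x / 2 + x / 2 by ring, neg_add, Real.exp_add, Real.exp_add]
    have : Real.exp (x / 2) * Real.exp (-(x / 2)) = 1 := by rw [← Real.exp_add]; simp
    rw [show (x / 2 + x / 2) / 2 = x / 2 by ring]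
    nlinarith
  rw [h, ← sq_abs (Real.sinh _), ← sq_abs x]
  have h1 : |x| / 2 ≤ |Real.sinh (x / 2)| := by
    rw [Real.abs_sinh]
    have := Real.self_le_sinh_iff.2 (show 0 ≤ |x / 2| by positivity)
    rwa [abs_div, abs_two] at this ⊢
  nlinarith [abs_nonneg x]

/-- The scale `max 1 λ` at which the dyadic decomposition of the tail starts. -/
lemma dyadic_tail_exponent {lam : ℝ} (hl : 0 < lam) (b : ℕ) :
    (2 : ℝ) ^ b + Real.log (max 1 lam / lam) ≤
      (8 * 2 ^ b * √(max 1 lam)) / 4 * Real.log (1 + (8 * 2 ^ b * √(max 1 lam)) / lam) := by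
  have h2 : (1 : ℝ) ≤ 2 ^ b := one_le_pow₀ (by norm_num)
  rcases le_total 1 lam with h | h
  · rw [max_eq_right h, div_self hl.ne', Real.log_one, add_zero]
    set R := √lam with hR
    have hR1 : 1 ≤ R := by rw [hR]; exact Real.one_le_sqrt.2 h
    have hRR : R * R = lam := Real.mul_self_sqrt hl.le
    set t := 8 * 2 ^ b * R with ht
    have ht8 : 8 * 2 ^ b ≤ t := by
      rw [ht]; nlinarith
    have ht0 : 0 < t := by positivity
    have hlog := Real.le_log_one_add_of_nonneg (x := t / lam) (by positivity)
    set x := t / lam with hx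
    have hx0 : 0 < x := by positivity
    have key : (2 : ℝ) ^ b ≤ t / 4 * (2 * x / (x + 2)) := by
      rcases le_total 2 x with h | h
      · have : 1 ≤ 2 * x / (x + 2) := by
          rw [le_div_iff₀ (by linarith)]; linarith
        nlinarith
      · have h1 : x / 2 ≤ 2 * x / (x + 2) := by
          rw [div_le_div_iff₀ (by norm_num) (by linarith)]; nlinarith
        have h2 : t * x = 64 * (2 ^ b) ^ 2 := by
          rw [hx, mul_div_assoc', div_eq_iff hl.ne', ht, ← hRR]; ring
        nlinarith
    exact key.trans (by gcongr)
  · rw [max_eq_left h]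
    simp only [Real.sqrt_one, mul_one]
    have h8 : (1 : ℝ) ≤ Real.log (8 * 2 ^ b) := by
      rw [Real.le_log_iff_exp_le (by positivity)]
      have := Real.exp_one_lt_d9
      nlinarith
    have h1l : 0 ≤ Real.log (1 / lam) := Real.log_nonneg (by rw [le_div_iff₀ hl]; linarith)
    have h3 : Real.log (8 * 2 ^ b) + Real.log (1 / lam) ≤ Real.log (1 + 8 * 2 ^ b / lam) := by
      rw [← Real.log_mul (by positivity) (by positivity)]
      apply Real.log_le_log (by positivity)
      rw [mul_one_div]; linarith
    nlinarith

lemma four_pow_mul_exp_neg_two_pow_le (b : ℕ) :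
    (4 : ℝ) ^ b * Real.exp (-2 ^ b) ≤ 6 * (1 / 2) ^ b := by
  have h := Real.pow_div_factorial_le_exp (x := (2 : ℝ) ^ b) (by positivity) 3
  have hf : ((Nat.factorial 3 : ℕ) : ℝ) = 6 := by norm_num [Nat.factorial]
  rw [hf, div_le_iff₀ (by norm_num)] at h
  rw [Real.exp_neg, ← div_eq_mul_inv, div_le_iff₀ (Real.exp_pos _)]
  have e1 : (4 : ℝ) ^ b = (2 ^ b) ^ 2 := by rw [← pow_mul, mul_comm, pow_mul]; norm_num
  have e2 : (1 / 2 : ℝ) ^ b * 2 ^ b = 1 := by rw [← mul_pow]; norm_num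
  have hp : (0 : ℝ) < (1 / 2) ^ b := by positivity
  calc (4 : ℝ) ^ b = (1 / 2) ^ b * (2 ^ b) ^ 3 := by
        rw [e1, pow_succ' ((2 : ℝ) ^ b) 2, ← mul_assoc, e2, one_mul]
    _ ≤ (1 / 2) ^ b * (Real.exp (2 ^ b) * 6) := by gcongr
    _ = _ := by ring

lemma log_one_add_mul_le {t T lam : ℝ} (hl : 0 < lam) (ht : 0 < t) (htT : t ≤ T) :
    t / T * Real.log (1 + T / lam) ≤ Real.log (1 + t / lam) := by
  have hT : 0 < T := ht.trans_le htT
  rw [← Real.log_rpow (by positivity)]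
  apply Real.log_le_log (by positivity)
  have := rpow_one_add_le_one_add_mul_self (s := T / lam) (by have : 0 ≤ T / lam := by positivity
                                                              linarith)
    (p := t / T) (by positivity) ((div_le_one hT).2 htT)
  refine this.trans (le_of_eq ?_)
  field_simp

variable {Ω : Type*} [MeasurableSpace Ω] {P : Measure Ω} [IsProbabilityMeasure P] {X : Ω → ℝ}
  {lam : ℝ}

lemma real_le_of_mgf_le (hl : 0 < lam)
    (hint : ∀ u : ℝ, Integrable (fun ω => Real.exp (u * X ω)) P)
    (hX : ∀ u : ℝ, ∫ ω, Real.exp (u * X ω) ∂P ≤ Real.exp (lam * (Real.exp |u| - 1 - |u|)))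
    {t : ℝ} (ht : 0 < t) :
    P.real {ω | t ≤ |X ω|} ≤ 2 * Real.exp (-(t / 2 * Real.log (1 + t / lam))) := by
  set u := Real.log (1 + t / lam) with hu
  have hx : 0 < t / lam := by positivity
  have hu0 : 0 < u := Real.log_pos (by linarith)
  have heu : Real.exp u = 1 + t / lam := Real.exp_log (by positivity)
  have hexp : -u * t + lam * (Real.exp u - 1 - u) ≤ -(t / 2 * u) := by
    have h := Real.le_log_one_add_of_nonneg hx.le
    rw [← hu, div_le_iff₀ (by positivity)] at h
    rw [heu]
    have e : lam * (t / lam) = t := by field_simp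
    have h' : lam * (2 * (t / lam)) ≤ lam * (u * (t / lam + 2)) := by gcongr
    have h'' : lam * (u * (t / lam + 2)) = u * t + 2 * (lam * u) := by
      rw [show lam * (u * (t / lam + 2)) = u * (lam * (t / lam)) + 2 * (lam * u) by ring, e]
    nlinarith
  have main : ∀ Y : Ω → ℝ, Integrable (fun ω => Real.exp (u * Y ω)) P →
      ∫ ω, Real.exp (u * Y ω) ∂P ≤ Real.exp (lam * (Real.exp u - 1 - u)) →
      P.real {ω | t ≤ Y ω} ≤ Real.exp (-(t / 2 * u)) := by
    intro Y hYi hY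
    calc P.real {ω | t ≤ Y ω} ≤ Real.exp (-u * t) * mgf Y P u :=
          measure_ge_le_exp_mul_mgf t hu0.le hYi
      _ ≤ Real.exp (-u * t) * Real.exp (lam * (Real.exp u - 1 - u)) := by
          gcongr; exact hY
      _ ≤ _ := by rw [← Real.exp_add]; exact Real.exp_le_exp.2 hexp
  have h1 := main X (hint u) (by simpa [abs_of_pos hu0] using hX u)
  have h2 := main (fun ω => - X ω) (by simpa using hint (-u))
    (by simpa [abs_of_pos hu0] using hX (-u))
  calc P.real {ω | t ≤ |X ω|} ≤ P.real ({ω | t ≤ X ω} ∪ {ω | t ≤ -X ω}) := by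
        apply measureReal_mono _ (measure_ne_top _ _)
        intro ω hω
        simpa [le_abs] using hω
    _ ≤ P.real {ω | t ≤ X ω} + P.real {ω | t ≤ -X ω} := measureReal_union_le _ _
    _ ≤ _ := by linarith

lemma integral_sq_le_of_mgf_le (hl : 0 < lam)
    (hint : ∀ u : ℝ, Integrable (fun ω => Real.exp (u * X ω)) P)
    (hX : ∀ u : ℝ, ∫ ω, Real.exp (u * X ω) ∂P ≤ Real.exp (lam * (Real.exp |u| - 1 - |u|)))
    (hm : Measurable X) :
    Integrable (fun ω => X ω ^ 2) P ∧ ∫ ω, X ω ^ 2 ∂P ≤ 4 * lam := by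
  have key : ∀ u : ℝ, 0 < u → Integrable (fun ω => X ω ^ 2) P ∧
      u ^ 2 * ∫ ω, X ω ^ 2 ∂P ≤ 2 * (Real.exp (lam * (Real.exp u - 1 - u)) - 1) := by
    intro u hu
    have hpt : ∀ ω, u ^ 2 * X ω ^ 2 ≤ Real.exp (u * X ω) + Real.exp (-u * X ω) - 2 := by
      intro ω
      have h := sq_le_exp_add_exp_neg (u * X ω)
      rw [← neg_mul] at h
      nlinarith
    have hi : Integrable (fun ω => Real.exp (u * X ω) + Real.exp (-u * X ω) - 2) P :=
      ((hint u).add (hint (-u))).sub (integrable_const _)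
    have hi2 : Integrable (fun ω => u ^ 2 * X ω ^ 2) P := by
      refine hi.mono' (by fun_prop) (Filter.Eventually.of_forall fun ω => ?_)
      rw [Real.norm_eq_abs, abs_of_nonneg (by positivity)]
      exact hpt ω
    refine ⟨?_, ?_⟩
    · have := hi2.const_mul (1 / u ^ 2)
      refine this.congr (Filter.Eventually.of_forall fun ω => ?_)
      field_simp
    · rw [← integral_const_mul]
      refine (integral_mono hi2 hi hpt).trans ?_
      have e1 := integral_sub ((hint u).add (hint (-u))) (integrable_const (μ := P) (2 : ℝ))
      have e2 := integral_add (hint u) (hint (-u))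
      simp only [Pi.add_apply] at e1 e2
      rw [e1, e2]
      have a := hX u
      have b := hX (-u)
      rw [abs_neg] at b
      rw [abs_of_pos hu] at a b
      simp only [integral_const, probReal_univ, one_smul]
      linarith
  refine ⟨(key 1 one_pos).1, ?_⟩
  have he := Real.exp_one_lt_d9
  rcases le_total lam 1 with h | h
  · have := (key 1 one_pos).2
    have h2 : Real.exp (lam * (Real.exp 1 - 1 - 1)) - 1 ≤ lam * Real.exp 1 - lam := by
      have h3 : lam * (Real.exp 1 - 1 - 1) ≤ lam := by nlinarith
      have h4 : Real.exp lam ≤ lam * Real.exp 1 + (1 - lam) * Real.exp 0 := by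
        have := convexOn_exp.2 (Set.mem_univ 1) (Set.mem_univ 0) hl.le (by linarith : 0 ≤ 1 - lam)
          (by ring)
        simpa using this
      have := Real.exp_le_exp.2 h3
      rw [Real.exp_zero] at h4
      linarith
    nlinarith
  · have hs : 0 < √lam := Real.sqrt_pos.2 hl
    have hss : √lam ^ 2 = lam := Real.sq_sqrt hl.le
    have h1 : 1 / √lam ≤ 1 := by
      rw [div_le_one hs]; exact Real.one_le_sqrt.2 h
    have := (key (1 / √lam) (by positivity)).2
    have h2 : lam * (Real.exp (1 / √lam) - 1 - 1 / √lam) ≤ 1 := by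
      have := exp_sub_one_sub_le (x := 1 / √lam) (by positivity) h1
      rw [div_pow, one_pow, hss, le_div_iff₀ hl] at this
      linarith
    have h3 := Real.exp_le_exp.2 h2
    rw [div_pow, one_pow, hss, div_mul_eq_mul_div, div_le_iff₀ hl, one_mul] at this
    nlinarith

/-- The absolute constant in `integral_exp_truncated_sq_le`. -/
noncomputable def truncConst : ℝ := 4 * Real.exp 64 + 6144

lemma truncConst_pos : 0 < truncConst := by unfold truncConst; positivity

lemma exp_truncated_sq_le {θ T : ℝ} (hθ : 0 < θ) (hθl : θ * max 1 lam ≤ 1) (B : ℕ)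
    (hB : T < 8 * 2 ^ B) (hT : 0 ≤ T) (x : ℝ) :
    Real.exp (θ * min (x ^ 2) (T ^ 2)) ≤ 1 + θ * Real.exp 64 * x ^ 2 +
      ∑ b ∈ (Finset.range B).filter (fun b => 8 * 2 ^ b * √(max 1 lam) ≤ T),
        Set.indicator {y : ℝ | 8 * 2 ^ b * √(max 1 lam) ≤ |y|}
          (fun _ => 4 * θ * (8 * 2 ^ b * √(max 1 lam)) ^ 2 *
            Real.exp (4 * θ * (8 * 2 ^ b * √(max 1 lam)) ^ 2)) x := by
  set R := √(max 1 lam) with hR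
  have hR1 : 1 ≤ R := Real.one_le_sqrt.2 (le_max_left _ _)
  have hRR : R ^ 2 = max 1 lam := Real.sq_sqrt (by positivity)
  set y := min |x| T with hy
  have hyT : y ≤ T := min_le_right _ _
  have hyx : y ≤ |x| := min_le_left _ _
  have hy0 : 0 ≤ y := le_min (abs_nonneg _) hT
  have hmin : min (x ^ 2) (T ^ 2) = y ^ 2 := by
    rcases le_total |x| T with h | h
    · rw [hy, min_eq_left h, sq_abs, min_eq_left (by rw [← sq_abs]; gcongr)]
    · rw [hy, min_eq_right h, min_eq_right (by rw [← sq_abs x]; gcongr)]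
  rw [hmin]
  have hnn : ∀ b ∈ (Finset.range B).filter (fun b => 8 * 2 ^ b * R ≤ T), 0 ≤
      Set.indicator {y : ℝ | 8 * 2 ^ b * R ≤ |y|}
          (fun _ => 4 * θ * (8 * 2 ^ b * R) ^ 2 *
            Real.exp (4 * θ * (8 * 2 ^ b * R) ^ 2)) x := by
    intro b _
    apply Set.indicator_nonneg
    intros; positivity
  by_cases hsm : y < 8 * R
  · have h1 : θ * y ^ 2 ≤ 64 := by
      have : y ^ 2 ≤ (8 * R) ^ 2 := by gcongr
      rw [mul_pow, hRR] at this
      nlinarith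
    have h2 := exp_sub_one_le_mul_exp (by positivity) h1
    have h3 : y ^ 2 ≤ x ^ 2 := by rw [← sq_abs x]; gcongr
    have h4 : θ * y ^ 2 * Real.exp 64 ≤ θ * Real.exp 64 * x ^ 2 := by
      rw [mul_right_comm]; gcongr
    have := Finset.sum_nonneg hnn
    linarith
  · push Not at hsm
    obtain ⟨b, hb1, hb2⟩ : ∃ b, 8 * 2 ^ b * R ≤ y ∧ y < 8 * 2 ^ (b + 1) * R := by
      have hex : ∃ c : ℕ, y < 8 * 2 ^ c * R := ⟨B, by
        refine (hyT.trans_lt hB).trans_le ?_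
        exact le_mul_of_one_le_right (by positivity) hR1⟩
      classical
      have hc := Nat.find_spec hex
      have hmin := fun m => Nat.find_min hex (m := m)
      set c := Nat.find hex
      cases hcc : c with
      | zero => rw [hcc] at hc; simp at hc; linarith
      | succ b =>
        refine ⟨b, ?_, by rw [← hcc]; exact hc⟩
        have := hmin b (by omega)
        linarith
    have hbmem : b ∈ (Finset.range B).filter (fun b => 8 * 2 ^ b * R ≤ T) := by
      rw [Finset.mem_filter, Finset.mem_range]
      refine ⟨?_, hb1.trans hyT⟩
      by_contra hcon
      push Not at hcon
      have : (8 : ℝ) * 2 ^ B ≤ 8 * 2 ^ b * R := by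
        have h1 : (2 : ℝ) ^ B ≤ 2 ^ b := pow_le_pow_right₀ (by norm_num) hcon
        have h2 : (0:ℝ) < 2 ^ b := by positivity
        nlinarith
      linarith
    have h1 := Finset.single_le_sum hnn hbmem
    rw [Set.indicator_of_mem (by simpa using hb1.trans hyx)] at h1
    set t := 8 * 2 ^ b * R with ht
    have h2 : y ^ 2 ≤ 4 * t ^ 2 := by
      have : y ≤ 2 * t := by rw [ht]; rw [pow_succ] at hb2; linarith
      calc y ^ 2 ≤ (2 * t) ^ 2 := by gcongr
        _ = _ := by ring
    have h3 : θ * y ^ 2 ≤ 4 * θ * t ^ 2 := by nlinarith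
    have h4 := exp_sub_one_le_mul_exp (by positivity) h3
    have h5 : θ * y ^ 2 * Real.exp (4 * θ * t ^ 2) ≤
      4 * θ * t ^ 2 * Real.exp (4 * θ * t ^ 2) := by gcongr
    have h6 : 0 ≤ θ * Real.exp 64 * x ^ 2 := by positivity
    linarith

/-- A truncated Gaussian-type moment of a random variable with a Poissonian moment generating
function. -/
lemma integral_exp_truncated_sq_le (hl : 0 < lam)
    (hint : ∀ u : ℝ, Integrable (fun ω => Real.exp (u * X ω)) P)
    (hX : ∀ u : ℝ, ∫ ω, Real.exp (u * X ω) ∂P ≤ Real.exp (lam * (Real.exp |u| - 1 - |u|)))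
    (hm : Measurable X) {θ T : ℝ} (hθ : 0 < θ) (hT : 0 < T)
    (hθl : θ * max 1 lam ≤ 1) (hθT : 16 * T * θ ≤ Real.log (1 + T / lam)) :
    ∫ ω, Real.exp (θ * min (X ω ^ 2) (T ^ 2)) ∂P ≤ 1 + truncConst * θ * lam := by
  obtain ⟨B, hB⟩ : ∃ B : ℕ, T < 8 * 2 ^ B := by
    obtain ⟨B, hB⟩ := pow_unbounded_of_one_lt T (one_lt_two)
    exact ⟨B, by linarith [pow_pos (two_pos (α := ℝ)) B]⟩
  obtain ⟨hsq, hsql⟩ := integral_sq_le_of_mgf_le hl hint hX hm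
  set R := √(max 1 lam) with hR
  have hR1 : 1 ≤ R := Real.one_le_sqrt.2 (le_max_left _ _)
  have hRR : R ^ 2 = max 1 lam := Real.sq_sqrt (by positivity)
  set F := (Finset.range B).filter (fun b => 8 * 2 ^ b * R ≤ T) with hF
  set c : ℕ → ℝ := fun b => 4 * θ * (8 * 2 ^ b * R) ^ 2 *
            Real.exp (4 * θ * (8 * 2 ^ b * R) ^ 2) with hc
  have hmeas : ∀ b : ℕ, MeasurableSet {ω | 8 * 2 ^ b * R ≤ |X ω|} := fun b =>
    measurableSet_le measurable_const (by fun_prop)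
  have hindi : ∀ b : ℕ, Integrable
      (Set.indicator {ω | 8 * 2 ^ b * R ≤ |X ω|} (fun _ => c b)) P := fun b =>
    (integrable_const _).indicator (hmeas b)
  have hub : ∀ ω, Real.exp (θ * min (X ω ^ 2) (T ^ 2)) ≤ (1 + θ * Real.exp 64 * X ω ^ 2) +
      ∑ b ∈ F, Set.indicator {ω | 8 * 2 ^ b * R ≤ |X ω|} (fun _ => c b) ω := by
    intro ω
    exact exp_truncated_sq_le hθ hθl B hB hT.le (X ω)
  have hi1 : Integrable (fun ω => 1 + θ * Real.exp 64 * X ω ^ 2) P :=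
    (integrable_const _).add (hsq.const_mul _)
  have hi2 : Integrable (fun ω => ∑ b ∈ F,
      Set.indicator {ω | 8 * 2 ^ b * R ≤ |X ω|} (fun _ => c b) ω) P :=
    integrable_finsetSum _ fun b _ => hindi b
  have step : ∫ ω, Real.exp (θ * min (X ω ^ 2) (T ^ 2)) ∂P ≤
      1 + θ * Real.exp 64 * (4 * lam) + ∑ b ∈ F, P.real {ω | 8 * 2 ^ b * R ≤ |X ω|} * c b := by
    refine (integral_mono_of_nonneg (Filter.Eventually.of_forall fun ω => (Real.exp_pos _).le)
      (hi1.add hi2) (Filter.Eventually.of_forall hub)).trans ?_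
    simp only [Pi.add_apply]
    rw [integral_add hi1 hi2, integral_add (integrable_const _) (hsq.const_mul _),
      integral_const_mul, integral_finsetSum _ fun b _ => hindi b]
    simp only [integral_const, probReal_univ, one_smul, integral_indicator (hmeas _)]
    simp only [measureReal_restrict_apply_univ, smul_eq_mul]
    gcongr
  refine step.trans ?_
  have hterm : ∀ b ∈ F, P.real {ω | 8 * 2 ^ b * R ≤ |X ω|} * c b ≤
      3072 * (θ * lam) * (1 / 2) ^ b := by
    intro b hb
    have hbT : 8 * 2 ^ b * R ≤ T := (Finset.mem_filter.1 hb).2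
    have ht0 : 0 < 8 * 2 ^ b * R := by positivity
    have h1 := real_le_of_mgf_le hl hint hX ht0
    have h2 := dyadic_tail_exponent hl b
    rw [← hR] at h2
    have h3 := log_one_add_mul_le hl ht0 hbT
    have ht2 : (8 * 2 ^ b * R) ^ 2 = 64 * 4 ^ b * max 1 lam := by
      rw [mul_pow, mul_pow, hRR, ← pow_mul, mul_comm b 2, pow_mul]; norm_num
    simp only [hc]
    set t := 8 * 2 ^ b * R with ht
    have h4 : 4 * θ * t ^ 2 ≤ t / 4 * Real.log (1 + t / lam) := by
      calc 4 * θ * t ^ 2 = t / 4 * (t / T * (16 * T * θ)) := by field_simp; ring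
        _ ≤ t / 4 * (t / T * Real.log (1 + T / lam)) := by gcongr
        _ ≤ _ := by gcongr
    have hM : 0 < max 1 lam := by positivity
    calc P.real {ω | t ≤ |X ω|} * (4 * θ * t ^ 2 * Real.exp (4 * θ * t ^ 2))
        ≤ 2 * Real.exp (-(t / 2 * Real.log (1 + t / lam))) *
          (4 * θ * t ^ 2 * Real.exp (t / 4 * Real.log (1 + t / lam))) := by gcongr
      _ = 8 * θ * t ^ 2 * Real.exp (-(t / 4 * Real.log (1 + t / lam))) := by
          rw [show -(t / 4 * Real.log (1 + t / lam)) = -(t / 2 * Real.log (1 + t / lam)) +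
            t / 4 * Real.log (1 + t / lam) by ring, Real.exp_add]; ring
      _ ≤ 8 * θ * t ^ 2 * Real.exp (-(2 ^ b + Real.log (max 1 lam / lam))) := by gcongr
      _ = 512 * (θ * lam) * (4 ^ b * Real.exp (- 2 ^ b)) := by
          rw [neg_add, Real.exp_add, ← Real.log_inv, Real.exp_log (by positivity), ht2]
          field_simp
          ring
      _ ≤ 512 * (θ * lam) * (6 * (1 / 2) ^ b) := by
          exact mul_le_mul_of_nonneg_left (four_pow_mul_exp_neg_two_pow_le b) (by positivity)
      _ = _ := by ring
  have hsum : ∑ b ∈ F, P.real {ω | 8 * 2 ^ b * R ≤ |X ω|} * c b ≤ 6144 * (θ * lam) := by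
    calc _ ≤ ∑ b ∈ F, 3072 * (θ * lam) * (1 / 2) ^ b := Finset.sum_le_sum hterm
      _ ≤ ∑ b ∈ Finset.range B, 3072 * (θ * lam) * (1 / 2) ^ b :=
          Finset.sum_le_sum_of_subset_of_nonneg (Finset.filter_subset _ _)
            fun _ _ _ => by positivity
      _ = 3072 * (θ * lam) * ∑ b ∈ Finset.range B, (1 / 2 : ℝ) ^ b := by rw [Finset.mul_sum]
      _ ≤ 3072 * (θ * lam) * 2 := by gcongr; exact sum_geometric_two_le B
      _ = _ := by ring
  unfold truncConst
  nlinarith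

end OneVariable

/-- A family of independent Bernoulli variables with values `0` and `1`. -/
structure IsBernoulliFamily {E Ω : Type*} [MeasurableSpace Ω] (P : Measure Ω) (X : E → Ω → ℝ)
    (p : E → unitInterval) : Prop where
  measurable : ∀ e, Measurable (X e)
  indep : iIndepFun X P
  law : ∀ e, HasLaw (X e) (bernoulliMeasure (1 : ℝ) 0 (p e)) P

namespace IsBernoulliFamily

variable {E Ω : Type*} [MeasurableSpace Ω] {P : Measure Ω} [IsProbabilityMeasure P]
  {X : E → Ω → ℝ} {p : E → unitInterval}

omit [IsProbabilityMeasure P] in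
lemma integral_exp (h : IsBernoulliFamily P X p) (e : E) (c : ℝ) :
    ∫ ω, Real.exp (c * X e ω) ∂P = 1 + p e * (Real.exp c - 1) := by
  have := (h.law e).integral_comp (f := fun x : ℝ => Real.exp (c * x))
    (by fun_prop)
  simp only [Function.comp_def] at this
  rw [this, integral_bernoulliMeasure]
  simp
  ring

omit [IsProbabilityMeasure P] in
lemma ae_eq_zero_or_one (h : IsBernoulliFamily P X p) (e : E) :
    ∀ᵐ ω ∂P, X e ω = 0 ∨ X e ω = 1 := by
  have hm : Measurable fun x : ℝ => (x = 0 ∨ x = 1) := by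
    apply Measurable.or <;> exact measurableSet_setOfPred.1 (measurableSet_singleton _)
  rw [(h.law e).ae_iff hm, ae_iff, bernoulliMeasure_apply_of_notMem_of_notMem]
  · exact (measurableSet_setOfPred.2 hm).compl
  · simp
  · simp

omit [IsProbabilityMeasure P] in
lemma ae_forall [Countable E] (h : IsBernoulliFamily P X p) :
    ∀ᵐ ω ∂P, ∀ e, X e ω = 0 ∨ X e ω = 1 :=
  ae_all_iff.2 h.ae_eq_zero_or_one

lemma integrable_exp_sum [Countable E] (h : IsBernoulliFamily P X p) (S : Finset E) (c : E → ℝ) :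
    Integrable (fun ω => Real.exp (∑ e ∈ S, c e * X e ω)) P := by
  have hm := h.measurable
  refine Integrable.of_bound (by fun_prop) (Real.exp (∑ e ∈ S, |c e|)) ?_
  filter_upwards [h.ae_forall] with ω hω
  rw [Real.norm_eq_abs, Real.abs_exp, Real.exp_le_exp]
  refine Finset.sum_le_sum fun e _ => ?_
  rcases hω e with h | h <;> simp [h, le_abs_self]

omit [IsProbabilityMeasure P] in
lemma integral_exp_sum [Countable E] (h : IsBernoulliFamily P X p) (S : Finset E) (c : E → ℝ) :
    ∫ ω, Real.exp (∑ e ∈ S, c e * X e ω) ∂P ≤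
      Real.exp (∑ e ∈ S, p e * (Real.exp (c e) - 1)) := by
  have hm := h.measurable
  have h1 : iIndepFun (fun e ω => c e * X e ω) P :=
    h.indep.comp (fun e x => c e * x) (fun e => by fun_prop)
  have h2 := h1.mgf_sum (t := 1) (fun e => by fun_prop) S
  simp only [mgf, Finset.sum_apply, one_mul] at h2
  rw [h2, Real.exp_sum]
  refine Finset.prod_le_prod (fun e _ => integral_nonneg fun ω => (Real.exp_pos _).le) fun e _ => ?_
  rw [h.integral_exp]
  linarith [Real.add_one_le_exp (p e * (Real.exp (c e) - 1))]

lemma measure_sum_ge_le [Countable E] (h : IsBernoulliFamily P X p) (S : Finset E) (c : E → ℝ)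
    (t : ℝ) :
    P.real {ω | t ≤ ∑ e ∈ S, c e * X e ω} ≤
      Real.exp (∑ e ∈ S, p e * (Real.exp (c e) - 1) - t) := by
  have h1 := measure_ge_le_exp_mul_mgf (μ := P) (X := fun ω => ∑ e ∈ S, c e * X e ω) (t := 1) t
    zero_le_one (by simpa using h.integrable_exp_sum S c)
  refine h1.trans ?_
  simp only [mgf, one_mul, neg_mul]
  calc _ ≤ Real.exp (-t) * Real.exp (∑ e ∈ S, p e * (Real.exp (c e) - 1)) := by
        gcongr; exact h.integral_exp_sum S c
    _ = _ := by rw [← Real.exp_add]; ring_nf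

/-- The centered sum over a set of indices. -/
lemma integral_exp_centered [Countable E] (h : IsBernoulliFamily P X p) (S : Finset E) (w : E → ℝ)
    (hw : ∀ e, w e = 0 ∨ w e = 1 ∨ w e = -1) {lam : ℝ} (hl : ∑ e ∈ S, |w e| * p e ≤ lam) (u : ℝ) :
    Integrable (fun ω => Real.exp (u * ∑ e ∈ S, w e * (X e ω - p e))) P ∧
    ∫ ω, Real.exp (u * ∑ e ∈ S, w e * (X e ω - p e)) ∂P ≤
      Real.exp (lam * (Real.exp |u| - 1 - |u|)) := by
  have heq : ∀ ω, Real.exp (u * ∑ e ∈ S, w e * (X e ω - p e)) =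
      Real.exp (-(∑ e ∈ S, u * w e * p e)) * Real.exp (∑ e ∈ S, (u * w e) * X e ω) := by
    intro ω
    rw [← Real.exp_add, Finset.mul_sum, ← Finset.sum_neg_distrib, ← Finset.sum_add_distrib]
    congr 1
    refine Finset.sum_congr rfl fun e _ => by ring
  simp_rw [heq]
  refine ⟨(h.integrable_exp_sum S _).const_mul _, ?_⟩
  rw [integral_const_mul]
  refine (mul_le_mul_of_nonneg_left (h.integral_exp_sum S _) (Real.exp_pos _).le).trans ?_
  rw [← Real.exp_add, Real.exp_le_exp, ← Finset.sum_neg_distrib, ← Finset.sum_add_distrib]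
  have hg : ∀ v : ℝ, Real.exp v - 1 - v ≤ Real.exp |v| - 1 - |v| := by
    intro v
    rcases abs_cases v with ⟨h, _⟩ | ⟨h, h'⟩
    · rw [h]
    · have := exp_neg_sub_one_add_le (x := -v) (by linarith)
      rw [h]; simpa using this
  have hg0 := exp_sub_one_sub_nonneg |u|
  have hterm : ∀ e ∈ S, -(u * w e * p e) + p e * (Real.exp (u * w e) - 1) ≤
      (|w e| * p e) * (Real.exp |u| - 1 - |u|) := by
    intro e _
    have hp := (p e).2.1
    have : -(u * w e * p e) + p e * (Real.exp (u * w e) - 1) =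
      p e * (Real.exp (u * w e) - 1 - u * w e) := by ring
    rw [this]
    rcases hw e with h | h | h
    · simp [h]
    · simp only [h, mul_one, abs_one, one_mul]
      exact mul_le_mul_of_nonneg_left (hg u) hp
    · simp only [h, mul_neg, mul_one, abs_neg, abs_one, one_mul]
      have := hg (-u)
      rw [abs_neg] at this
      exact mul_le_mul_of_nonneg_left this hp
  refine (Finset.sum_le_sum hterm).trans ?_
  rw [← Finset.sum_mul]
  gcongr

variable [Fintype E] [DecidableEq E] {ι : Type*} [DecidableEq ι]

/-- Exponential moments of functions of disjoint groups of the variables factor. -/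
lemma integral_exp_sum_rows (h : IsBernoulliFamily P X p) (row : E → ι) (f : ι → (E → ℝ) → ℝ)
    (hf : ∀ i, Measurable (f i))
    (hdep : ∀ i, ∀ x y : E → ℝ, (∀ e, row e = i → x e = y e) → f i x = f i y) (s : Finset ι) :
    ∫ ω, Real.exp (∑ i ∈ s, f i fun e => X e ω) ∂P =
      ∏ i ∈ s, ∫ ω, Real.exp (f i fun e => X e ω) ∂P := by
  have hm := h.measurable
  induction s using Finset.induction_on with
  | empty => simp
  | insert a s ha ih =>
    rw [Finset.prod_insert ha, ← ih]
    simp_rw [Finset.sum_insert ha, Real.exp_add]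
    let S : Finset E := Finset.univ.filter fun e => row e = a
    let T : Finset E := Finset.univ.filter fun e => row e ∈ s
    have hST : Disjoint S T := by
      rw [Finset.disjoint_left]
      intro e he he'
      simp only [S, T, Finset.mem_filter, Finset.mem_univ, true_and] at he he'
      exact ha (he ▸ he')
    let extS : (S → ℝ) → E → ℝ := fun x e => if he : e ∈ S then x ⟨e, he⟩ else 0
    let extT : (T → ℝ) → E → ℝ := fun x e => if he : e ∈ T then x ⟨e, he⟩ else 0
    have hmS : Measurable extS := by
      refine measurable_pi_lambda _ fun e => ?_
      by_cases he : e ∈ S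
      · simp only [extS, he, dite_true]; fun_prop
      · simp only [extS, he, dite_false]; fun_prop
    have hmT : Measurable extT := by
      refine measurable_pi_lambda _ fun e => ?_
      by_cases he : e ∈ T
      · simp only [extT, he, dite_true]; fun_prop
      · simp only [extT, he, dite_false]; fun_prop
    have hind := (h.indep.indepFun_finset S T hST h.measurable).comp
      (φ := fun x => Real.exp (f a (extS x)))
      (ψ := fun x => Real.exp (∑ i ∈ s, f i (extT x)))
      (by have := hf a; fun_prop) (by fun_prop)
    have e1 : ∀ ω, f a (extS fun e => X e ω) = f a fun e => X e ω := by
      intro ω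
      refine hdep a _ _ fun e he => ?_
      have : e ∈ S := by simp [S, he]
      simp [extS, this]
    have e2 : ∀ ω, ∑ i ∈ s, f i (extT fun e => X e ω) = ∑ i ∈ s, f i fun e => X e ω := by
      intro ω
      refine Finset.sum_congr rfl fun i hi => hdep i _ _ fun e he => ?_
      have : e ∈ T := by simp [T, he, hi]
      simp [extT, this]
    have hmul := hind.integral_fun_mul_eq_mul_integral
      (by have := hf a
          have : Measurable fun ω (i : S) => X i ω := measurable_pi_lambda _ fun e => hm e
          exact (by fun_prop : Measurable fun x => Real.exp (f a (extS x))).comp this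
            |>.aestronglyMeasurable)
      (by have : Measurable fun ω (i : T) => X i ω := measurable_pi_lambda _ fun e => hm e
          exact (by fun_prop : Measurable fun x => Real.exp (∑ i ∈ s, f i (extT x))).comp this
            |>.aestronglyMeasurable)
    simp only [Function.comp_def, e1, e2] at hmul
    exact hmul

/-- Upper tail of the sum of the truncated squares of the centered sums over the rows. -/
lemma measure_sum_rows_ge_le (h : IsBernoulliFamily P X p) (row : E → ι) (w : E → ℝ)
    (hw : ∀ e, w e = 0 ∨ w e = 1 ∨ w e = -1) {lam : ℝ} (hl0 : 0 < lam) [Fintype ι]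
    (hl : ∀ i, ∑ e with row e = i, |w e| * p e ≤ lam) {θ T : ℝ} (hθ : 0 < θ) (hT : 0 < T)
    (hθl : θ * max 1 lam ≤ 1) (hθT : 16 * T * θ ≤ Real.log (1 + T / lam)) (B : ℝ) :
    P.real {ω | B ≤ ∑ i, min ((∑ e with row e = i, w e * (X e ω - p e)) ^ 2) (T ^ 2)} ≤
      Real.exp (Fintype.card ι * (truncConst * θ * lam) - θ * B) := by
  have hm := h.measurable
  let v : ι → (E → ℝ) → ℝ := fun i x => ∑ e with row e = i, w e * (x e - p e)
  let f : ι → (E → ℝ) → ℝ := fun i x => θ * min (v i x ^ 2) (T ^ 2)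
  have hvm : ∀ i, Measurable (v i) := fun i => by
    simp only [v]; fun_prop
  have hfm : ∀ i, Measurable (f i) := fun i => by
    have := hvm i; simp only [f]; fun_prop
  have hdep : ∀ i, ∀ x y : E → ℝ, (∀ e, row e = i → x e = y e) → f i x = f i y := by
    intro i x y hxy
    have : v i x = v i y := Finset.sum_congr rfl fun e he => by
      rw [hxy e (Finset.mem_filter.1 he).2]
    simp only [f, this]
  have hX : Measurable fun ω => fun e => X e ω := measurable_pi_lambda _ h.measurable
  have hprod := h.integral_exp_sum_rows row f hfm hdep Finset.univ
  have hrow : ∀ i, ∫ ω, Real.exp (f i fun e => X e ω) ∂P ≤ Real.exp (truncConst * θ * lam) := by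
    intro i
    have h1 := fun u => h.integral_exp_centered (Finset.univ.filter fun e => row e = i) w hw (hl i) u
    have := integral_exp_truncated_sq_le (P := P) hl0 (fun u => (h1 u).1) (fun u => (h1 u).2)
      (by fun_prop) hθ hT hθl hθT
    refine this.trans ?_
    linarith [Real.add_one_le_exp (truncConst * θ * lam)]
  have hint : Integrable (fun ω => Real.exp (∑ i, f i fun e => X e ω)) P := by
    have hfe : Measurable fun x : E → ℝ => Real.exp (∑ i, f i x) := by fun_prop
    refine Integrable.of_bound (hfe.comp hX).aestronglyMeasurable
      (Real.exp (∑ i : ι, θ * T ^ 2)) ?_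
    refine Filter.Eventually.of_forall fun ω => ?_
    rw [Real.norm_eq_abs, Real.abs_exp, Real.exp_le_exp]
    refine Finset.sum_le_sum fun i _ => ?_
    simp only [f]
    gcongr
    exact min_le_right _ _
  have hsum : ∀ ω, θ * ∑ i, min ((∑ e with row e = i, w e * (X e ω - p e)) ^ 2) (T ^ 2) =
      ∑ i, f i fun e => X e ω := fun ω => by rw [Finset.mul_sum]
  have h1 := measure_ge_le_exp_mul_mgf (μ := P)
    (X := fun ω => ∑ i, min ((∑ e with row e = i, w e * (X e ω - p e)) ^ 2) (T ^ 2)) (t := θ) B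
    hθ.le (by simp_rw [hsum]; exact hint)
  refine h1.trans ?_
  simp only [mgf, hsum]
  rw [hprod]
  calc _ ≤ Real.exp (-θ * B) * ∏ i : ι, Real.exp (truncConst * θ * lam) := by
        gcongr with i
        exact hrow i
    _ = _ := by
        rw [Finset.prod_const, ← Real.exp_nat_mul, ← Real.exp_add, Finset.card_univ]
        ring_nf

end IsBernoulliFamily

/-- Hyperedges, given by their increasing enumeration. -/
abbrev Edge (d n : ℕ) : Type := {e : Fin d → Fin n // StrictMono e}

noncomputable instance (d n : ℕ) : Fintype (Edge d n) := Fintype.ofFinite _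

/-- Symmetric tensors which vanish at the tuples with a repeated index. -/
structure IsHypergraphTensor {d n : ℕ} (A : Tensor d n) : Prop where
  symm : ∀ j (σ : Equiv.Perm (Fin d)), A (j ∘ σ) = A j
  diag : ∀ j, ¬ Function.Injective j → A j = 0

open Classical in
lemma sum_injective_eq {d n : ℕ} (F : (Fin d → Fin n) → ℝ) :
    ∑ j with Function.Injective j, F j = ∑ e : Edge d n, ∑ τ : Equiv.Perm (Fin d), F (e.1 ∘ τ) := by
  rw [← Fintype.sum_prod_type']
  symm
  refine Finset.sum_bij (fun x _ => x.1.1 ∘ x.2) ?_ ?_ ?_ ?_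
  · intro x _
    simp only [Finset.mem_filter, Finset.mem_univ, true_and]
    exact x.1.2.injective.comp x.2.injective
  · rintro ⟨⟨e, he⟩, τ⟩ _ ⟨⟨f, hf⟩, ρ⟩ _ h
    simp only at h
    have h1 : f = e ∘ (τ * ρ⁻¹ : Equiv.Perm (Fin d)) := by
      ext t
      have := congrFun h (ρ⁻¹ t)
      simp only [Function.comp_apply, Equiv.Perm.inv_def, Equiv.apply_symm_apply] at this
      simp [this]
    have h2 : e ∘ (1 : Equiv.Perm (Fin d)) = e ∘ (τ * ρ⁻¹ : Equiv.Perm (Fin d)) :=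
      Tuple.unique_monotone (by simpa using he.monotone) (by rw [← h1]; exact hf.monotone)
    have h3 : τ * ρ⁻¹ = 1 := by
      ext t
      have := congrFun h2 t
      simpa using congrArg Fin.val (he.injective this).symm
    have h4 : τ = ρ := by simpa using mul_inv_eq_one.1 h3
    subst h4
    have : e = f := by rw [h1]; simp
    subst this
    rfl
  · intro j hj
    simp only [Finset.mem_filter, Finset.mem_univ, true_and] at hj
    refine ⟨(⟨j ∘ Tuple.sort j, (Tuple.monotone_sort j).strictMono_of_injective
      (hj.comp (Tuple.sort j).injective)⟩, (Tuple.sort j)⁻¹), Finset.mem_univ _, ?_⟩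
    ext t
    simp
  · intro x _
    rfl

lemma sum_perm_apply_zero {d : ℕ} [NeZero d] (g : Fin d → ℝ) :
    ∑ τ : Equiv.Perm (Fin d), g (τ 0) = ((d - 1).factorial : ℝ) * ∑ r, g r := by
  obtain ⟨k, rfl⟩ : ∃ k, d = k + 1 := ⟨d - 1, (Nat.succ_pred_eq_of_ne_zero (NeZero.ne d)).symm⟩
  rw [← Equiv.sum_comp (Equiv.Perm.decomposeFin (n := k)).symm, Fintype.sum_prod_type]
  have : ∀ (p : Fin (k + 1)) (e : Equiv.Perm (Fin k)),
      (Equiv.Perm.decomposeFin.symm (p, e)) 0 = p := fun p e =>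
    Equiv.Perm.decomposeFin_symm_apply_zero p e
  simp only [this, Finset.sum_const, Finset.card_univ, Fintype.card_perm, Fintype.card_fin,
    nsmul_eq_mul, Finset.mul_sum, Nat.add_sub_cancel]

section

variable {d n K : ℕ} [NeZero d]

open Classical in
lemma multilinearOp_eq_sum_injective {A : Tensor d n} (hA : ∀ j, ¬ Function.Injective j → A j = 0)
    (H : Matrix (Fin n) (Fin K) ℝ) (i : Fin n) (k : Fin K) :
    multilinearOp A H i k = ∑ j with Function.Injective j,
      if j 0 = i then A j * ∏ r ∈ Finset.univ.erase (0 : Fin d), H (j r) k else 0 := by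
  simp only [multilinearOp, Matrix.of_apply]
  rw [Finset.sum_filter, Finset.sum_filter]
  refine Finset.sum_congr rfl fun j _ => ?_
  by_cases h : Function.Injective j
  · simp [h]
  · simp [h, hA j h]

/-- The multilinear operation as a sum over the hyperedges. -/
lemma multilinearOp_eq_sum_edges {A : Tensor d n} (hA : IsHypergraphTensor A)
    (H : Matrix (Fin n) (Fin K) ℝ) (i : Fin n) (k : Fin K) :
    multilinearOp A H i k = ((d - 1).factorial : ℝ) * ∑ r : Fin d, ∑ e : Edge d n with e.1 r = i,
      A e.1 * ∏ t ∈ Finset.univ.erase r, H (e.1 t) k := by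
  rw [multilinearOp_eq_sum_injective hA.diag, sum_injective_eq]
  have h1 : ∀ (e : Edge d n) (τ : Equiv.Perm (Fin d)),
      (if (e.1 ∘ τ) 0 = i then A (e.1 ∘ τ) *
        ∏ r ∈ Finset.univ.erase (0 : Fin d), H ((e.1 ∘ τ) r) k else 0) =
      (fun r => if e.1 r = i then A e.1 * ∏ t ∈ Finset.univ.erase r, H (e.1 t) k else 0) (τ 0) := by
    intro e τ
    simp only [Function.comp_apply, hA.symm e.1 τ]
    congr 2
    refine Finset.prod_bij (fun r _ => τ r) ?_ ?_ ?_ ?_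
    · intro r hr
      simpa using hr
    · intro a _ b _ h
      exact τ.injective h
    · intro b hb
      refine ⟨τ.symm b, ?_, by simp⟩
      simp only [Finset.mem_erase, Finset.mem_univ, and_true, ne_eq] at hb ⊢
      intro h
      apply hb
      rw [← h]; simp
    · intro r _
      rfl
  rw [Finset.sum_congr rfl fun e _ => (Finset.sum_congr rfl fun τ _ => h1 e τ).trans
    (sum_perm_apply_zero fun r => if e.1 r = i then A e.1 *
      ∏ t ∈ Finset.univ.erase r, H (e.1 t) k else 0), ← Finset.mul_sum]
  congr 1
  rw [Finset.sum_comm]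
  refine Finset.sum_congr rfl fun r _ => ?_
  rw [Finset.sum_filter]

lemma multilinearOp_sub (A B : Tensor d n) (H : Matrix (Fin n) (Fin K) ℝ) :
    multilinearOp (A - B) H = multilinearOp A H - multilinearOp B H := by
  ext i k
  simp [multilinearOp, sub_mul, Finset.sum_sub_distrib]

open Classical in
lemma card_injective_tuples (i : Fin n) (S : Finset (Fin n)) :
    (Finset.univ.filter fun j : Fin d → Fin n =>
      Function.Injective j ∧ j 0 = i ∧ ∀ t, t ≠ 0 → j t ∈ S).card =
      (S.erase i).card.descFactorial (d - 1) := by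
  obtain ⟨k, rfl⟩ : ∃ k, d = k + 1 := ⟨d - 1, (Nat.succ_pred_eq_of_ne_zero (NeZero.ne d)).symm⟩
  have h0 : (Fintype.card (Fin k ↪ ↥(S.erase i))) = (S.erase i).card.descFactorial k := by
    rw [Fintype.card_embedding_eq, Fintype.card_coe, Fintype.card_fin]
  rw [Nat.add_sub_cancel, ← h0, ← Finset.card_univ]
  symm
  refine Finset.card_bij (fun f _ => Fin.cons i fun t => (f t : Fin n)) ?_ ?_ ?_
  · intro f _
    simp only [Finset.mem_filter, Finset.mem_univ, true_and]
    refine ⟨?_, by exact Fin.cons_zero _ _, ?_⟩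
    · rw [Fin.cons_injective_iff]
      refine ⟨?_, fun a b h => f.injective (Subtype.ext h)⟩
      rintro ⟨t, ht⟩
      have := (f t).2
      simp only at ht
      rw [ht] at this
      simp at this
    · intro t ht
      obtain ⟨s, rfl⟩ := Fin.exists_succ_eq.2 ht
      rw [Fin.cons_succ]
      exact Finset.mem_of_mem_erase (f s).2
  · intro f _ g _ h
    ext t
    have := congrFun h t.succ
    simp only [Fin.cons_succ] at this
    exact congrArg _ this
  · intro j hj
    simp only [Finset.mem_filter, Finset.mem_univ, true_and] at hj
    obtain ⟨hinj, hj0, hjS⟩ := hj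
    refine ⟨⟨fun t => ⟨j t.succ, ?_⟩, ?_⟩, Finset.mem_univ _, ?_⟩
    · rw [Finset.mem_erase]
      refine ⟨?_, hjS _ (Fin.succ_ne_zero t)⟩
      rw [← hj0]
      intro h
      exact Fin.succ_ne_zero t (hinj h)
    · intro a b h
      have := hinj (Subtype.ext_iff.1 h)
      exact Fin.succ_injective _ this
    · ext t
      refine Fin.cases ?_ (fun s => ?_) t
      · simp only [Fin.cons_zero]; rw [← hj0]
      · rfl

/-- The membership matrix of a labelling of the nodes. -/
def labelMatrix (c : Fin n → Fin K) : Matrix (Fin n) (Fin K) ℝ :=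
  Matrix.of fun i k => if c i = k then 1 else 0

lemma labelMatrix_apply (c : Fin n → Fin K) (i : Fin n) (k : Fin K) :
    labelMatrix c i k = if c i = k then 1 else 0 := rfl

lemma exists_labelMatrix {H : Matrix (Fin n) (Fin K) ℝ} (hH : H ∈ membership n K) :
    ∃ c, H = labelMatrix c := by
  obtain ⟨h01, hsum⟩ := hH
  have hex : ∀ i, ∃ k, H i k = 1 := by
    intro i
    by_contra hcon
    push Not at hcon
    have : ∀ k, H i k = 0 := fun k => (h01 i k).resolve_right (hcon k)
    have := hsum i
    simp_all
  choose c hc using hex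
  refine ⟨c, ?_⟩
  ext i k
  rw [labelMatrix_apply]
  split_ifs with h
  · rw [← h, hc]
  · have h1 := hsum i
    rw [← Finset.add_sum_erase _ _ (Finset.mem_univ (c i)), hc] at h1
    have h2 : ∑ k ∈ Finset.univ.erase (c i), H i k = 0 := by linarith
    rw [Finset.sum_eq_zero_iff_of_nonneg] at h2
    · exact h2 k (by simp [Ne.symm h])
    · intro k _
      rcases h01 i k with h | h <;> simp [h]

/-- The community with label `k`. -/
def community (c : Fin n → Fin K) (k : Fin K) : Finset (Fin n) :=
  Finset.univ.filter fun i => c i = k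

lemma mem_community {c : Fin n → Fin K} {k : Fin K} {i : Fin n} : i ∈ community c k ↔ c i = k := by
  simp [community]

lemma labelMatrix_mem_balanced {c : Fin n → Fin K} :
    labelMatrix c ∈ balanced n K ↔ ∀ k, ((community c k).card : ℝ) = n / K := by
  simp only [balanced, membership, Set.mem_ofPred_eq]
  have h1 : ∀ i k, labelMatrix c i k = 0 ∨ labelMatrix c i k = 1 := by
    intro i k
    rw [labelMatrix_apply]; split_ifs <;> simp
  have h2 : ∀ i, ∑ k, labelMatrix c i k = 1 := by
    intro i; simp [labelMatrix_apply]
  have h3 : ∀ k, ∑ i, labelMatrix c i k = (community c k).card := by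
    intro k; simp [labelMatrix_apply, community]
  simp [h1, h2, h3]

lemma exists_labelMatrix_of_balanced {H : Matrix (Fin n) (Fin K) ℝ} (hH : H ∈ balanced n K) :
    ∃ c, H = labelMatrix c ∧ ∀ k, ((community c k).card : ℝ) = n / K := by
  obtain ⟨c, rfl⟩ := exists_labelMatrix hH.1
  exact ⟨c, rfl, labelMatrix_mem_balanced.1 hH⟩

lemma relabel_apply (H : Matrix (Fin n) (Fin K) ℝ) (σ : Equiv.Perm (Fin K)) (i : Fin n)
    (k : Fin K) : relabel H σ i k = H i (σ.symm k) := by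
  simp [relabel, Equiv.Perm.permMatrix, PEquiv.mul_toMatrix_toPEquiv]

lemma relabel_labelMatrix (c : Fin n → Fin K) (σ : Equiv.Perm (Fin K)) :
    relabel (labelMatrix c) σ = labelMatrix (σ ∘ c) := by
  ext i k
  rw [relabel_apply, labelMatrix_apply, labelMatrix_apply]
  simp [Equiv.eq_symm_apply]

lemma community_perm (c : Fin n → Fin K) (σ : Equiv.Perm (Fin K)) (k : Fin K) :
    community (σ ∘ c) k = community c (σ.symm k) := by
  ext i
  simp [mem_community, Equiv.eq_symm_apply]

lemma edgeProb_labelMatrix (p q : unitInterval) (c : Fin n → Fin K) (j : Fin d → Fin n) :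
    edgeProb p q (labelMatrix c) j = if ∀ t, c (j t) = c (j 0) then p else q := by
  have h : ∑ k, ∏ r, labelMatrix c (j r) k = if ∀ t, c (j t) = c (j 0) then 1 else 0 := by
    have : ∀ k, ∏ r, labelMatrix c (j r) k = if ∀ t, c (j t) = k then 1 else 0 := by
      intro k
      simp only [labelMatrix_apply]
      rw [Finset.prod_ite_zero]
      simp
    simp_rw [this]
    rw [Finset.sum_eq_single (c (j 0))]
    · intro k _ hk
      rw [if_neg]
      intro h
      exact hk (h 0).symm
    · simp
  unfold edgeProb
  rw [h]
  by_cases hc : ∀ t, c (j t) = c (j 0)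
  · simp [hc]
  · simp [hc]

lemma frobenius_sq (M : Matrix (Fin n) (Fin K) ℝ) : ‖M‖ ^ 2 = ∑ i, ∑ k, M i k ^ 2 := by
  rw [Matrix.frobenius_norm_def, ← Real.sqrt_eq_rpow, Real.sq_sqrt]
  · simp
  · exact Finset.sum_nonneg fun i _ => Finset.sum_nonneg fun k _ => by positivity

lemma frobenius_le_of_sq_le {M : Matrix (Fin n) (Fin K) ℝ} {a : ℝ} (ha : 0 ≤ a)
    (h : ∑ i, ∑ k, M i k ^ 2 ≤ a ^ 2) : ‖M‖ ≤ a := by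
  rw [← frobenius_sq] at h
  exact le_of_sq_le_sq h ha

lemma frobenius_mono {M N : Matrix (Fin n) (Fin K) ℝ} (h : ∀ i k, |M i k| ≤ N i k) :
    ‖M‖ ≤ ‖N‖ := by
  apply frobenius_le_of_sq_le (norm_nonneg _)
  rw [frobenius_sq]
  exact Finset.sum_le_sum fun i _ => Finset.sum_le_sum fun k _ =>
    sq_le_sq.2 ((h i k).trans (le_abs_self _))

lemma labelMatrix_sub_norm_sq (b c : Fin n → Fin K) :
    ‖labelMatrix b - labelMatrix c‖ ^ 2 = 2 * (Finset.univ.filter fun i => b i ≠ c i).card := by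
  rw [frobenius_sq]
  have : ∀ i, ∑ k, (labelMatrix b - labelMatrix c) i k ^ 2 = if b i ≠ c i then 2 else 0 := by
    intro i
    simp only [Matrix.sub_apply, labelMatrix_apply]
    by_cases h : b i = c i
    · simp [h]
    · simp only [ne_eq, h, not_false_eq_true, if_true]
      have hx : ∀ k, ((if b i = k then (1:ℝ) else 0) - if c i = k then 1 else 0) ^ 2 =
        (if b i = k then 1 else 0) + if c i = k then 1 else 0 := by
        intro k
        by_cases h1 : b i = k
        · have : c i ≠ k := fun h2 => h (h1.trans h2.symm)
          simp [h1, this]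
        · by_cases h2 : c i = k <;> simp [h1, h2]
      simp_rw [hx, Finset.sum_add_distrib]
      simp
      norm_num
  simp_rw [this]
  rw [← Finset.sum_filter]
  simp [mul_comm]

end

lemma descFactorial_sub_le {M : ℝ} (k : ℕ) {x y : ℕ} (hxy : x ≤ y) (hy : (y : ℝ) ≤ M) :
    ((y.descFactorial (k + 1) : ℕ) : ℝ) - (x.descFactorial (k + 1) : ℕ) ≤
      (k + 1) * M ^ k * ((y : ℝ) - x) := by
  induction y, hxy using Nat.le_induction with
  | base => simp
  | succ z hz ih =>
    have hz' : (z : ℝ) ≤ M := le_trans (by push_cast; linarith) hy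
    have h1 := ih hz'
    have h2 : (((z + 1).descFactorial (k + 1) : ℕ) : ℝ) - (z.descFactorial (k + 1) : ℕ) =
        (k + 1) * (z.descFactorial k : ℕ) := by
      rw [Nat.succ_descFactorial_succ, Nat.descFactorial_succ]
      rcases le_or_gt k z with h | h
      · push_cast [h]; ring
      · rw [Nat.descFactorial_of_lt h]; simp
    have h3 : ((z.descFactorial k : ℕ) : ℝ) ≤ M ^ k := by
      calc ((z.descFactorial k : ℕ) : ℝ) ≤ ((z ^ k : ℕ) : ℝ) := by
            exact_mod_cast Nat.descFactorial_le_pow z k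
        _ = (z : ℝ) ^ k := by push_cast; rfl
        _ ≤ M ^ k := by gcongr
    have h4 : (k + 1) * ((z.descFactorial k : ℕ) : ℝ) ≤ (k + 1) * M ^ k := by gcongr
    push_cast
    linarith

lemma descFactorial_mono_left (k : ℕ) {x y : ℕ} (h : x ≤ y) :
    x.descFactorial k ≤ y.descFactorial k := by
  induction k with
  | zero => simp
  | succ k ih =>
    rw [Nat.descFactorial_succ, Nat.descFactorial_succ]
    exact Nat.mul_le_mul (by omega) ih

lemma abs_descFactorial_sub_le {M : ℝ} (k : ℕ) {x y : ℕ} (hx : (x : ℝ) ≤ M) (hy : (y : ℝ) ≤ M) :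
    |((y.descFactorial (k + 1) : ℕ) : ℝ) - (x.descFactorial (k + 1) : ℕ)| ≤
      (k + 1) * M ^ k * |(y : ℝ) - x| := by
  wlog h : x ≤ y generalizing x y
  · rw [abs_sub_comm, abs_sub_comm (y : ℝ)]
    exact this hy hx (by omega)
  · have h0 : ((x.descFactorial (k + 1) : ℕ) : ℝ) ≤ (y.descFactorial (k + 1) : ℕ) := by
      exact_mod_cast descFactorial_mono_left _ h
    have hxy : (x : ℝ) ≤ y := by exact_mod_cast h
    rw [abs_of_nonneg (by linarith), abs_of_nonneg (by linarith)]
    exact descFactorial_sub_le k h hy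

section

variable {d n K : ℕ} [NeZero d]

open Classical in
/-- The expectation of the adjacency tensor. -/
noncomputable def meanTensor (p q : unitInterval) (Hstar : Matrix (Fin n) (Fin K) ℝ) :
    Tensor d n :=
  fun j => if Function.Injective j then (edgeProb p q Hstar j : ℝ) else 0

omit [NeZero d] in
lemma isHypergraphTensor_meanTensor (p q : unitInterval) (Hstar : Matrix (Fin n) (Fin K) ℝ) :
    IsHypergraphTensor (meanTensor (d := d) p q Hstar) where
  symm j σ := by
    have h1 : Function.Injective (j ∘ σ) ↔ Function.Injective j :=
      σ.injective_comp j
    have h2 : edgeProb p q Hstar (j ∘ σ) = edgeProb p q Hstar j := by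
      have : ∀ k, ∏ r, Hstar ((j ∘ σ) r) k = ∏ r, Hstar (j r) k := fun k =>
        Equiv.prod_comp σ fun r => Hstar (j r) k
      simp only [edgeProb, this]
    simp only [meanTensor, h1, h2]
  diag j hj := by simp [meanTensor, hj]

open Classical in
/-- Closed form of the multilinear operation for tensors which are constant on the hyperedges inside
the communities and on the remaining hyperedges. -/
lemma multilinearOp_planted (x y : ℝ) (b c : Fin n → Fin K) (i : Fin n) (k : Fin K) :
    multilinearOp (fun j : Fin d → Fin n => if Function.Injective j then
        (if ∀ t, c (j t) = c (j 0) then x else y) else 0) (labelMatrix b) i k =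
      y * ((((community b k).erase i).card.descFactorial (d - 1) : ℕ) : ℝ) + (x - y) *
        ((((community c (c i) ∩ community b k).erase i).card.descFactorial (d - 1) : ℕ) : ℝ) := by
  rw [multilinearOp_eq_sum_injective (fun j hj => by simp [hj]), ← card_injective_tuples,
    ← card_injective_tuples, Finset.card_filter, Finset.card_filter, Finset.sum_filter]
  push_cast
  rw [Finset.mul_sum, Finset.mul_sum, ← Finset.sum_add_distrib]
  refine Finset.sum_congr rfl fun j _ => ?_
  have hprod : ∏ r ∈ Finset.univ.erase (0 : Fin d), labelMatrix b (j r) k =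
      if ∀ t, t ≠ 0 → j t ∈ community b k then 1 else 0 := by
    simp only [labelMatrix_apply]
    rw [Finset.prod_ite_zero]
    simp [mem_community]
  rw [hprod]
  by_cases h1 : Function.Injective j
  · by_cases h2 : j 0 = i
    · subst h2
      by_cases h3 : ∀ t, t ≠ 0 → j t ∈ community b k
      · have h4 : (∀ t, t ≠ 0 → j t ∈ community c (c (j 0)) ∩ community b k) ↔
            ∀ t, c (j t) = c (j 0) := by
          simp only [Finset.mem_inter, mem_community]
          constructor
          · intro h t
            by_cases ht : t = 0
            · rw [ht]
            · exact (h t ht).1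
          · intro h t ht
            exact ⟨h t, mem_community.1 (h3 t ht)⟩
        by_cases h5 : ∀ t, c (j t) = c (j 0)
        · rw [if_pos h1, if_pos rfl, if_pos h1, if_pos h5, if_pos h3, if_pos ⟨h1, rfl, h3⟩,
            if_pos ⟨h1, rfl, h4.2 h5⟩]
          ring
        · rw [if_pos h1, if_pos rfl, if_pos h1, if_neg h5, if_pos h3, if_pos ⟨h1, rfl, h3⟩,
            if_neg fun h => h5 (h4.1 h.2.2)]
          ring
      · have h4 : ¬ ∀ t, t ≠ 0 → j t ∈ community c (c (j 0)) ∩ community b k := fun h =>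
          h3 fun t ht => (Finset.mem_inter.1 (h t ht)).2
        have h5 : ¬ (Function.Injective j ∧ j 0 = j 0 ∧ ∀ t, t ≠ 0 → j t ∈ community b k) :=
          fun h => h3 h.2.2
        have h6 : ¬ (Function.Injective j ∧ j 0 = j 0 ∧
          ∀ t, t ≠ 0 → j t ∈ community c (c (j 0)) ∩ community b k) := fun h => h4 h.2.2
        rw [if_neg h3, if_neg h5, if_neg h6]
        simp
    · simp [h2]
  · simp [h1]

lemma meanTensor_labelMatrix (p q : unitInterval) (c : Fin n → Fin K) :
    meanTensor (d := d) p q (labelMatrix c) = open Classical in fun j =>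
      if Function.Injective j then (if ∀ t, c (j t) = c (j 0) then (p : ℝ) else q) else 0 := by
  ext j
  simp only [meanTensor, edgeProb_labelMatrix]
  split_ifs <;> rfl

lemma card_inter_community_erase (C : Finset (Fin n)) (b : Fin n → Fin K) (i : Fin n) (k : Fin K) :
    (((C ∩ community b k).erase i).card : ℝ) = ∑ j ∈ C.erase i, labelMatrix b j k := by
  simp only [labelMatrix_apply]
  rw [← Finset.sum_filter, Finset.sum_const, nsmul_eq_mul, mul_one]
  congr 2
  ext j
  simp [mem_community]
  tauto

lemma abs_multilinearOp_mean_sub_le (hd : 2 ≤ d) {p q : unitInterval} (hpq : q ≤ p)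
    {a b c : Fin n → Fin K} {m : ℝ} (ha : ∀ k, ((community a k).card : ℝ) = m)
    (hb : ∀ k, ((community b k).card : ℝ) = m) (i : Fin n) (k : Fin K) :
    |multilinearOp (meanTensor (d := d) p q (labelMatrix c)) (labelMatrix b) i k -
      multilinearOp (meanTensor (d := d) p q (labelMatrix c)) (labelMatrix a) i k| ≤
      (q * (((d : ℝ) - 1) * m ^ (d - 2))) * |(labelMatrix b - labelMatrix a) i k| +
      ((p - q) * (((d : ℝ) - 1) * m ^ (d - 2))) *
        ∑ j ∈ community c (c i), |(labelMatrix b - labelMatrix a) j k| := by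
  obtain ⟨l, rfl⟩ : ∃ l, d = l + 2 := ⟨d - 2, by omega⟩
  rw [meanTensor_labelMatrix, multilinearOp_planted, multilinearOp_planted]
  have hq0 : (0 : ℝ) ≤ q := q.2.1
  have hpq0 : (0 : ℝ) ≤ p - q := sub_nonneg.2 hpq
  have hm0 : 0 ≤ m := by rw [← ha k]; positivity
  have hsub : ∀ (S T : Finset (Fin n)), S ⊆ T → (T.card : ℝ) = m → (S.card : ℝ) ≤ m :=
    fun S T hST hT => by rw [← hT]; exact_mod_cast Finset.card_le_card hST
  have e1 : l + 2 - 1 = l + 1 := rfl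
  have e2 : l + 2 - 2 = l := rfl
  have e3 : (((l + 2 : ℕ) : ℝ) - 1) = l + 1 := by push_cast; ring
  rw [e1, e2, e3]
  have hS := abs_descFactorial_sub_le l
    (hsub _ _ (Finset.erase_subset i (community a k)) (ha k))
    (hsub _ _ (Finset.erase_subset i (community b k)) (hb k))
  have hC := abs_descFactorial_sub_le l
    (hsub ((community c (c i) ∩ community a k).erase i) _
      ((Finset.erase_subset _ _).trans Finset.inter_subset_right) (ha k))
    (hsub ((community c (c i) ∩ community b k).erase i) _
      ((Finset.erase_subset _ _).trans Finset.inter_subset_right) (hb k))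
  have hS' : |(((community b k).erase i).card : ℝ) - ((community a k).erase i).card| =
      |(labelMatrix b - labelMatrix a) i k| := by
    have key : ∀ f : Fin n → Fin K, (((community f k).erase i).card : ℝ) =
        (community f k).card - labelMatrix f i k := by
      intro f
      have := card_inter_community_erase Finset.univ f i k
      rw [Finset.univ_inter] at this
      rw [this]
      have h2 := Finset.add_sum_erase Finset.univ (fun j => labelMatrix f j k) (Finset.mem_univ i)
      have h3 : ∑ j, labelMatrix f j k = (community f k).card := by
        simp [labelMatrix_apply, community]
      rw [← h3, ← h2]; ring
    rw [key, key, ha, hb, Matrix.sub_apply, abs_sub_comm]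
    congr 1; ring
  have hC' : |(((community c (c i) ∩ community b k).erase i).card : ℝ) -
      ((community c (c i) ∩ community a k).erase i).card| ≤
      ∑ j ∈ community c (c i), |(labelMatrix b - labelMatrix a) j k| := by
    rw [card_inter_community_erase, card_inter_community_erase, ← Finset.sum_sub_distrib]
    refine (Finset.abs_sum_le_sum_abs _ _).trans ?_
    exact Finset.sum_le_sum_of_subset_of_nonneg (Finset.erase_subset _ _) fun _ _ _ => abs_nonneg _
  rw [hS'] at hS
  have hC2 := hC.trans (mul_le_mul_of_nonneg_left hC' (by positivity))
  rw [add_sub_add_comm, ← mul_sub, ← mul_sub]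
  refine (abs_add_le _ _).trans ?_
  rw [abs_mul, abs_mul, abs_of_nonneg hq0, abs_of_nonneg hpq0, mul_assoc (q : ℝ), mul_assoc ((p : ℝ) - q)]
  exact add_le_add (mul_le_mul_of_nonneg_left hS hq0) (mul_le_mul_of_nonneg_left hC2 hpq0)

/-- Lipschitz bound for the multilinear operation with the expected adjacency tensor. -/
lemma norm_multilinearOp_mean_sub_le (hd : 2 ≤ d) {p q : unitInterval} (hpq : q ≤ p)
    {a b c : Fin n → Fin K} {m : ℝ} (ha : ∀ k, ((community a k).card : ℝ) = m)
    (hb : ∀ k, ((community b k).card : ℝ) = m) (hc : ∀ k, ((community c k).card : ℝ) = m)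
    (hm0 : 0 ≤ m) :
    ‖multilinearOp (meanTensor (d := d) p q (labelMatrix c)) (labelMatrix b) -
      multilinearOp (meanTensor (d := d) p q (labelMatrix c)) (labelMatrix a)‖ ≤
      (q * (((d : ℝ) - 1) * m ^ (d - 2))) * ‖labelMatrix b - labelMatrix a‖ +
      ((p - q) * (((d : ℝ) - 1) * m ^ (d - 2))) *
        (√m * ‖labelMatrix b - labelMatrix a‖ ^ 2) := by
  have hq0 : (0 : ℝ) ≤ q := q.2.1
  have hpq0 : (0 : ℝ) ≤ p - q := sub_nonneg.2 hpq
  have hd0 : (0 : ℝ) ≤ (d : ℝ) - 1 := by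
    have : (2 : ℝ) ≤ d := by exact_mod_cast hd
    linarith
  set x := labelMatrix b - labelMatrix a with hx
  set s := q * (((d : ℝ) - 1) * m ^ (d - 2)) with hs
  set t := (p - q) * (((d : ℝ) - 1) * m ^ (d - 2)) with ht
  have hs0 : 0 ≤ s := by positivity
  have ht0 : 0 ≤ t := by positivity
  let X : Matrix (Fin n) (Fin K) ℝ := Matrix.of fun i k => s * |x i k|
  let Y : Matrix (Fin n) (Fin K) ℝ := Matrix.of fun i k => t * ∑ j ∈ community c (c i), |x j k|
  have h1 : ‖multilinearOp (meanTensor (d := d) p q (labelMatrix c)) (labelMatrix b) -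
      multilinearOp (meanTensor (d := d) p q (labelMatrix c)) (labelMatrix a)‖ ≤ ‖X + Y‖ :=
    frobenius_mono fun i k => abs_multilinearOp_mean_sub_le hd hpq ha hb i k
  refine h1.trans ((norm_add_le _ _).trans (add_le_add ?_ ?_))
  · apply frobenius_le_of_sq_le (by positivity)
    rw [mul_pow, frobenius_sq, Finset.mul_sum]
    simp only [X, Matrix.of_apply, mul_pow, sq_abs, Finset.mul_sum]
    exact le_rfl
  · apply frobenius_le_of_sq_le (by positivity)
    simp only [Y, Matrix.of_apply, mul_pow, ← Finset.mul_sum]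
    gcongr
    rw [Real.sq_sqrt hm0]
    have hxsq : ∀ i k, |x i k| = x i k ^ 2 := by
      intro i k
      simp only [hx, Matrix.sub_apply, labelMatrix_apply]
      split_ifs <;> simp
    have hnorm : ‖x‖ ^ 2 = ∑ l, ∑ k, ∑ j ∈ community c l, |x j k| := by
      rw [frobenius_sq]
      simp_rw [← hxsq]
      rw [← Finset.sum_fiberwise Finset.univ c]
      refine Finset.sum_congr rfl fun l _ => ?_
      rw [Finset.sum_comm]
      rfl
    have hn0 : ∀ l k, 0 ≤ ∑ j ∈ community c l, |x j k| := fun l k =>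
      Finset.sum_nonneg fun _ _ => abs_nonneg _
    calc ∑ i, ∑ k, (∑ j ∈ community c (c i), |x j k|) ^ 2
        = ∑ l, ∑ i ∈ community c l, ∑ k, (∑ j ∈ community c (c i), |x j k|) ^ 2 :=
          (Finset.sum_fiberwise Finset.univ c _).symm
      _ = ∑ l, m * ∑ k, (∑ j ∈ community c l, |x j k|) ^ 2 := by
          refine Finset.sum_congr rfl fun l _ => ?_
          rw [Finset.sum_congr rfl (g := fun _ => ∑ k, (∑ j ∈ community c l, |x j k|) ^ 2)]
          · rw [Finset.sum_const, nsmul_eq_mul, hc]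
          · intro i hi
            rw [mem_community.1 hi]
      _ = m * ∑ l, ∑ k, (∑ j ∈ community c l, |x j k|) ^ 2 := by rw [Finset.mul_sum]
      _ ≤ m * ∑ l, (∑ k, ∑ j ∈ community c l, |x j k|) ^ 2 := by
          gcongr with l
          exact Finset.sum_sq_le_sq_sum_of_nonneg fun k _ => hn0 l k
      _ ≤ m * (∑ l, ∑ k, ∑ j ∈ community c l, |x j k|) ^ 2 := by
          gcongr
          exact Finset.sum_sq_le_sq_sum_of_nonneg fun l _ => Finset.sum_nonneg fun k _ => hn0 l k
      _ = m * (‖x‖ ^ 2) ^ 2 := by rw [hnorm]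

end

section Counting

variable {d n : ℕ}

lemma card_edges_le (Q : (Fin d → Fin n) → Prop) [DecidablePred Q] :
    (Finset.univ.filter fun e : Edge d n => Q e.1).card ≤ (Finset.univ.filter Q).card := by
  refine Finset.card_le_card_of_injOn (fun e => e.1) ?_ Subtype.val_injective.injOn
  intro e he
  simpa using he

lemma card_edges_through_le (r : Fin d) (i : Fin n) :
    (Finset.univ.filter fun e : Edge d n => e.1 r = i).card ≤ n ^ (d - 1) := by
  classical
  refine (card_edges_le fun j => j r = i).trans ?_
  have : (Finset.univ.filter fun j : Fin d → Fin n => j r = i) =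
      Fintype.piFinset fun t => if t = r then {i} else Finset.univ := by
    ext j
    simp only [Finset.mem_filter, Finset.mem_univ, true_and, Fintype.mem_piFinset]
    constructor
    · intro h t
      split_ifs with ht
      · subst ht; simpa using h
      · simp
    · intro h
      simpa using h r
  rw [this, Fintype.card_piFinset, ← Finset.mul_prod_erase _ _ (Finset.mem_univ r),
    Finset.prod_congr rfl (g := fun _ => n)]
  · simp
  · intro t ht
    simp [Finset.ne_of_mem_erase ht]

lemma card_edges_through_through_le {r t : Fin d} (htr : t ≠ r) (i : Fin n) (U : Finset (Fin n)) :
    (Finset.univ.filter fun e : Edge d n => e.1 r = i ∧ e.1 t ∈ U).card ≤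
      U.card * n ^ (d - 2) := by
  classical
  refine (card_edges_le fun j => j r = i ∧ j t ∈ U).trans ?_
  have : (Finset.univ.filter fun j : Fin d → Fin n => j r = i ∧ j t ∈ U) =
      Fintype.piFinset fun s => if s = r then {i} else if s = t then U else Finset.univ := by
    ext j
    simp only [Finset.mem_filter, Finset.mem_univ, true_and, Fintype.mem_piFinset]
    constructor
    · intro h s
      split_ifs with hs hs'
      · subst hs; simpa using h.1
      · subst hs'; exact h.2
      · simp
    · intro h
      refine ⟨by simpa using h r, by simpa [htr] using h t⟩
  rw [this, Fintype.card_piFinset, ← Finset.mul_prod_erase _ _ (Finset.mem_univ r),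
    ← Finset.mul_prod_erase _ _ (Finset.mem_erase.2 ⟨htr, Finset.mem_univ t⟩),
    Finset.prod_congr rfl (g := fun _ => n)]
  · simp [htr, Finset.card_erase_of_mem, Nat.sub_sub]
  · intro s hs
    simp only [Finset.mem_erase] at hs
    simp [hs.1, hs.2.1]

end Counting

section Weights

variable {d n : ℕ}

/-- The difference of the indicators of `e t ∈ S` for all `t ≠ r` and of `e t ∈ S'` for all
`t ≠ r`. -/
noncomputable def diffWeight (S S' : Finset (Fin n)) (r : Fin d) (e : Edge d n) : ℝ :=
  (∏ t ∈ Finset.univ.erase r, if e.1 t ∈ S then 1 else 0) -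
    ∏ t ∈ Finset.univ.erase r, if e.1 t ∈ S' then 1 else 0

lemma diffWeight_cases (S S' : Finset (Fin n)) (r : Fin d) (e : Edge d n) :
    diffWeight S S' r e = 0 ∨ diffWeight S S' r e = 1 ∨ diffWeight S S' r e = -1 := by
  unfold diffWeight
  rw [Finset.prod_ite_zero, Finset.prod_ite_zero]
  split_ifs <;> simp

lemma abs_diffWeight_le_one (S S' : Finset (Fin n)) (r : Fin d) (e : Edge d n) :
    |diffWeight S S' r e| ≤ 1 := by
  rcases diffWeight_cases S S' r e with h | h | h <;> simp [h]

lemma exists_mem_symmDiff_of_diffWeight_ne_zero {S S' : Finset (Fin n)} {r : Fin d} {e : Edge d n}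
    (h : diffWeight S S' r e ≠ 0) : ∃ t, t ≠ r ∧ e.1 t ∈ symmDiff S S' := by
  by_contra hcon
  push Not at hcon
  apply h
  unfold diffWeight
  rw [sub_eq_zero]
  refine Finset.prod_congr rfl fun t ht => ?_
  have := hcon t (Finset.ne_of_mem_erase ht)
  rw [Finset.mem_symmDiff] at this
  by_cases h1 : e.1 t ∈ S <;> by_cases h2 : e.1 t ∈ S' <;> simp_all

lemma sum_abs_diffWeight_le (S S' : Finset (Fin n)) (r : Fin d) (i : Fin n) :
    ∑ e : Edge d n with e.1 r = i, |diffWeight S S' r e| ≤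
      ((d : ℝ) - 1) * (symmDiff S S').card * (n : ℝ) ^ (d - 2) := by
  classical
  have hd : 1 ≤ d := Fin.pos r
  have h1 : ∀ e : Edge d n, |diffWeight S S' r e| ≤
      ∑ t ∈ Finset.univ.erase r, if e.1 t ∈ symmDiff S S' then (1 : ℝ) else 0 := by
    intro e
    by_cases h : diffWeight S S' r e = 0
    · rw [h, abs_zero]
      exact Finset.sum_nonneg fun t _ => by split_ifs <;> simp
    · obtain ⟨t, ht, htU⟩ := exists_mem_symmDiff_of_diffWeight_ne_zero h
      refine (abs_diffWeight_le_one S S' r e).trans ?_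
      have := Finset.single_le_sum
        (f := fun t => if e.1 t ∈ symmDiff S S' then (1 : ℝ) else 0) (s := Finset.univ.erase r)
        (fun t _ => by split_ifs <;> simp) (Finset.mem_erase.2 ⟨ht, Finset.mem_univ t⟩)
      simpa [htU] using this
  refine (Finset.sum_le_sum fun e _ => h1 e).trans ?_
  rw [Finset.sum_comm]
  have h2 : ∀ t ∈ Finset.univ.erase r, ∑ e : Edge d n with e.1 r = i,
      (if e.1 t ∈ symmDiff S S' then (1 : ℝ) else 0) ≤
        (symmDiff S S').card * (n : ℝ) ^ (d - 2) := by
    intro t ht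
    rw [← Finset.sum_filter, Finset.filter_filter, Finset.sum_const, nsmul_eq_mul, mul_one]
    exact_mod_cast card_edges_through_through_le (Finset.ne_of_mem_erase ht) i _
  refine (Finset.sum_le_sum h2).trans ?_
  rw [Finset.sum_const, Finset.card_erase_of_mem (Finset.mem_univ r), Finset.card_univ,
    Fintype.card_fin, nsmul_eq_mul]
  push_cast [hd]
  exact le_of_eq (by ring)

end Weights

section UnionBound

lemma choose_le_exp {n s : ℕ} (hs : 1 ≤ s) (hn : 1 ≤ n) :
    (n.choose s : ℝ) ≤ Real.exp (s * (1 + Real.log (n / s))) := by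
  have hs0 : (0 : ℝ) < s := by exact_mod_cast hs
  have hn0 : (0 : ℝ) < n := by exact_mod_cast hn
  have h1 := Nat.choose_le_pow_div (α := ℝ) s n
  have h2 := Real.pow_div_factorial_le_exp (x := (s : ℝ)) hs0.le s
  have hf : (0 : ℝ) < s.factorial := by exact_mod_cast s.factorial_pos
  have h3 : Real.exp (s * (1 + Real.log (n / s))) = Real.exp s * ((n : ℝ) / s) ^ s := by
    rw [mul_add, Real.exp_add, mul_one, Real.exp_nat_mul, Real.exp_log (by positivity)]
  rw [h3]
  refine h1.trans ?_
  calc (n : ℝ) ^ s / s.factorial = ((s : ℝ) ^ s / s.factorial) * ((n : ℝ) / s) ^ s := by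
        rw [div_pow]; field_simp
    _ ≤ _ := by gcongr

lemma log_add_one_le {n s : ℝ} (hs : 1 ≤ s) (hn : 0 < n) (hsn : s ≤ n) :
    Real.log n + 1 ≤ s * (1 + Real.log (n / s)) := by
  have hs0 : 0 < s := by linarith
  have h1 := Real.log_le_sub_one_of_pos hs0
  have h2 : 0 ≤ Real.log (n / s) := Real.log_nonneg ((one_le_div hs0).2 hsn)
  have h3 : Real.log n = Real.log s + Real.log (n / s) := by
    rw [← Real.log_mul (by positivity) (by positivity)]
    congr 1; field_simp
  nlinarith

lemma sum_exp_card_le {n : ℕ} (hn : 1 ≤ n) {R : ℝ} (hR : 0 ≤ R) :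
    ∑ U : Finset (Fin n) with U ≠ ∅,
      Real.exp (-(R + 1) * (U.card * (1 + Real.log (n / U.card)))) ≤
      n * Real.exp (-R * (Real.log n + 1)) := by
  let f : ℕ → ℝ := fun s => if s = 0 then 0 else
    Real.exp (-(R + 1) * (s * (1 + Real.log (n / s))))
  have h1 : ∑ U : Finset (Fin n) with U ≠ ∅,
      Real.exp (-(R + 1) * (U.card * (1 + Real.log (n / U.card)))) =
      ∑ U : Finset (Fin n), f U.card := by
    rw [Finset.sum_filter]
    refine Finset.sum_congr rfl fun U _ => ?_
    by_cases hU : U = ∅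
    · simp [hU, f]
    · simp [hU, f]
  rw [h1, ← Finset.powerset_univ, Finset.sum_powerset_apply_card, Finset.card_univ,
    Fintype.card_fin, Finset.sum_range_succ']
  have h2 : ∀ s ∈ Finset.range n, n.choose (s + 1) • f (s + 1) ≤
      Real.exp (-R * (Real.log n + 1)) := by
    intro s hs
    rw [Finset.mem_range] at hs
    simp only [f, Nat.succ_ne_zero, if_false, nsmul_eq_mul]
    have h3 := choose_le_exp (n := n) (s := s + 1) (by omega) hn
    have h4 := log_add_one_le (n := n) (s := ((s + 1 : ℕ) : ℝ)) (by push_cast; linarith)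
      (by exact_mod_cast hn) (by exact_mod_cast hs)
    set x := ((s + 1 : ℕ) : ℝ) * (1 + Real.log (n / ((s + 1 : ℕ) : ℝ))) with hx
    calc (n.choose (s + 1) : ℝ) * Real.exp (-(R + 1) * x) ≤
          Real.exp x * Real.exp (-(R + 1) * x) := by gcongr
      _ = Real.exp (-R * x) := by rw [← Real.exp_add]; ring_nf
      _ ≤ _ := by
          rw [Real.exp_le_exp]
          nlinarith
  have h5 := Finset.sum_le_sum h2
  simp only [Finset.sum_const, Finset.card_range, nsmul_eq_mul] at h5
  simp only [f, nsmul_eq_mul, if_true, mul_zero, add_zero]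
  exact h5

end UnionBound

section Noise

variable {d n : ℕ} {Ω : Type*} [MeasurableSpace Ω] {P : Measure Ω} [IsProbabilityMeasure P]
  {X : Edge d n → Ω → ℝ} {p : Edge d n → unitInterval} {α : ℝ}

lemma half_le_log {n : ℕ} (hn : 2 ≤ n) : 1 / 2 ≤ Real.log n := by
  have h1 : Real.log 2 ≤ Real.log n := Real.log_le_log (by norm_num) (by exact_mod_cast hn)
  linarith [Real.log_two_gt_d9]

lemma measure_noise_ge_le (hd : 2 ≤ d) (hn : 2 ≤ n) (hα : 0 < α) (h : IsBernoulliFamily P X p)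
    (hp : ∀ e, (p e : ℝ) ≤ α * Real.log n / (n : ℝ) ^ (d - 1)) {S S' : Finset (Fin n)}
    (hS : (symmDiff S S').Nonempty) (r : Fin d) {R C₃ : ℝ} (hC₃ : 1 + 3 * (((d : ℝ) - 1) * α) ≤ C₃) :
    P.real {ω | (truncConst * (((d : ℝ) - 1) * α) + 16 * C₃ * (R + 1)) *
        ((symmDiff S S').card * Real.log n) ≤
        ∑ i, min ((∑ e with e.1 r = i, diffWeight S S' r e * (X e ω - p e)) ^ 2)
          ((C₃ * Real.log n) ^ 2)} ≤
      Real.exp (-(R + 1) * ((symmDiff S S').card *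
        (1 + Real.log (n / (symmDiff S S').card)))) := by
  classical
  set L := Real.log n with hL
  have hL0 : 1 / 2 ≤ L := half_le_log hn
  have hLp : 0 < L := by linarith
  set c₁ := ((d : ℝ) - 1) * α with hc₁
  have hd1 : (2 : ℝ) ≤ d := by exact_mod_cast hd
  have hc₁0 : 0 < c₁ := by rw [hc₁]; nlinarith
  have hC₃0 : 0 < C₃ := by linarith
  have hn0 : (0 : ℝ) < n := by exact_mod_cast (by omega : 0 < n)
  have hs1 : (1 : ℝ) ≤ (symmDiff S S').card := by exact_mod_cast hS.card_pos
  have hsn : ((symmDiff S S').card : ℝ) ≤ n := by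
    have := Finset.card_le_univ (symmDiff S S')
    rw [Fintype.card_fin] at this
    exact_mod_cast this
  have hrate0 := sum_abs_diffWeight_le S S' r
  set s := ((symmDiff S S').card : ℝ) with hs
  have hs0 : 0 < s := by linarith
  set l := 1 + Real.log (n / s) with hl
  have hl1 : 1 ≤ l := by
    have : 0 ≤ Real.log (n / s) := Real.log_nonneg ((one_le_div hs0).2 hsn)
    linarith
  have hln : l * s ≤ n := by
    have : Real.log (n / s) ≤ n / s - 1 := Real.log_le_sub_one_of_pos (by positivity)
    have h2 : l ≤ n / s := by linarith
    calc l * s ≤ n / s * s := by gcongr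
      _ = n := by field_simp
  have hlL : l ≤ 1 + L := by
    have : Real.log (n / s) ≤ L := Real.log_le_log (by positivity) (div_le_self hn0.le hs1)
    linarith
  set lam := c₁ * s * L / n with hlam
  have hlam0 : 0 < lam := by positivity
  set θ := l / (16 * C₃ * L) with hθ
  have hθ0 : 0 < θ := by positivity
  have hrate : ∀ i, ∑ e with e.1 r = i, |diffWeight S S' r e| * p e ≤ lam := by
    intro i
    calc ∑ e with e.1 r = i, |diffWeight S S' r e| * p e ≤
          ∑ e with e.1 r = i, |diffWeight S S' r e| * (α * L / (n : ℝ) ^ (d - 1)) := by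
          gcongr with e; exact hp e
      _ = (∑ e with e.1 r = i, |diffWeight S S' r e|) * (α * L / (n : ℝ) ^ (d - 1)) := by
          rw [Finset.sum_mul]
      _ ≤ (((d : ℝ) - 1) * s * (n : ℝ) ^ (d - 2)) * (α * L / (n : ℝ) ^ (d - 1)) := by
          gcongr; exact hrate0 i
      _ = lam := by
          obtain ⟨k, rfl⟩ : ∃ k, d = k + 2 := ⟨d - 2, by omega⟩
          rw [hlam, hc₁, show k + 2 - 2 = k from rfl, show k + 2 - 1 = k + 1 from rfl, pow_succ]
          field_simp
  have hθl : θ * max 1 lam ≤ 1 := by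
    rw [mul_max_of_nonneg _ _ hθ0.le, max_le_iff]
    constructor
    · rw [mul_one, hθ, div_le_one (by positivity)]
      nlinarith
    · have : θ * lam = (l * s) * c₁ / (16 * C₃ * n) := by
        rw [hθ, hlam]; field_simp
      rw [this, div_le_one (by positivity)]
      nlinarith
  have hθT : 16 * (C₃ * L) * θ ≤ Real.log (1 + C₃ * L / lam) := by
    have e1 : 16 * (C₃ * L) * θ = l := by rw [hθ]; field_simp
    have e2 : C₃ * L / lam = C₃ / c₁ * (n / s) := by rw [hlam]; field_simp
    rw [e1, e2, Real.le_log_iff_exp_le (by positivity), hl, Real.exp_add,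
      Real.exp_log (by positivity)]
    have h3 : 3 ≤ C₃ / c₁ := by rw [le_div_iff₀ hc₁0]; linarith
    have h4 := Real.exp_one_lt_d9
    have h5 : 0 < n / s := by positivity
    nlinarith
  have main := h.measure_sum_rows_ge_le (fun e => e.1 r) (diffWeight S S' r)
    (diffWeight_cases S S' r) hlam0 hrate hθ0 (by positivity) hθl hθT
    ((truncConst * c₁ + 16 * C₃ * (R + 1)) * (s * L))
  refine main.trans (le_of_eq ?_)
  congr 1
  rw [Fintype.card_fin, hθ, hlam]
  field_simp
  ring

lemma sum_prob_through_le (hn : 2 ≤ n) (hα : 0 < α)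
    (hp : ∀ e, (p e : ℝ) ≤ α * Real.log n / (n : ℝ) ^ (d - 1)) (r : Fin d) (i : Fin n) :
    ∑ e with e.1 r = i, (p e : ℝ) ≤ α * Real.log n := by
  have hn0 : (0 : ℝ) < n := by exact_mod_cast (by omega : 0 < n)
  by_cases hex : ∃ e : Edge d n, e.1 r = i
  · obtain ⟨e₀, _⟩ := hex
    have h0 : 0 ≤ α * Real.log n / (n : ℝ) ^ (d - 1) := le_trans (p e₀).2.1 (hp e₀)
    calc ∑ e with e.1 r = i, (p e : ℝ) ≤
          ∑ e : Edge d n with e.1 r = i, α * Real.log n / (n : ℝ) ^ (d - 1) :=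
          Finset.sum_le_sum fun e _ => hp e
      _ = ((Finset.univ.filter fun e : Edge d n => e.1 r = i).card : ℝ) *
          (α * Real.log n / (n : ℝ) ^ (d - 1)) := by rw [Finset.sum_const, nsmul_eq_mul]
      _ ≤ (n : ℝ) ^ (d - 1) * (α * Real.log n / (n : ℝ) ^ (d - 1)) := by
          gcongr
          exact_mod_cast card_edges_through_le r i
      _ = α * Real.log n := by field_simp
  · push Not at hex
    rw [Finset.sum_eq_zero fun e he => absurd (Finset.mem_filter.1 he).2 (hex e)]
    have := half_le_log hn
    positivity

lemma measure_degree_ge_le (hn : 2 ≤ n) (hα : 0 < α) (h : IsBernoulliFamily P X p)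
    (hp : ∀ e, (p e : ℝ) ≤ α * Real.log n / (n : ℝ) ^ (d - 1)) (r : Fin d) (i : Fin n) (R : ℝ) :
    P.real {ω | (2 * α + R) * Real.log n ≤ ∑ e with e.1 r = i, X e ω} ≤
      Real.exp (-R * Real.log n) := by
  have h1 := h.measure_sum_ge_le (Finset.univ.filter fun e => e.1 r = i) (fun _ => 1)
    ((2 * α + R) * Real.log n)
  simp only [one_mul] at h1
  refine h1.trans ?_
  rw [Real.exp_le_exp, ← Finset.sum_mul]
  have h2 := sum_prob_through_le hn hα hp r i
  have h3 := Real.exp_one_lt_d9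
  have h4 := Real.exp_one_gt_d9
  have h5 : (∑ e with e.1 r = i, (p e : ℝ)) * (Real.exp 1 - 1) ≤ α * Real.log n * 2 := by
    have : 0 ≤ ∑ e with e.1 r = i, (p e : ℝ) := Finset.sum_nonneg fun e _ => (p e).2.1
    nlinarith
  linarith

end Noise

section GoodEvent

variable {d n K : ℕ} {Ω : Type*} [MeasurableSpace Ω] {P : Measure Ω} [IsProbabilityMeasure P]
  {X : Edge d n → Ω → ℝ} {p : Edge d n → unitInterval} {α : ℝ}

/-- The exponent of the tail bounds which absorbs the number of terms in the union bounds. -/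
noncomputable def tailExponent (d K : ℕ) : ℝ := 11 + (K + 1) * d

/-- The truncation level of the noise, in units of `log n`. -/
noncomputable def truncLevel (d K : ℕ) (α : ℝ) : ℝ :=
  1 + 3 * (((d : ℝ) - 1) * α) + (2 * α + tailExponent d K) + α

/-- The constant in the bound for the noise. -/
noncomputable def noiseConst (d K : ℕ) (α : ℝ) : ℝ :=
  truncConst * (((d : ℝ) - 1) * α) + 16 * truncLevel d K α * (tailExponent d K + 1)

/-- The event that the degrees are logarithmic and the noise is small in all directions. -/
def noiseEvent (α : ℝ) (c : Fin n → Fin K) (X : Edge d n → Ω → ℝ) (p : Edge d n → unitInterval) :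
    Set Ω :=
  {ω | (∀ e, X e ω = 0 ∨ X e ω = 1) ∧
    (∀ (r : Fin d) i, ∑ e with e.1 r = i, X e ω < (2 * α + tailExponent d K) * Real.log n) ∧
    ∀ (k : Fin K) (S : Finset (Fin n)), S ≠ community c k → ∀ r : Fin d,
      ∑ i, min ((∑ e with e.1 r = i, diffWeight S (community c k) r e * (X e ω - p e)) ^ 2)
        ((truncLevel d K α * Real.log n) ^ 2) <
      noiseConst d K α * ((symmDiff S (community c k)).card * Real.log n)}

lemma one_sub_le_measure_of_compl_le {G : Set Ω} {x : ℝ} (h : P.real Gᶜ ≤ x) :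
    1 - x ≤ P.real G := by
  have h1 : (1 : ℝ) ≤ P.real G + P.real Gᶜ := by
    calc (1 : ℝ) = P.real Set.univ := by simp
      _ = P.real (G ∪ Gᶜ) := by rw [Set.union_compl_self]
      _ ≤ _ := measureReal_union_le _ _
  linarith

lemma measure_noiseEvent_compl_le (hd : 2 ≤ d) (hn : 2 ≤ n) (hα : 0 < α) (h : IsBernoulliFamily P X p)
    (hp : ∀ e, (p e : ℝ) ≤ α * Real.log n / (n : ℝ) ^ (d - 1)) (c : Fin n → Fin K) :
    P.real (noiseEvent α c X p)ᶜ ≤ (n : ℝ) ^ (-10 : ℝ) := by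
  classical
  set L := Real.log n with hL
  have hL0 : 1 / 2 ≤ L := half_le_log hn
  have hn0 : (0 : ℝ) < n := by exact_mod_cast (by omega : 0 < n)
  have hd1 : (2 : ℝ) ≤ d := by exact_mod_cast hd
  set R := tailExponent d K with hR
  have hR0 : 0 ≤ R := by rw [hR, tailExponent]; positivity
  let N : Set Ω := {ω | ¬ ∀ e, X e ω = 0 ∨ X e ω = 1}
  let D : Fin d × Fin n → Set Ω := fun x =>
    {ω | (2 * α + R) * L ≤ ∑ e with e.1 x.1 = x.2, X e ω}
  let V : Fin K → Fin d → Finset (Fin n) → Set Ω := fun k r U =>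
    {ω | noiseConst d K α * ((symmDiff (symmDiff U (community c k)) (community c k)).card * L) ≤
      ∑ i, min ((∑ e with e.1 r = i, diffWeight (symmDiff U (community c k)) (community c k) r e *
        (X e ω - p e)) ^ 2) ((truncLevel d K α * L) ^ 2)}
  let F : Finset (Finset (Fin n)) := Finset.univ.filter fun U => U ≠ ∅
  have hN : P.real N = 0 := by
    rw [measureReal_eq_zero_iff]
    exact ae_iff.1 h.ae_forall
  have hD : P.real (⋃ x, D x) ≤ d * (n * Real.exp (-R * L)) := by
    refine (measureReal_iUnion_fintype_le _).trans ?_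
    refine (Finset.sum_le_sum fun x _ => measure_degree_ge_le hn hα h hp x.1 x.2 R).trans ?_
    simp [mul_assoc, hL]
  have hV : ∀ k r, P.real (⋃ U ∈ F, V k r U) ≤ n * Real.exp (-R * L) := by
    intro k r
    refine (measureReal_biUnion_finset_le _ _).trans ?_
    have h1 := sum_exp_card_le (n := n) (by omega) hR0
    have h2 : ∀ U ∈ F, P.real (V k r U) ≤
        Real.exp (-(R + 1) * (U.card * (1 + Real.log (n / U.card)))) := by
      intro U hU
      have hU' : U ≠ ∅ := (Finset.mem_filter.1 hU).2
      have := measure_noise_ge_le (S := symmDiff U (community c k)) (S' := community c k) hd hn hα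
        h hp (by rw [symmDiff_symmDiff_cancel_right]; exact Finset.nonempty_iff_ne_empty.2 hU') r
        (R := R) (C₃ := truncLevel d K α) (by unfold truncLevel; linarith)
      rw [show (symmDiff (symmDiff U (community c k)) (community c k)) = U from
        symmDiff_symmDiff_cancel_right _ _] at this
      simp only [V]
      rw [show (symmDiff (symmDiff U (community c k)) (community c k)) = U from
        symmDiff_symmDiff_cancel_right _ _]
      exact this
    refine (Finset.sum_le_sum h2).trans (h1.trans ?_)
    refine mul_le_mul_of_nonneg_left (Real.exp_le_exp.2 ?_) hn0.le
    nlinarith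
  have hVV : P.real (⋃ x : Fin K × Fin d, ⋃ U ∈ F, V x.1 x.2 U) ≤
      K * d * (n * Real.exp (-R * L)) := by
    refine (measureReal_iUnion_fintype_le _).trans ?_
    refine (Finset.sum_le_sum fun x _ => hV x.1 x.2).trans ?_
    simp
  have hcompl : (noiseEvent α c X p)ᶜ ⊆
      N ∪ ((⋃ x, D x) ∪ ⋃ x : Fin K × Fin d, ⋃ U ∈ F, V x.1 x.2 U) := by
    intro ω hω
    by_contra hcon
    simp only [Set.mem_union, Set.mem_iUnion, not_or, not_exists] at hcon
    obtain ⟨h1, h2, h3⟩ := hcon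
    apply hω
    refine ⟨not_not.1 h1, fun r i => not_le.1 (h2 (r, i)), fun k S hS r => ?_⟩
    have hU : symmDiff S (community c k) ∈ F := by
      simp only [F, Finset.mem_filter, Finset.mem_univ, true_and]
      intro h0
      exact hS (symmDiff_eq_bot.1 h0)
    have := h3 (k, r) _ hU
    simp only [V, Set.mem_ofPred_eq, not_le] at this
    rw [show symmDiff (symmDiff S (community c k)) (community c k) = S from
        symmDiff_symmDiff_cancel_right _ _] at this
    exact this
  calc P.real (noiseEvent α c X p)ᶜ ≤
        P.real (N ∪ ((⋃ x, D x) ∪ ⋃ x : Fin K × Fin d, ⋃ U ∈ F, V x.1 x.2 U)) :=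
        measureReal_mono hcompl (measure_ne_top _ _)
    _ ≤ P.real N + (P.real (⋃ x, D x) +
        P.real (⋃ x : Fin K × Fin d, ⋃ U ∈ F, V x.1 x.2 U)) :=
        (measureReal_union_le _ _).trans (by gcongr; exact measureReal_union_le _ _)
    _ ≤ ((K + 1) * d : ℕ) * (n * Real.exp (-R * L)) := by
        rw [hN]; push_cast; linarith
    _ = ((K + 1) * d : ℕ) * Real.exp (-((((K + 1) * d : ℕ) : ℝ) * L)) * Real.exp (-10 * L) := by
        have : (n : ℝ) = Real.exp L := (Real.exp_log hn0).symm
        rw [this, mul_assoc, ← Real.exp_add, ← Real.exp_add, hR, tailExponent]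
        push_cast
        ring_nf
    _ ≤ 1 * Real.exp (-10 * L) := by
        gcongr
        rw [Real.exp_neg, Real.exp_nat_mul, Real.exp_log hn0, ← div_eq_mul_inv,
          div_le_one (by positivity)]
        have h2 : ((K + 1) * d : ℕ) < n ^ ((K + 1) * d) := Nat.lt_pow_self (by omega)
        exact_mod_cast h2.le
    _ = (n : ℝ) ^ (-10 : ℝ) := by
        rw [one_mul, Real.rpow_def_of_pos hn0, mul_comm]

end GoodEvent

section Lipschitz

variable {d n K : ℕ} [NeZero d] {Ω : Type*} [MeasurableSpace Ω] {P : Measure Ω}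
  {α β : ℝ} {p q : unitInterval} {A : Ω → Tensor d n}

omit [NeZero d] in
lemma IsHSBM.isHypergraphTensor {Hstar : Matrix (Fin n) (Fin K) ℝ} (h : IsHSBM p q Hstar P A)
    (ω : Ω) : IsHypergraphTensor (A ω) := ⟨h.symm ω, h.diag ω⟩

omit [NeZero d] in
lemma IsHSBM.isBernoulliFamily {Hstar : Matrix (Fin n) (Fin K) ℝ} (h : IsHSBM p q Hstar P A) :
    IsBernoulliFamily P (fun (e : Edge d n) ω => A ω e.1) fun e => edgeProb p q Hstar e.1 :=
  ⟨fun e => h.measurable e.1, h.indep, fun e => h.law e.1 e.2⟩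

lemma sum_card_symmDiff_community (a b : Fin n → Fin K) :
    ∑ k, ((symmDiff (community b k) (community a k)).card : ℝ) =
      ‖labelMatrix b - labelMatrix a‖ ^ 2 := by
  rw [frobenius_sq, Finset.sum_comm]
  refine Finset.sum_congr rfl fun k _ => ?_
  have : ∀ i, (labelMatrix b - labelMatrix a) i k ^ 2 =
      if i ∈ symmDiff (community b k) (community a k) then 1 else 0 := by
    intro i
    simp only [Finset.mem_symmDiff, mem_community, Matrix.sub_apply, labelMatrix_apply]
    by_cases h1 : b i = k <;> by_cases h2 : a i = k <;> simp [h1, h2]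
  simp_rw [this]
  simp

omit [MeasurableSpace Ω] in
/-- Lipschitz bound for the multilinear operation with the centered adjacency tensor. -/
lemma norm_multilinearOp_noise_sub_le (hn : 2 ≤ n) (hα : 0 < α) (hd : 2 ≤ d) {c : Fin n → Fin K}
    {ω : Ω} (hA : IsHypergraphTensor (A ω))
    (hp : ∀ e : Edge d n, (edgeProb p q (labelMatrix c) e.1 : ℝ) ≤
      α * Real.log n / (n : ℝ) ^ (d - 1))
    (hω : ω ∈ noiseEvent α c (fun (e : Edge d n) ω => A ω e.1)
      fun e => edgeProb p q (labelMatrix c) e.1) (σ : Equiv.Perm (Fin K)) (b : Fin n → Fin K) :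
    ‖multilinearOp (A ω - meanTensor p q (labelMatrix c)) (labelMatrix b) -
      multilinearOp (A ω - meanTensor p q (labelMatrix c)) (labelMatrix (σ ∘ c))‖ ≤
      ((d - 1).factorial * d * √(noiseConst d K α)) * √(Real.log n) *
        ‖labelMatrix b - labelMatrix (σ ∘ c)‖ := by
  classical
  obtain ⟨h01, hdeg, hnoise⟩ := hω
  set L := Real.log n with hL
  have hL0 : 1 / 2 ≤ L := half_le_log hn
  set X : Edge d n → ℝ := fun e => A ω e.1 with hX
  set pr : Edge d n → unitInterval := fun e => edgeProb p q (labelMatrix c) e.1 with hpr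
  have hd1 : (2 : ℝ) ≤ d := by exact_mod_cast hd
  have hR0 : 0 ≤ tailExponent d K := by rw [tailExponent]; positivity
  have hT0 : 0 ≤ truncLevel d K α := by
    have : 0 ≤ ((d : ℝ) - 1) * α := mul_nonneg (by linarith) hα.le
    unfold truncLevel; linarith
  have hB0 : 0 ≤ noiseConst d K α := by
    have : 0 ≤ ((d : ℝ) - 1) * α := mul_nonneg (by linarith) hα.le
    have := truncConst_pos
    unfold noiseConst; positivity
  let v : Fin K → Fin d → Fin n → ℝ := fun k r i =>
    ∑ e with e.1 r = i, diffWeight (community b k) (community (σ ∘ c) k) r e * (X e - pr e)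
  have hW : IsHypergraphTensor (A ω - meanTensor p q (labelMatrix c)) := by
    have h2 := isHypergraphTensor_meanTensor (d := d) p q (labelMatrix c)
    exact ⟨fun j τ => by simp [hA.symm j τ, h2.symm j τ], fun j hj => by
      simp [hA.diag j hj, h2.diag j hj]⟩
  have hentry : ∀ i k, (multilinearOp (A ω - meanTensor p q (labelMatrix c)) (labelMatrix b) -
      multilinearOp (A ω - meanTensor p q (labelMatrix c)) (labelMatrix (σ ∘ c))) i k =
      (d - 1).factorial * ∑ r, v k r i := by
    intro i k
    rw [Matrix.sub_apply, multilinearOp_eq_sum_edges hW, multilinearOp_eq_sum_edges hW, ← mul_sub,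
      ← Finset.sum_sub_distrib]
    congr 1
    refine Finset.sum_congr rfl fun r _ => ?_
    rw [← Finset.sum_sub_distrib]
    refine Finset.sum_congr rfl fun e _ => ?_
    rw [← mul_sub, mul_comm]
    congr 1
    · simp only [diffWeight, labelMatrix_apply, mem_community]
    · simp only [Pi.sub_apply, meanTensor, e.2.injective, if_true, hX, hpr]
  have hvT : ∀ k r i, v k r i ^ 2 ≤ (truncLevel d K α * L) ^ 2 := by
    intro k r i
    apply sq_le_sq'
    all_goals
      have h1 : |v k r i| ≤ truncLevel d K α * L := by
        calc |v k r i| ≤ ∑ e with e.1 r = i, |diffWeight (community b k) (community (σ ∘ c) k) r e *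
              (X e - pr e)| := Finset.abs_sum_le_sum_abs _ _
          _ ≤ ∑ e with e.1 r = i, (X e + pr e) := by
              refine Finset.sum_le_sum fun e _ => ?_
              rw [abs_mul]
              have h1 := abs_diffWeight_le_one (community b k) (community (σ ∘ c) k) r e
              have hp0 : (0 : ℝ) ≤ pr e := (pr e).2.1
              have hX0 : 0 ≤ X e := by rcases h01 e with h | h <;> simp only at h <;> simp [hX, h]
              calc _ ≤ 1 * |X e - pr e| := by gcongr
                _ ≤ X e + pr e := by rw [one_mul, abs_le]; constructor <;> linarith
          _ = ∑ e with e.1 r = i, X e + ∑ e with e.1 r = i, (pr e : ℝ) := Finset.sum_add_distrib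
          _ ≤ (2 * α + tailExponent d K) * L + α * L :=
              add_le_add (hdeg r i).le (sum_prob_through_le hn hα hp r i)
          _ ≤ _ := by
              have : 0 ≤ ((d : ℝ) - 1) * α := mul_nonneg (by linarith) hα.le
              rw [← add_mul]
              gcongr
              unfold truncLevel; linarith
      have := abs_le.1 h1
      linarith [this.1, this.2]
  have hsum : ∀ k r, ∑ i, v k r i ^ 2 ≤ noiseConst d K α *
      ((symmDiff (community b k) (community (σ ∘ c) k)).card * L) := by
    intro k r
    by_cases hS : community b k = community (σ ∘ c) k
    · have : ∀ i, v k r i = 0 := by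
        intro i
        refine Finset.sum_eq_zero fun e _ => ?_
        rw [hS]; simp [diffWeight]
      simp only [this]
      simp
      positivity
    · have hcom : community (σ ∘ c) k = community c (σ.symm k) := community_perm c σ k
      have := hnoise (σ.symm k) (community b k) (by rwa [← hcom]) r
      rw [← hcom] at this
      refine le_trans (le_of_eq ?_) this.le
      refine Finset.sum_congr rfl fun i _ => ?_
      rw [min_eq_left (hvT k r i)]
  apply frobenius_le_of_sq_le (by positivity)
  simp_rw [hentry]
  calc ∑ i, ∑ k, (((d - 1).factorial : ℝ) * ∑ r, v k r i) ^ 2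
      ≤ ∑ i, ∑ k, ((d - 1).factorial : ℝ) ^ 2 * (d * ∑ r, v k r i ^ 2) := by
        refine Finset.sum_le_sum fun i _ => Finset.sum_le_sum fun k _ => ?_
        rw [mul_pow]
        gcongr
        have := sq_sum_le_card_mul_sum_sq (s := (Finset.univ : Finset (Fin d))) (f := fun r => v k r i)
        simpa using this
    _ = ((d - 1).factorial : ℝ) ^ 2 * d * ∑ k, ∑ r, ∑ i, v k r i ^ 2 := by
        rw [Finset.sum_comm, Finset.mul_sum]
        refine Finset.sum_congr rfl fun k _ => ?_
        rw [Finset.sum_comm (s := (Finset.univ : Finset (Fin d))), Finset.mul_sum]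
        refine Finset.sum_congr rfl fun i _ => by ring
    _ ≤ ((d - 1).factorial : ℝ) ^ 2 * d * ∑ k, ∑ r : Fin d, noiseConst d K α *
          ((symmDiff (community b k) (community (σ ∘ c) k)).card * L) := by
        gcongr with k _ r
        exact hsum k r
    _ = ((d - 1).factorial : ℝ) ^ 2 * d ^ 2 * noiseConst d K α * L *
          ∑ k, ((symmDiff (community b k) (community (σ ∘ c) k)).card : ℝ) := by
        simp only [Finset.sum_const, Finset.card_univ, Fintype.card_fin, nsmul_eq_mul,
          Finset.mul_sum]
        refine Finset.sum_congr rfl fun k _ => by ring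
    _ = _ := by
        rw [sum_card_symmDiff_community, mul_pow, mul_pow, mul_pow, mul_pow, Real.sq_sqrt hB0,
          Real.sq_sqrt (by linarith)]

/-- The Lipschitz constant in units of `√(log n)`. -/
noncomputable def lipConst (d K : ℕ) (α β : ℝ) : ℝ :=
  (d - 1).factorial * d * √(noiseConst d K α) + ((d : ℝ) - 1) * β

omit [NeZero d] in
lemma IsLogHSBM.eq_labelMatrix {Hstar : Matrix (Fin n) (Fin K) ℝ}
    (h : IsLogHSBM α β Hstar P A) :
    ∃ c, Hstar = labelMatrix c ∧ ∀ k, ((community c k).card : ℝ) = n / K := by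
  obtain ⟨p, q, _, _, h⟩ := h
  exact exists_labelMatrix_of_balanced h.planted

omit [NeZero d] in
lemma edgeProb_le {p q : unitInterval} (hpq : q ≤ p) (Hstar : Matrix (Fin n) (Fin K) ℝ)
    (j : Fin d → Fin n) : edgeProb p q Hstar j ≤ p := by
  unfold edgeProb
  split_ifs
  · exact le_rfl
  · exact hpq

lemma noiseEvent_subset_lipschitzEvent (hd : 2 ≤ d) (hK : 2 ≤ K) (hn : 2 ≤ n) (hβ : 0 < β)
    (hαβ : β < α) (hp : (p : ℝ) = α * Real.log n / (n : ℝ) ^ (d - 1))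
    (hq : (q : ℝ) = β * Real.log n / (n : ℝ) ^ (d - 1)) {c : Fin n → Fin K}
    (h : IsHSBM p q (labelMatrix c) P A) :
    noiseEvent α c (fun (e : Edge d n) ω => A ω e.1)
      (fun e => edgeProb p q (labelMatrix c) e.1) ⊆
      lipschitzEvent α β (lipConst d K α β) (labelMatrix c) A := by
  intro ω hω ε hε _ H hH σ hHε
  have hα : 0 < α := hβ.trans hαβ
  have hn0 : (0 : ℝ) < n := by exact_mod_cast (by omega : 0 < n)
  have hK0 : (0 : ℝ) < K := by exact_mod_cast (by omega : 0 < K)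
  have hK1 : (1 : ℝ) ≤ K := by exact_mod_cast (by omega : 1 ≤ K)
  have hd1 : (2 : ℝ) ≤ d := by exact_mod_cast hd
  have hL0 : 1 / 2 ≤ Real.log n := half_le_log hn
  have hc := labelMatrix_mem_balanced.1 h.planted
  obtain ⟨b, rfl, hb⟩ := exists_labelMatrix_of_balanced hH
  rw [relabel_labelMatrix] at hHε ⊢
  have ha : ∀ k, ((community (σ ∘ c) k).card : ℝ) = n / K := fun k => by
    rw [community_perm]; exact hc _
  have hpq : q ≤ p := by
    rw [← Subtype.coe_le_coe, hp, hq]; gcongr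
  have hnoise := norm_multilinearOp_noise_sub_le hn hα hd (h.isHypergraphTensor ω)
    (fun e => by rw [← hp]; exact edgeProb_le hpq _ _) hω σ b
  have hmean := norm_multilinearOp_mean_sub_le hd hpq ha hb hc (by positivity)
  set x := ‖labelMatrix b - labelMatrix (σ ∘ c)‖ with hx
  have hx0 : 0 ≤ x := norm_nonneg _
  set L := Real.log n with hL
  set m : ℝ := n / K with hm
  have hm0 : 0 < m := by positivity
  have htri : ‖multilinearOp (A ω) (labelMatrix b) - multilinearOp (A ω) (labelMatrix (σ ∘ c))‖ ≤
      ‖multilinearOp (A ω - meanTensor p q (labelMatrix c)) (labelMatrix b) -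
      multilinearOp (A ω - meanTensor p q (labelMatrix c)) (labelMatrix (σ ∘ c))‖ +
      ‖multilinearOp (meanTensor (d := d) p q (labelMatrix c)) (labelMatrix b) -
      multilinearOp (meanTensor (d := d) p q (labelMatrix c)) (labelMatrix (σ ∘ c))‖ := by
    refine le_trans (le_of_eq ?_) (norm_add_le _ _)
    rw [multilinearOp_sub, multilinearOp_sub]
    congr 1
    abel
  refine htri.trans ((add_le_add hnoise hmean).trans ?_)
  have h1 : (q : ℝ) * (((d : ℝ) - 1) * m ^ (d - 2)) ≤ ((d : ℝ) - 1) * β * √L := by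
    have e1 : m ^ (d - 2) ≤ (n : ℝ) ^ (d - 2) := by
      gcongr; exact div_le_self hn0.le hK1
    have e2 : L ≤ √L * n := by
      have h3 : √L ≤ n := by
        rw [Real.sqrt_le_left hn0.le]
        have h4 := Real.log_le_sub_one_of_pos hn0
        have h5 : (2 : ℝ) ≤ n := by exact_mod_cast hn
        nlinarith
      calc L = √L * √L := (Real.mul_self_sqrt (by linarith)).symm
        _ ≤ √L * n := by gcongr
    have e3 : (n : ℝ) ^ (d - 1) = n ^ (d - 2) * n := by
      rw [← pow_succ]; congr 1; omega
    have hd0 : 0 ≤ (d : ℝ) - 1 := by linarith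
    calc (q : ℝ) * (((d : ℝ) - 1) * m ^ (d - 2)) ≤
        β * L / (n : ℝ) ^ (d - 1) * (((d : ℝ) - 1) * n ^ (d - 2)) := by
          rw [hq]; gcongr
      _ = ((d : ℝ) - 1) * β * (L / n) := by
          rw [e3]; field_simp
      _ ≤ ((d : ℝ) - 1) * β * √L := by
          gcongr
          rwa [div_le_iff₀ hn0]
  have h2 : √m * x ^ 2 ≤ ε * n / √K * x := by
    have e1 : √m * √n = n / √K := by
      rw [hm, Real.sqrt_div hn0.le, div_mul_eq_mul_div, Real.mul_self_sqrt hn0.le]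
    calc √m * x ^ 2 = √m * x * x := by ring
      _ ≤ √m * (ε * √n) * x := by gcongr
      _ = ε * (√m * √n) * x := by ring
      _ = _ := by rw [e1]; ring
  have hpq' : (p : ℝ) - q = (α - β) * L / (n : ℝ) ^ (d - 1) := by rw [hp, hq]; ring
  have hpq0 : 0 ≤ (α - β) * L / (n : ℝ) ^ (d - 1) := by
    have : 0 < α - β := by linarith
    positivity
  have hd0 : 0 ≤ (d : ℝ) - 1 := by linarith
  rw [hpq']
  set D := (α - β) * L / (n : ℝ) ^ (d - 1) with hD
  have h3 : D * (((d : ℝ) - 1) * m ^ (d - 2)) * (√m * x ^ 2) ≤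
      4 * ((d : ℝ) - 1) * m ^ (d - 2) * ε * n / √K * D * x := by
    calc _ ≤ D * (((d : ℝ) - 1) * m ^ (d - 2)) * (ε * n / √K * x) := by gcongr
      _ = 1 * (((d : ℝ) - 1) * m ^ (d - 2) * ε * n / √K * D * x) := by ring
      _ ≤ 4 * (((d : ℝ) - 1) * m ^ (d - 2) * ε * n / √K * D * x) := by
          gcongr; norm_num
      _ = _ := by ring
  have h4 := mul_le_mul_of_nonneg_right h1 hx0
  unfold lipConst
  nlinarith

lemma measure_lipschitzEvent_compl_le [IsProbabilityMeasure P] (hd : 2 ≤ d) (hK : 2 ≤ K)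
    (hn : 2 ≤ n) (hβ : 0 < β) (hαβ : β < α) {Hstar : Matrix (Fin n) (Fin K) ℝ}
    (h : IsLogHSBM α β Hstar P A) :
    P.real (lipschitzEvent α β (lipConst d K α β) Hstar A)ᶜ ≤ (n : ℝ) ^ (-10 : ℝ) := by
  obtain ⟨c, rfl, hc⟩ := h.eq_labelMatrix
  obtain ⟨p, q, hp, hq, h⟩ := h
  have hL0 : 1 / 2 ≤ Real.log n := half_le_log hn
  have hpq : q ≤ p := by
    rw [← Subtype.coe_le_coe, hp, hq]; gcongr
  refine le_trans (measureReal_mono (Set.compl_subset_compl.2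
    (noiseEvent_subset_lipschitzEvent hd hK hn hβ hαβ hp hq h)) (measure_ne_top _ _)) ?_
  exact measure_noiseEvent_compl_le hd hn (hβ.trans hαβ) h.isBernoulliFamily
    (fun e => by rw [← hp]; exact edgeProb_le hpq _ _) c

omit [NeZero d] in
lemma lipConst_pos (hd : 2 ≤ d) (hβ : 0 < β) : 0 < lipConst d K α β := by
  have hd1 : (2 : ℝ) ≤ d := by exact_mod_cast hd
  have : 0 < (d : ℝ) - 1 := by linarith
  unfold lipConst
  positivity

end Lipschitz

section Separation

variable {d n K : ℕ} [NeZero d] {Ω : Type*} [MeasurableSpace Ω] {P : Measure Ω}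
  {α β : ℝ} {p q : unitInterval} {A : Ω → Tensor d n}

omit [NeZero d] in
lemma map_sum_through (e : Edge d n) (i : Fin n) (f : Fin d → ℝ) (φ : ℝ → ℝ) (hφ : φ 0 = 0) :
    φ (∑ r, if e.1 r = i then f r else 0) = ∑ r, if e.1 r = i then φ (f r) else 0 := by
  by_cases h : ∃ r₀, e.1 r₀ = i
  · obtain ⟨r₀, h₀⟩ := h
    have : ∀ g : Fin d → ℝ, (∑ r, if e.1 r = i then g r else 0) = g r₀ := by
      intro g
      rw [Finset.sum_eq_single r₀ (fun r _ hr => if_neg fun h => hr (e.2.injective (h.trans h₀.symm)))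
        (by simp), if_pos h₀]
    rw [this, this]
  · push Not at h
    simp [h, hφ]

omit [NeZero d] in
lemma exp_diffWeight (hd : 2 ≤ d) {S S' : Finset (Fin n)} (hS : Disjoint S S') (r : Fin d)
    (e : Edge d n) (u : ℝ) :
    Real.exp (-u * diffWeight S S' r e) - 1 =
      (Real.exp (-u) - 1) * (∏ t ∈ Finset.univ.erase r, if e.1 t ∈ S then 1 else 0) +
      (Real.exp u - 1) * ∏ t ∈ Finset.univ.erase r, if e.1 t ∈ S' then 1 else 0 := by
  unfold diffWeight
  rw [Finset.prod_ite_zero, Finset.prod_ite_zero]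
  have : Nontrivial (Fin d) := Fin.nontrivial_iff_two_le.2 hd
  obtain ⟨t, ht⟩ := exists_ne r
  have hnot : ¬ ((∀ t ∈ Finset.univ.erase r, e.1 t ∈ S) ∧ ∀ t ∈ Finset.univ.erase r, e.1 t ∈ S') := by
    rintro ⟨h1, h2⟩
    have htm : t ∈ Finset.univ.erase r := by simpa using ht
    exact Finset.disjoint_left.1 hS (h1 t htm) (h2 t htm)
  split_ifs with h1 h2 h2
  · exact absurd ⟨h1, h2⟩ hnot
  · simp
  · simp
  · simp

/-- Chernoff bound for the gap between the own community and another one. -/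
lemma measure_gap_le [IsProbabilityMeasure P] (hd : 2 ≤ d) {c : Fin n → Fin K}
    (h : IsHSBM p q (labelMatrix c) P A) (i : Fin n) {l : Fin K} (hl : l ≠ c i) {u : ℝ}
    (hu : 0 ≤ u) (t : ℝ) :
    P.real {ω | multilinearOp (A ω) (labelMatrix c) i (c i) -
        multilinearOp (A ω) (labelMatrix c) i l ≤ t} ≤
      Real.exp (((Real.exp (-u) - 1) *
        (p * ((((community c (c i)).erase i).card.descFactorial (d - 1) : ℕ) : ℝ)) +
        (Real.exp u - 1) * (q * (((community c l).card.descFactorial (d - 1) : ℕ) : ℝ)) +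
          u * t) / (d - 1).factorial) := by
  classical
  have hf : (0 : ℝ) < (d - 1).factorial := by exact_mod_cast (d - 1).factorial_pos
  set S := community c (c i) with hS
  set S' := community c l with hS'
  have hdisj : Disjoint S S' := by
    rw [Finset.disjoint_left]
    intro j hj hj'
    rw [hS, mem_community] at hj
    rw [hS', mem_community] at hj'
    exact hl (hj'.symm.trans hj)
  let W : Edge d n → ℝ := fun e => ∑ r, if e.1 r = i then diffWeight S S' r e else 0
  have hprod : ∀ (k : Fin K) (r : Fin d) (e : Edge d n),
      ∏ t ∈ Finset.univ.erase r, labelMatrix c (e.1 t) k =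
        ∏ t ∈ Finset.univ.erase r, if e.1 t ∈ community c k then (1 : ℝ) else 0 := by
    intro k r e
    simp only [labelMatrix_apply, mem_community]
  have hgap : ∀ ω, multilinearOp (A ω) (labelMatrix c) i (c i) -
      multilinearOp (A ω) (labelMatrix c) i l =
        (d - 1).factorial * ∑ e : Edge d n, W e * A ω e.1 := by
    intro ω
    rw [multilinearOp_eq_sum_edges (h.isHypergraphTensor ω),
      multilinearOp_eq_sum_edges (h.isHypergraphTensor ω), ← mul_sub, ← Finset.sum_sub_distrib]
    congr 1
    simp only [W, Finset.sum_mul]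
    rw [Finset.sum_comm (s := (Finset.univ : Finset (Edge d n)))]
    refine Finset.sum_congr rfl fun r _ => ?_
    rw [← Finset.sum_sub_distrib, Finset.sum_filter]
    refine Finset.sum_congr rfl fun e _ => ?_
    split_ifs
    · rw [hprod, hprod, ← mul_sub, mul_comm]; rfl
    · simp
  have hmean : ∀ k : Fin K, multilinearOp (meanTensor (d := d) p q (labelMatrix c))
      (labelMatrix c) i k = (d - 1).factorial * ∑ e : Edge d n, ∑ r, if e.1 r = i then
        (edgeProb p q (labelMatrix c) e.1 : ℝ) * ∏ t ∈ Finset.univ.erase r,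
          (if e.1 t ∈ community c k then 1 else 0) else 0 := by
    intro k
    rw [multilinearOp_eq_sum_edges (isHypergraphTensor_meanTensor p q _)]
    congr 1
    rw [Finset.sum_comm (s := (Finset.univ : Finset (Edge d n)))]
    refine Finset.sum_congr rfl fun r _ => ?_
    rw [Finset.sum_filter]
    refine Finset.sum_congr rfl fun e _ => ?_
    rw [hprod]
    simp only [meanTensor, e.2.injective, if_true]
  have hmean1 := hmean (c i)
  have hmean2 := hmean l
  have hcap : community c (c i) ∩ community c l = ∅ := Finset.disjoint_iff_inter_eq_empty.1 hdisj
  have hil : i ∉ community c l := fun hi => hl (mem_community.1 hi).symm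
  have h0 : Nat.descFactorial 0 (d - 1) = 0 := Nat.descFactorial_of_lt (by omega)
  rw [meanTensor_labelMatrix, multilinearOp_planted, Finset.inter_self, ← add_mul,
    add_sub_cancel] at hmean1
  rw [meanTensor_labelMatrix, multilinearOp_planted, hcap, Finset.erase_eq_of_notMem hil,
    Finset.erase_empty, Finset.card_empty, h0, Nat.cast_zero, mul_zero, add_zero] at hmean2
  have hexp : ∑ e : Edge d n, (edgeProb p q (labelMatrix c) e.1 : ℝ) * (Real.exp (-u * W e) - 1) =
      ((Real.exp (-u) - 1) * (p * ((S.erase i).card.descFactorial (d - 1) : ℕ)) +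
        (Real.exp u - 1) * (q * (S'.card.descFactorial (d - 1) : ℕ))) / (d - 1).factorial := by
    rw [hmean1, hmean2, eq_div_iff hf.ne']
    have : ∀ e : Edge d n, Real.exp (-u * W e) - 1 = ∑ r, if e.1 r = i then
        ((Real.exp (-u) - 1) * (∏ t ∈ Finset.univ.erase r, if e.1 t ∈ S then 1 else 0) +
      (Real.exp u - 1) * ∏ t ∈ Finset.univ.erase r, if e.1 t ∈ S' then 1 else 0) else 0 := by
      intro e
      have := map_sum_through e i (fun r => diffWeight S S' r e)
        (fun x => Real.exp (-u * x) - 1) (by simp)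
      refine this.trans ?_
      refine Finset.sum_congr rfl fun r _ => ?_
      rw [exp_diffWeight hd hdisj]
    simp_rw [this, Finset.mul_sum, Finset.sum_mul]
    rw [← Finset.sum_add_distrib]
    refine Finset.sum_congr rfl fun e _ => ?_
    rw [← Finset.sum_add_distrib]
    refine Finset.sum_congr rfl fun r _ => ?_
    split_ifs
    · ring
    · simp
  have hch := h.isBernoulliFamily.measure_sum_ge_le Finset.univ (fun e => -u * W e)
    (-(u * t) / (d - 1).factorial)
  rw [hexp] at hch
  refine le_trans (measureReal_mono ?_ (measure_ne_top _ _)) (hch.trans (le_of_eq ?_))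
  · intro ω hω
    simp only [Set.mem_ofPred_eq] at hω ⊢
    rw [hgap] at hω
    rw [div_le_iff₀ hf]
    have : ∑ e : Edge d n, -u * W e * A ω e.1 = -u * ∑ e : Edge d n, W e * A ω e.1 := by
      rw [Finset.mul_sum]
      exact Finset.sum_congr rfl fun e _ => by ring
    rw [this]
    nlinarith
  · congr 1
    ring

lemma separation_bound [IsProbabilityMeasure P] {c : Fin n → Fin K} {γ x : ℝ}
    (hx : ∀ i l, l ≠ c i → P.real {ω | multilinearOp (A ω) (labelMatrix c) i (c i) -
        multilinearOp (A ω) (labelMatrix c) i l ≤ γ * Real.log n} ≤ x) (hx0 : 0 ≤ x) :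
    P.real (separationEvent γ (labelMatrix c) A)ᶜ ≤ n * K * x := by
  classical
  let E : Fin n × Fin K → Set Ω := fun y => if y.2 = c y.1 then ∅ else
    {ω | multilinearOp (A ω) (labelMatrix c) y.1 (c y.1) -
        multilinearOp (A ω) (labelMatrix c) y.1 y.2 ≤ γ * Real.log n}
  have hsub : (separationEvent γ (labelMatrix c) A)ᶜ ⊆ ⋃ y, E y := by
    intro ω hω
    simp only [separationEvent, Set.mem_compl_iff, Set.mem_ofPred_eq] at hω
    push Not at hω
    obtain ⟨i, k, l, hik, hlk, hlt⟩ := hω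
    rw [labelMatrix_apply] at hik
    have hk : c i = k := by
      by_contra hne
      simp [hne] at hik
    subst hk
    refine Set.mem_iUnion.2 ⟨(i, l), ?_⟩
    simp only [E, if_neg hlk]
    exact hlt.le
  refine (measureReal_mono hsub (measure_ne_top _ _)).trans
    ((measureReal_iUnion_fintype_le _).trans ?_)
  have : ∀ y, P.real (E y) ≤ x := by
    intro y
    by_cases hy : y.2 = c y.1
    · simpa [E, hy] using hx0
    · simp only [E, if_neg hy]
      exact hx y.1 y.2 hy
  refine (Finset.sum_le_sum fun y _ => this y).trans ?_
  simp

end Separation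

lemma le_mul_descFactorial_erase {d n K : ℕ} (hd : 2 ≤ d) (hK : 0 < K) (hn : 0 < n) {α L p : ℝ}
    (hp0 : 0 ≤ p) (hp : p = α * L / (n : ℝ) ^ (d - 1)) (hnd : (d - 1) * K ≤ n) {S : Finset (Fin n)}
    {i : Fin n} (hmi : i ∈ S) (hcard : (S.card : ℝ) = n / K) :
    α / ((K : ℝ) ^ (d - 1) * ((d - 1).factorial : ℝ)) * L *
        (1 - ((d : ℝ) - 1) * (((d : ℝ) - 1) * K / n)) ≤
      p * (((S.erase i).card.descFactorial (d - 1) : ℕ) : ℝ) / (d - 1).factorial := by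
  have hf : (0 : ℝ) < (d - 1).factorial := by exact_mod_cast (d - 1).factorial_pos
  have hK0 : (0 : ℝ) < K := by exact_mod_cast hK
  have hn0 : (0 : ℝ) < n := by exact_mod_cast hn
  have hd1 : (2 : ℝ) ≤ d := by exact_mod_cast hd
  have h1 := Nat.pow_sub_le_descFactorial (S.erase i).card (d - 1)
  rw [Finset.card_erase_of_mem hmi, Nat.sub_add_cancel (Finset.card_pos.2 ⟨i, hmi⟩)] at h1
  have h2 : ((n : ℝ) / K - (d - 1)) ≤ ((S.card - (d - 1) : ℕ) : ℝ) := by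
    rw [← hcard]
    have := Nat.sub_le_iff_le_add.1 (le_refl (S.card - (d - 1)))
    have h3 : (S.card : ℝ) ≤
      ((S.card - (d - 1) : ℕ) : ℝ) + ((d - 1 : ℕ) : ℝ) := by
      exact_mod_cast this
    rw [Nat.cast_sub (by omega : 1 ≤ d), Nat.cast_one] at h3
    linarith
  have h3 : ((n : ℝ) / K) * (1 - ((d : ℝ) - 1) * K / n) = (n : ℝ) / K - (d - 1) := by
    field_simp
  have hnd' : ((d : ℝ) - 1) * K ≤ n := by
    have : (((d - 1) * K : ℕ) : ℝ) ≤ n := by exact_mod_cast hnd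
    push_cast [(by omega : 1 ≤ d)] at this
    exact this
  have hy0 : 0 ≤ ((d : ℝ) - 1) * K / n := by
    have : 0 ≤ (d : ℝ) - 1 := by linarith
    positivity
  have hy1 : ((d : ℝ) - 1) * K / n ≤ 1 := (div_le_one hn0).2 hnd'
  have h4 := one_add_mul_le_pow (a := -(((d : ℝ) - 1) * K / n)) (by linarith) (d - 1)
  rw [Nat.cast_sub (by omega : 1 ≤ d), Nat.cast_one] at h4
  set y := ((d : ℝ) - 1) * K / n with hy
  have h5 : ((n : ℝ) / K) ^ (d - 1) * (1 - y) ^ (d - 1) ≤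
      ((S.erase i).card.descFactorial (d - 1) : ℕ) := by
    rw [← mul_pow, h3]
    calc ((n : ℝ) / K - (d - 1)) ^ (d - 1) ≤
          (((S.card - (d - 1) : ℕ) : ℝ)) ^ (d - 1) := by
          apply pow_le_pow_left₀ _ h2
          rw [← h3]
          exact mul_nonneg (by positivity) (by linarith)
      _ ≤ _ := by
          rw [Finset.card_erase_of_mem hmi]
          exact_mod_cast h1
  rw [le_div_iff₀ hf]
  calc α / ((K : ℝ) ^ (d - 1) * ((d - 1).factorial : ℝ)) * L * (1 - ((d : ℝ) - 1) * y) * (d - 1).factorial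
      = p * (((n : ℝ) / K) ^ (d - 1) * (1 + ((d : ℝ) - 1) * -y)) := by
        rw [hp, div_pow]; field_simp; ring
    _ ≤ p * (((n : ℝ) / K) ^ (d - 1) * (1 + -y) ^ (d - 1)) := by
        have := hp0
        gcongr
    _ ≤ _ := by
        have := hp0
        rw [← sub_eq_add_neg]
        gcongr

lemma mul_descFactorial_le {d n K : ℕ} (hn : 0 < n) {β L q : ℝ}
    (hq0 : 0 ≤ q) (hq : q = β * L / (n : ℝ) ^ (d - 1)) {s : ℕ} (hcard : (s : ℝ) = n / K) :
    q * ((s.descFactorial (d - 1) : ℕ) : ℝ) / (d - 1).factorial ≤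
      β / ((K : ℝ) ^ (d - 1) * ((d - 1).factorial : ℝ)) * L := by
  have hf : (0 : ℝ) < (d - 1).factorial := by exact_mod_cast (d - 1).factorial_pos
  have hn0 : (0 : ℝ) < n := by exact_mod_cast hn
  have h1 : ((s.descFactorial (d - 1) : ℕ) : ℝ) ≤ ((n : ℝ) / K) ^ (d - 1) := by
    rw [← hcard]
    exact_mod_cast Nat.descFactorial_le_pow _ _
  rw [div_le_iff₀ hf]
  calc q * ((s.descFactorial (d - 1) : ℕ) : ℝ)
      ≤ q * ((n : ℝ) / K) ^ (d - 1) := by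
        have := hq0
        gcongr
    _ = _ := by rw [hq, div_pow]; field_simp

lemma sqrt_div_exponent {α β : ℝ} (hα : 0 < α) (hβ : 0 < β) (M L : ℝ) :
    (√β / √α - 1) * (α / M * L) + (√α / √β - 1) * (β / M * L) =
      -((√α - √β) ^ 2 / M * L) := by
  have hsa : 0 < √α := Real.sqrt_pos.2 hα
  have hsb : 0 < √β := Real.sqrt_pos.2 hβ
  obtain ⟨a, ha⟩ : ∃ a, a = √α := ⟨_, rfl⟩
  obtain ⟨b, hb⟩ : ∃ b, b = √β := ⟨_, rfl⟩
  have hsa2 : α = a * a := by rw [ha, Real.mul_self_sqrt hα.le]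
  have hsb2 : β = b * b := by rw [hb, Real.mul_self_sqrt hβ.le]
  rw [← ha] at hsa ⊢
  rw [← hb] at hsb ⊢
  rw [hsa2, hsb2]
  field_simp
  ring

lemma exists_separation (d K : ℕ) [NeZero d] (hd : 2 ≤ d) (hK : 2 ≤ K) {α β : ℝ} (hβ : 0 < β)
    (hαβ : β < α)
    (hthr : 1 < (√α - √β) ^ 2 / ((K : ℝ) ^ (d - 1) * ((d - 1).factorial : ℝ))) :
    ∃ γ : ℝ, 0 < γ ∧ ∃ c : ℝ, 0 < c ∧ ∃ n₁ : ℕ, ∀ n : ℕ, n₁ ≤ n →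
        ∀ (Hstar : Matrix (Fin n) (Fin K) ℝ) (Ω : Type u) [MeasurableSpace Ω]
        (P : Measure Ω) [IsProbabilityMeasure P] (A : Ω → HSBM.Tensor d n),
        HSBM.IsLogHSBM α β Hstar P A →
          1 - (n : ℝ) ^ (-c) ≤ P.real (HSBM.separationEvent γ Hstar A) := by
  have hα : 0 < α := hβ.trans hαβ
  have hf : (0 : ℝ) < (d - 1).factorial := by exact_mod_cast (d - 1).factorial_pos
  have hK0 : (0 : ℝ) < K := by exact_mod_cast (by omega : 0 < K)
  have hd1 : (2 : ℝ) ≤ d := by exact_mod_cast hd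
  set M := (K : ℝ) ^ (d - 1) * ((d - 1).factorial : ℝ) with hM
  have hM0 : 0 < M := by positivity
  set J := (√α - √β) ^ 2 / M with hJ
  set η := (J - 1) / 4 with hη
  have hη0 : 0 < η := by rw [hη]; linarith
  have hsa : 0 < √α := Real.sqrt_pos.2 hα
  have hsb : 0 < √β := Real.sqrt_pos.2 hβ
  have hsab : √β < √α := Real.sqrt_lt_sqrt hβ.le hαβ
  have hsa2 : √α * √α = α := Real.mul_self_sqrt hα.le
  have hsb2 : √β * √β = β := Real.mul_self_sqrt hβ.le
  set u := Real.log (√α / √β) with hu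
  have hu0 : 0 < u := Real.log_pos ((one_lt_div hsb).2 hsab)
  have heu : Real.exp u = √α / √β := Real.exp_log (by positivity)
  have heu' : Real.exp (-u) = √β / √α := by rw [Real.exp_neg, heu, inv_div]
  refine ⟨η * (d - 1).factorial / u, by positivity, η, hη0, ?_⟩
  have hev : ∀ᶠ n : ℕ in Filter.atTop, 2 ≤ n ∧ (d - 1) * K ≤ n ∧
      α / M * ((d : ℝ) - 1) * (((d : ℝ) - 1) * K) ≤ η * n ∧ (K : ℝ) ≤ (n : ℝ) ^ η := by
    refine (Filter.eventually_ge_atTop 2).and ((Filter.eventually_ge_atTop _).and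
      (Filter.Eventually.and ?_ ?_))
    · exact (tendsto_natCast_atTop_atTop.const_mul_atTop hη0).eventually_ge_atTop _
    · exact ((tendsto_rpow_atTop hη0).comp tendsto_natCast_atTop_atTop).eventually_ge_atTop _
  obtain ⟨n₁, hn₁⟩ := Filter.eventually_atTop.1 hev
  refine ⟨n₁, fun n hn Hstar Ω _ P _ A h => ?_⟩
  obtain ⟨hn2, hnd, hna, hnK⟩ := hn₁ n hn
  obtain ⟨c, rfl, hc⟩ := h.eq_labelMatrix
  obtain ⟨p, q, hp, hq, h⟩ := h
  have hn0 : (0 : ℝ) < n := by exact_mod_cast (by omega : 0 < n)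
  set L := Real.log n with hL
  have hL0 : 1 / 2 ≤ L := half_le_log hn2
  have hexpL : Real.exp L = n := Real.exp_log hn0
  apply one_sub_le_measure_of_compl_le
  have key : ∀ i l, l ≠ c i → P.real {ω | multilinearOp (A ω) (labelMatrix c) i (c i) -
        multilinearOp (A ω) (labelMatrix c) i l ≤ η * (d - 1).factorial / u * Real.log n} ≤
        Real.exp (-(1 + 2 * η) * L) := by
    intro i l hl
    refine (measure_gap_le hd h i hl hu0.le _).trans ?_
    rw [Real.exp_le_exp]
    have hmi : i ∈ community c (c i) := mem_community.2 rfl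
    have hcard : ((community c (c i)).card : ℝ) = n / K := hc _
    have hlow := le_mul_descFactorial_erase hd (by omega) (by omega) p.2.1 hp hnd hmi hcard
    have hup := mul_descFactorial_le (by omega) q.2.1 hq (hc l)
    rw [← hM] at hlow hup
    rw [add_div, add_div, mul_div_assoc, mul_div_assoc (Real.exp u - 1)]
    have e1 : u * (η * (d - 1).factorial / u * L) / (d - 1).factorial = η * L := by
      field_simp
    rw [e1]
    have hneg : Real.exp (-u) - 1 ≤ 0 := by
      have := Real.exp_le_one_iff.2 (by linarith : -u ≤ 0)
      linarith
    have hpos : 0 ≤ Real.exp u - 1 := by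
      have := Real.one_le_exp hu0.le
      linarith
    have hA := mul_le_mul_of_nonpos_left hlow hneg
    have hB := mul_le_mul_of_nonneg_left hup hpos
    have hε : α / M * L * (((d : ℝ) - 1) * (((d : ℝ) - 1) * K / n)) ≤ η * L := by
      have : α / M * L * (((d : ℝ) - 1) * (((d : ℝ) - 1) * K / n)) =
        (α / M * ((d : ℝ) - 1) * (((d : ℝ) - 1) * K)) / n * L := by ring
      rw [this]
      gcongr
      rwa [div_le_iff₀ hn0]
    have hε0 : 0 ≤ α / M * L * (((d : ℝ) - 1) * (((d : ℝ) - 1) * K / n)) := by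
      have : 0 ≤ (d : ℝ) - 1 := by linarith
      positivity
    have hJe : (Real.exp (-u) - 1) * (α / M * L) + (Real.exp u - 1) * (β / M * L) = -(J * L) := by
      rw [heu, heu', hJ]
      exact sqrt_div_exponent hα hβ M L
    have he0 : 0 ≤ Real.exp (-u) := (Real.exp_pos _).le
    have hJη : J = 1 + 4 * η := by rw [hη]; ring
    have hfin : (Real.exp (-u) - 1) *
        (α / M * L * (1 - ((d : ℝ) - 1) * (((d : ℝ) - 1) * K / n))) ≤
        (Real.exp (-u) - 1) * (α / M * L) + η * L := by
      rw [mul_sub, mul_one, mul_sub]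
      have := mul_nonneg he0 hε0
      linarith
    rw [hJη] at hJe
    linarith
  refine (separation_bound key (Real.exp_pos _).le).trans ?_
  rw [Real.rpow_def_of_pos hn0] at hnK ⊢
  rw [← hL] at hnK ⊢
  calc (n : ℝ) * K * Real.exp (-(1 + 2 * η) * L)
      ≤ Real.exp L * Real.exp (L * η) * Real.exp (-(1 + 2 * η) * L) := by
        rw [hexpL]; gcongr
    _ = _ := by rw [← Real.exp_add, ← Real.exp_add]; ring_nf

section Projection

variable {n K : ℕ} {Y : Matrix (Fin n) (Fin K) ℝ} {v c : Fin n → Fin K}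

lemma norm_labelMatrix_sub_sq (v : Fin n → Fin K) (Y : Matrix (Fin n) (Fin K) ℝ) :
    ‖labelMatrix v - Y‖ ^ 2 = n - 2 * ∑ i, Y i (v i) + ∑ i, ∑ k, Y i k ^ 2 := by
  have h : ∀ i, ∑ k, (labelMatrix v - Y) i k ^ 2 = 1 - 2 * Y i (v i) + ∑ k, Y i k ^ 2 := by
    intro i
    have : ∀ k, (labelMatrix v - Y) i k ^ 2 =
        (if v i = k then 1 - 2 * Y i k else 0) + Y i k ^ 2 := by
      intro k
      rw [Matrix.sub_apply, labelMatrix_apply]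
      split_ifs <;> ring
    simp_rw [this, Finset.sum_add_distrib]
    simp
  rw [frobenius_sq]
  simp_rw [h, Finset.sum_add_distrib, Finset.sum_sub_distrib, ← Finset.mul_sum]
  simp

lemma sum_le_of_mem_proj (hv : labelMatrix v ∈ proj Y) (hc : labelMatrix c ∈ balanced n K) :
    ∑ i, Y i (c i) ≤ ∑ i, Y i (v i) := by
  have h1 := pow_le_pow_left₀ (norm_nonneg _) (hv.2 _ hc) 2
  rw [norm_labelMatrix_sub_sq, norm_labelMatrix_sub_sq] at h1
  linarith

lemma eq_of_mem_proj (hv : labelMatrix v ∈ proj Y) (hc : labelMatrix c ∈ balanced n K)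
    (hY : ∀ i l, l ≠ c i → Y i l < Y i (c i)) : v = c := by
  by_contra hne
  obtain ⟨i, hi⟩ := Function.ne_iff.1 hne
  refine absurd (sum_le_of_mem_proj hv hc) (not_le.2 (Finset.sum_lt_sum (fun j _ => ?_)
    ⟨i, Finset.mem_univ i, hY i _ hi⟩))
  by_cases hj : v j = c j
  · rw [hj]
  · exact (hY j _ hj).le

lemma sum_mul_le_norm_mul_norm (M N : Matrix (Fin n) (Fin K) ℝ) :
    ∑ i, ∑ k, M i k * N i k ≤ ‖M‖ * ‖N‖ := by
  have h := Finset.sum_mul_sq_le_sq_mul_sq (Finset.univ : Finset (Fin n × Fin K))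
    (fun x => M x.1 x.2) (fun x => N x.1 x.2)
  simp only [Fintype.sum_prod_type] at h
  rw [← frobenius_sq, ← frobenius_sq, ← mul_pow] at h
  exact le_of_sq_le_sq h (by positivity)

/-- A point of the projection of `Y` is close to a labelling which is separated by a matrix close
to `Y`. -/
lemma norm_sub_le_of_mem_proj {X : Matrix (Fin n) (Fin K) ℝ} {g : ℝ} (hg : 0 < g)
    (hv : labelMatrix v ∈ proj Y) (hc : labelMatrix c ∈ balanced n K)
    (hX : ∀ i l, l ≠ c i → g ≤ X i (c i) - X i l) :
    ‖labelMatrix v - labelMatrix c‖ ≤ 2 / g * ‖Y - X‖ := by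
  have h1 : g * (‖labelMatrix v - labelMatrix c‖ ^ 2 / 2) ≤ ∑ i, (X i (c i) - X i (v i)) := by
    rw [labelMatrix_sub_norm_sq, mul_div_cancel_left₀ _ two_ne_zero, mul_comm, ← nsmul_eq_mul,
      ← Finset.sum_const, Finset.sum_filter]
    refine Finset.sum_le_sum fun i _ => ?_
    by_cases h : v i = c i
    · simp [h]
    · simpa [h] using hX i _ h
  have h2 := sum_le_of_mem_proj hv hc
  have h3 := sum_mul_le_norm_mul_norm (labelMatrix v - labelMatrix c) (Y - X)
  have h4 : ∑ i, ∑ k, (labelMatrix v - labelMatrix c) i k * (Y - X) i k =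
      (∑ i, Y i (v i) - ∑ i, Y i (c i)) + ∑ i, (X i (c i) - X i (v i)) := by
    rw [← Finset.sum_sub_distrib, ← Finset.sum_add_distrib]
    refine Finset.sum_congr rfl fun i _ => ?_
    simp [Matrix.sub_apply, labelMatrix_apply, sub_mul, Finset.sum_sub_distrib]
    ring
  set x := ‖labelMatrix v - labelMatrix c‖ with hx
  have hx0 : 0 ≤ x := norm_nonneg _
  rcases hx0.eq_or_lt with h0 | h0
  · rw [← h0]; positivity
  · have h5 : g * (x ^ 2 / 2) ≤ x * ‖Y - X‖ := by linarith
    have h6 : g * x / 2 ≤ ‖Y - X‖ := by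
      refine le_of_mul_le_mul_left ?_ h0
      linarith
    rw [div_mul_eq_mul_div, le_div_iff₀ hg]
    linarith

lemma eq_of_norm_sub_lt (h : ‖labelMatrix v - labelMatrix c‖ < 1) : v = c := by
  have h1 := labelMatrix_sub_norm_sq v c
  have h2 : ‖labelMatrix v - labelMatrix c‖ ^ 2 < 1 := by
    have := norm_nonneg (labelMatrix v - labelMatrix c)
    nlinarith
  rw [h1] at h2
  have h3 : (Finset.univ.filter fun i => v i ≠ c i).card = 0 := by
    by_contra hne
    have : (1 : ℝ) ≤ (Finset.univ.filter fun i => v i ≠ c i).card := by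
      exact_mod_cast Nat.one_le_iff_ne_zero.2 hne
    linarith
  ext1 i
  by_contra hi
  have : i ∈ Finset.univ.filter fun i => v i ≠ c i := by simp [hi]
  rw [Finset.card_eq_zero.1 h3] at this
  simp at this

end Projection

lemma quadratic_contraction {e : ℕ → ℝ} {a b E r : ℝ} {N s t : ℕ} (he : ∀ j, 0 ≤ e j)
    (ha : 0 ≤ a) (hb : 0 ≤ b) (h0 : e 1 ≤ E)
    (hstep : ∀ j, 1 ≤ j → j ≤ N → e j ≤ E → e (j + 1) ≤ (a * e j + b) * e j)
    (hE : a * E + b ≤ 1 / 2) (hr : a * (E * (1 / 2) ^ s) + b ≤ r) (hr1 : r ≤ 1)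
    (hN : s + t ≤ N) : e (N + 1) ≤ E * (1 / 2) ^ s * r ^ t := by
  have hE0 : 0 ≤ E := (he 1).trans h0
  have hr0 : 0 ≤ r := le_trans (by positivity) hr
  have h1 : ∀ j ≤ N, e (j + 1) ≤ E * (1 / 2) ^ j := by
    intro j
    induction j with
    | zero => intro _; simpa using h0
    | succ j ih =>
      intro hj
      have h2 := ih (by omega)
      have h3 : e (j + 1) ≤ E := h2.trans (mul_le_of_le_one_right hE0
        (pow_le_one₀ (by norm_num) (by norm_num)))
      calc e (j + 1 + 1) ≤ (a * e (j + 1) + b) * e (j + 1) := hstep _ (by omega) hj h3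
        _ ≤ (a * E + b) * e (j + 1) := by
            have := he (j + 1)
            gcongr
        _ ≤ 1 / 2 * (E * (1 / 2) ^ j) := by
            have := he (j + 1)
            gcongr
        _ = _ := by ring
  have h2 : ∀ j, s + j ≤ N → e (s + j + 1) ≤ E * (1 / 2) ^ s * r ^ j := by
    intro j
    induction j with
    | zero => intro hj; simpa using h1 s hj
    | succ j ih =>
      intro hj
      have h2 := ih (by omega)
      have h3 : e (s + j + 1) ≤ E * (1 / 2) ^ s := h2.trans (mul_le_of_le_one_right (by positivity)
        (pow_le_one₀ hr0 hr1))
      have h4 : e (s + j + 1) ≤ E := h3.trans (mul_le_of_le_one_right hE0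
        (pow_le_one₀ (by norm_num) (by norm_num)))
      have h5 := he (s + j + 1)
      calc e (s + j + 1 + 1) ≤ (a * e (s + j + 1) + b) * e (s + j + 1) :=
            hstep _ (by omega) hj h4
        _ ≤ (a * (E * (1 / 2) ^ s) + b) * e (s + j + 1) := by gcongr
        _ ≤ r * (E * (1 / 2) ^ s * r ^ j) := by gcongr
        _ = _ := by ring
  have h3 := h2 (N - s) (by omega)
  rw [show s + (N - s) + 1 = N + 1 by omega] at h3
  refine h3.trans ?_
  gcongr 1
  exact pow_le_pow_of_le_one hr0 hr1 (by omega)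

section Contraction

variable {d n K : ℕ} [NeZero d] {Ω : Type*} {α β γ C : ℝ} {A : Ω → Tensor d n}

lemma multilinearOp_relabel (A : Tensor d n) (H : Matrix (Fin n) (Fin K) ℝ)
    (σ : Equiv.Perm (Fin K)) (i : Fin n) (k : Fin K) :
    multilinearOp A (relabel H σ) i k = multilinearOp A H i (σ.symm k) := by
  simp [multilinearOp, relabel_apply]

lemma separation_relabel {c : Fin n → Fin K} {ω : Ω}
    (h : ω ∈ separationEvent γ (labelMatrix c) A) (σ : Equiv.Perm (Fin K)) (i : Fin n) (l : Fin K)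
    (hl : l ≠ (σ ∘ c) i) :
    γ * Real.log n ≤ multilinearOp (A ω) (labelMatrix (σ ∘ c)) i ((σ ∘ c) i) -
      multilinearOp (A ω) (labelMatrix (σ ∘ c)) i l := by
  rw [← relabel_labelMatrix, multilinearOp_relabel, multilinearOp_relabel]
  refine h i _ _ ?_ fun heq => hl ?_
  · simp [labelMatrix_apply]
  · rw [Equiv.symm_apply_eq] at heq
    simpa using heq

/-- The first projection at most doubles the distance to the ground truth. -/
lemma norm_proj_sub_le {X V W : Matrix (Fin n) (Fin K) ℝ} (hV : V ∈ proj X)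
    (hW : W ∈ balanced n K) : ‖V - W‖ ≤ 2 * ‖X - W‖ := by
  have h1 := hV.2 W hW
  have h2 := norm_sub_le_norm_sub_add_norm_sub V X W
  rw [norm_sub_rev W X] at h1
  linarith

end Contraction

section Threshold

variable {d K : ℕ} {α β γ C L : ℝ}

lemma eight_lt_of_logThreshold_lt (hC : 0 < C) (hγ : 0 < γ) (h : logThreshold d K α β γ C < L) :
    8 < L := by
  simp only [logThreshold, max_lt_iff] at h
  obtain ⟨h1, h2, -⟩ := h
  have h0 : 0 < L := lt_trans (by positivity) h1
  have h3 : 64 * C ^ 2 / γ ^ 2 * (γ ^ 2 / C ^ 2) < L * L := by gcongr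
  have h4 : 64 * C ^ 2 / γ ^ 2 * (γ ^ 2 / C ^ 2) = 64 := by field_simp
  nlinarith

lemma eight_mul_div_le_sqrt (hC : 0 < C) (hγ : 0 < γ) (h : logThreshold d K α β γ C < L) :
    8 * (C / γ) ≤ √L := by
  simp only [logThreshold, max_lt_iff] at h
  apply Real.le_sqrt_of_sq_le
  refine le_trans (le_of_eq ?_) h.1.le
  field_simp
  norm_num

lemma one_le_div_mul_sqrt (hC : 0 < C) (hγ : 0 < γ) (h : logThreshold d K α β γ C < L) :
    1 ≤ C / γ * √L := by
  simp only [logThreshold, max_lt_iff] at h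
  have h1 : γ / C ≤ √L := Real.le_sqrt_of_sq_le (by rw [div_pow]; exact h.2.1.le)
  calc 1 = C / γ * (γ / C) := by field_simp
    _ ≤ _ := by gcongr

lemma four_mul_div_le_sqrt_sqrt (hC : 0 < C) (hγ : 0 < γ) (h : logThreshold d K α β γ C < L) :
    4 * (C / γ) ≤ √√L := by
  simp only [logThreshold, max_lt_iff] at h
  apply Real.le_sqrt_of_sq_le
  apply Real.le_sqrt_of_sq_le
  refine le_trans (le_of_eq ?_) h.2.2.2.2.le
  field_simp
  norm_num

lemma one_lt_of_logThreshold_lt {n : ℕ} (hC : 0 < C) (hγ : 0 < γ)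
    (h : Real.exp (logThreshold d K α β γ C) < n) :
    2 ≤ n ∧ logThreshold d K α β γ C < Real.log n := by
  have h0 : (0 : ℝ) < n := (Real.exp_pos _).trans h
  have h1 := (Real.lt_log_iff_exp_lt h0).2 h
  refine ⟨?_, h1⟩
  have h2 := eight_lt_of_logThreshold_lt hC hγ h1
  by_contra hn
  have : n ≤ 1 := by omega
  interval_cases n <;> simp at h2 <;> norm_num at h2

lemma theta_pos (hd : 2 ≤ d) (hK : 2 ≤ K) (hαβ : β < α) (hγ : 0 < γ) : 0 < theta d K α β γ := by
  have hd1 : (2 : ℝ) ≤ d := by exact_mod_cast hd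
  have hK0 : (0 : ℝ) < K := by exact_mod_cast (by omega : 0 < K)
  have h1 : 0 < (d : ℝ) - 1 := by linarith
  have h2 : 0 < α - β := by linarith
  unfold theta
  have : 0 < min (1 / √(K * ((d : ℝ) - 1)))
    (γ * (K : ℝ) ^ ((d : ℝ) - 3 / 2) / (16 * ((d : ℝ) - 1) * (α - β))) :=
    lt_min (by positivity) (by positivity)
  positivity

lemma theta_le_sqrt (d K : ℕ) (α β γ : ℝ) :
    theta d K α β γ ≤ 1 / 4 * (1 / √(K * ((d : ℝ) - 1))) :=
  mul_le_mul_of_nonneg_left (min_le_left _ _) (by norm_num)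

lemma mul_theta_le (hd : 2 ≤ d) (hK : 2 ≤ K) (hαβ : β < α) (hγ : 0 < γ) :
    8 * ((d : ℝ) - 1) * (α - β) / (γ * (K : ℝ) ^ ((d : ℝ) - 3 / 2)) * (2 * theta d K α β γ) ≤
      1 / 4 := by
  have hd1 : (2 : ℝ) ≤ d := by exact_mod_cast hd
  have hK0 : (0 : ℝ) < K := by exact_mod_cast (by omega : 0 < K)
  have h1 : 0 < (d : ℝ) - 1 := by linarith
  have h2 : 0 < α - β := by linarith
  have h3 : theta d K α β γ ≤
      1 / 4 * (γ * (K : ℝ) ^ ((d : ℝ) - 3 / 2) / (16 * ((d : ℝ) - 1) * (α - β))) :=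
    mul_le_mul_of_nonneg_left (min_le_right _ _) (by norm_num)
  calc _ ≤ 8 * ((d : ℝ) - 1) * (α - β) / (γ * (K : ℝ) ^ ((d : ℝ) - 3 / 2)) *
      (2 * (1 / 4 * (γ * (K : ℝ) ^ ((d : ℝ) - 3 / 2) / (16 * ((d : ℝ) - 1) * (α - β))))) := by
        gcongr
    _ = 1 / 4 := by field_simp; norm_num

lemma theta_lt_half (hd : 2 ≤ d) (hK : 2 ≤ K) : theta d K α β γ < 1 / 2 := by
  have hd1 : (2 : ℝ) ≤ d := by exact_mod_cast hd
  have hK0 : (2 : ℝ) ≤ K := by exact_mod_cast hK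
  have h1 : 1 ≤ √(K * ((d : ℝ) - 1)) := Real.one_le_sqrt.2 (by nlinarith)
  have h2 : 1 / √(K * ((d : ℝ) - 1)) ≤ 1 := (div_le_one (by linarith)).2 h1
  linarith [theta_le_sqrt d K α β γ]

lemma half_pow_ceil_le (hL : 1 < L) : (1 / 2 : ℝ) ^ ⌈2 * Real.log L⌉₊ ≤ 1 / L := by
  have hL0 : 0 < L := by linarith
  rw [_root_.one_div_pow]
  apply one_div_le_one_div_of_le hL0
  have h1 : 2 * Real.log L ≤ ⌈2 * Real.log L⌉₊ := Nat.le_ceil _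
  have h2 := Real.log_two_gt_d9
  have h3 := Real.log_pos hL
  rw [← Real.log_le_log_iff hL0 (by positivity), Real.log_pow]
  nlinarith

lemma pow_ceil_le (hL : 1 < L) :
    (1 / √√L) ^ ⌈2 * L / Real.log L⌉₊ ≤ Real.exp (-(L / 2)) := by
  have hL0 : 0 < L := by linarith
  have h3 := Real.log_pos hL
  have h1 : 2 * L / Real.log L ≤ ⌈2 * L / Real.log L⌉₊ := Nat.le_ceil _
  rw [div_le_iff₀ h3] at h1
  rw [← Real.log_le_iff_le_exp (by positivity), Real.log_pow, one_div, Real.log_inv,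
    Real.log_sqrt (by positivity), Real.log_sqrt hL0.le]
  linarith

end Threshold

section Contraction

variable {d n K : ℕ} [NeZero d] {Ω : Type*} {α β γ C : ℝ} {A : Ω → Tensor d n}

lemma rpow_sub_three_halves {d : ℕ} (hd : 2 ≤ d) {x : ℝ} (hx : 0 < x) :
    x ^ ((d : ℝ) - 3 / 2) = x ^ (d - 2) * √x := by
  rw [Real.sqrt_eq_rpow, ← Real.rpow_natCast, ← Real.rpow_add hx, Nat.cast_sub hd]
  congr 1
  push_cast
  ring

lemma iterate_step (hd : 2 ≤ d) (hK : 2 ≤ K) (hn : 2 ≤ n) (hγ : 0 < γ)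
    {c : Fin n → Fin K} (hc : labelMatrix c ∈ balanced n K) {ω : Ω}
    (hsep : ω ∈ separationEvent γ (labelMatrix c) A)
    (hlip : ω ∈ lipschitzEvent α β C (labelMatrix c) A) (σ : Equiv.Perm (Fin K))
    {H H' : Matrix (Fin n) (Fin K) ℝ} (hH : H ∈ balanced n K)
    (hH' : H' ∈ proj (multilinearOp (A ω) H))
    (hε : ‖H - labelMatrix (σ ∘ c)‖ / √n < 1 / √(K * ((d : ℝ) - 1))) :
    ‖H' - labelMatrix (σ ∘ c)‖ / √n ≤
      (8 * ((d : ℝ) - 1) * (α - β) / (γ * (K : ℝ) ^ ((d : ℝ) - 3 / 2)) *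
        (‖H - labelMatrix (σ ∘ c)‖ / √n) + 2 * (C / γ) / √(Real.log n)) *
        (‖H - labelMatrix (σ ∘ c)‖ / √n) := by
  have hn0 : (0 : ℝ) < n := by exact_mod_cast (by omega : 0 < n)
  have hK0 : (0 : ℝ) < K := by exact_mod_cast (by omega : 0 < K)
  have hsn : 0 < √(n : ℝ) := Real.sqrt_pos.2 hn0
  have hL0 : 0 < Real.log n := by linarith [half_le_log hn]
  have hcσ : labelMatrix (σ ∘ c) ∈ balanced n K := by
    rw [labelMatrix_mem_balanced] at hc ⊢
    exact fun k => by rw [community_perm]; exact hc _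
  obtain ⟨v, rfl, -⟩ := exists_labelMatrix_of_balanced hH'.1
  have h1 := norm_sub_le_of_mem_proj (mul_pos hγ hL0) hH' hcσ (separation_relabel hsep σ)
  obtain ⟨ε, hεdef⟩ : ∃ ε, ε = ‖H - labelMatrix (σ ∘ c)‖ / √n := ⟨_, rfl⟩
  rw [← hεdef] at hε ⊢
  have hx : ‖H - labelMatrix (σ ∘ c)‖ = ε * √n := by rw [hεdef]; field_simp
  have hε0 : 0 ≤ ε := by rw [hεdef]; positivity
  rcases hε0.eq_or_lt with h0 | h0
  · rw [← h0, zero_mul, norm_eq_zero, sub_eq_zero] at hx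
    rw [hx, sub_self, norm_zero, mul_zero] at h1
    rw [← h0, mul_zero]
    exact (div_le_div_of_nonneg_right h1 hsn.le).trans_eq (zero_div _)
  · have h2 := hlip ε h0 hε H hH σ (by rw [relabel_labelMatrix, hx])
    rw [relabel_labelMatrix, hx] at h2
    rw [div_le_iff₀ hsn]
    refine h1.trans ((mul_le_mul_of_nonneg_left h2 (by positivity)).trans_eq ?_)
    rw [rpow_sub_three_halves hd hK0]
    obtain ⟨e, rfl⟩ := Nat.exists_eq_add_of_le' hd
    obtain ⟨l, hl⟩ : ∃ l, l = √(Real.log n) := ⟨_, rfl⟩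
    have hll : Real.log n = l ^ 2 := by rw [hl, Real.sq_sqrt hL0.le]
    have hl0 : 0 < l := by rw [hl]; exact Real.sqrt_pos.2 hL0
    have hsK : 0 < √(K : ℝ) := Real.sqrt_pos.2 hK0
    rw [← hl, hll]
    simp only [Nat.add_sub_cancel, show e + 2 - 1 = e + 1 from rfl, pow_succ (n : ℝ) e, div_pow]
    field_simp
    ring

lemma separation_lipschitz_subset_recovery (hd : 2 ≤ d) (hK : 2 ≤ K) (hαβ : β < α) (hC : 0 < C)
    (hγ : 0 < γ) (hn : Real.exp (logThreshold d K α β γ C) < n) {c : Fin n → Fin K}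
    (hc : labelMatrix c ∈ balanced n K) :
    separationEvent γ (labelMatrix c) A ∩ lipschitzEvent α β C (labelMatrix c) A ⊆
      recoveryEvent α β γ (labelMatrix c) A := by
  rintro ω ⟨hsep, hlip⟩ H₀ _ σ hH₀ N hN H rfl hrun
  rw [relabel_labelMatrix] at hH₀ ⊢
  obtain ⟨hn2, hth⟩ := one_lt_of_logThreshold_lt hC hγ hn
  have hn0 : (0 : ℝ) < n := by exact_mod_cast (by omega : 0 < n)
  have hK0 : (0 : ℝ) < K := by exact_mod_cast (by omega : 0 < K)
  have hd1 : (2 : ℝ) ≤ d := by exact_mod_cast hd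
  have hdd : 0 < (d : ℝ) - 1 := by linarith
  have hab : 0 < α - β := by linarith
  have hsn : 0 < √(n : ℝ) := Real.sqrt_pos.2 hn0
  have hcσ : labelMatrix (σ ∘ c) ∈ balanced n K := by
    rw [labelMatrix_mem_balanced] at hc ⊢
    exact fun k => by rw [community_perm]; exact hc _
  have h8 := eight_lt_of_logThreshold_lt hC hγ hth
  have hx1 := eight_mul_div_le_sqrt hC hγ hth
  have hx2 := one_le_div_mul_sqrt hC hγ hth
  have hx3 := four_mul_div_le_sqrt_sqrt hC hγ hth
  set L := Real.log n with hL
  have hL0 : 0 < L := by linarith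
  have hlL : 0 < √L := Real.sqrt_pos.2 hL0
  have hllL : 0 < √√L := Real.sqrt_pos.2 hlL
  set θ := theta d K α β γ with hθ
  have hθ0 : 0 < θ := theta_pos hd hK hαβ hγ
  have hbal : ∀ j, 1 ≤ j → j ≤ N + 1 → H j ∈ balanced n K := by
    intro j hj hjN
    obtain ⟨i, rfl⟩ := Nat.exists_eq_add_of_le' hj
    rcases Nat.eq_zero_or_pos i with rfl | hi
    · exact hrun.init.1
    · exact (hrun.step i hi (by omega)).1
  set x := C / γ with hx
  have hx0 : 0 < x := by positivity
  set a := 8 * ((d : ℝ) - 1) * (α - β) / (γ * (K : ℝ) ^ ((d : ℝ) - 3 / 2)) with ha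
  have ha0 : 0 ≤ a := by positivity
  have haE : a * (2 * θ) ≤ 1 / 4 := mul_theta_le hd hK hαβ hγ
  have hb : 2 * x / √L ≤ 1 / 4 := by rw [div_le_iff₀ hlL]; linarith
  have hhalf := half_pow_ceil_le (by linarith : 1 < L)
  have hfac : a * (2 * θ * (1 / 2) ^ ⌈2 * Real.log L⌉₊) + 2 * x / √L ≤ 1 / √√L := by
    have h1 : a * (2 * θ * (1 / 2) ^ ⌈2 * Real.log L⌉₊) ≤ x / 4 / √L := by
      calc a * (2 * θ * (1 / 2) ^ ⌈2 * Real.log L⌉₊)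
          = a * (2 * θ) * (1 / 2) ^ ⌈2 * Real.log L⌉₊ := by ring
        _ ≤ 1 / 4 * (1 / L) := by gcongr
        _ ≤ 1 / 4 * (x * √L / (√L * √L)) := by
            rw [Real.mul_self_sqrt hL0.le]; gcongr
        _ = x / 4 / √L := by field_simp
    have h2 : 1 / √√L = √√L / √L := by
      rw [div_eq_div_iff hllL.ne' hlL.ne', one_mul, Real.mul_self_sqrt hlL.le]
    rw [h2]
    calc _ ≤ x / 4 / √L + 2 * x / √L := by gcongr
      _ = (x / 4 + 2 * x) / √L := by ring
      _ ≤ √√L / √L := by gcongr; linarith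
  have hllL1 : 1 / √√L ≤ 1 := by
    rw [div_le_one hllL]
    exact Real.one_le_sqrt.2 (Real.one_le_sqrt.2 (by linarith))
  have key := quadratic_contraction (e := fun j => ‖H j - labelMatrix (σ ∘ c)‖ / √n) (a := a)
    (b := 2 * x / √L) (E := 2 * θ) (r := 1 / √√L) (N := N) (s := ⌈2 * Real.log L⌉₊)
    (t := ⌈2 * L / Real.log L⌉₊) (fun j => by positivity) ha0 (by positivity) ?_ ?_
    (by linarith) hfac hllL1 (le_trans (Nat.le_add_right _ 2) hN)
  · obtain ⟨v, hv, -⟩ := exists_labelMatrix_of_balanced (hbal (N + 1) (by omega) le_rfl)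
    rw [hv] at key ⊢
    congr 1
    apply eq_of_norm_sub_lt
    have hexp : Real.exp (-(L / 2)) * √n = 1 := by
      rw [← Real.exp_log hsn, Real.log_sqrt hn0.le, ← Real.exp_add, ← hL]
      simp
    have h1 := pow_ceil_le (by linarith : 1 < L)
    rw [div_le_iff₀ hsn] at key
    calc _ ≤ _ := key
      _ ≤ 2 * θ * 1 * Real.exp (-(L / 2)) * √n := by
          gcongr
          exact pow_le_one₀ (by norm_num) (by norm_num)
      _ = 2 * θ := by rw [mul_assoc, hexp]; ring
      _ < 1 := by linarith [theta_lt_half (α := α) (β := β) (γ := γ) hd hK]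
  · rw [div_le_iff₀ hsn]
    linarith [norm_proj_sub_le hrun.init hcσ]
  · intro j hj hjN hje
    refine iterate_step hd hK hn2 hγ hc hsep hlip σ (hbal j hj (by omega))
      (hrun.step j hj hjN) (lt_of_le_of_lt hje ?_)
    have h1 := theta_le_sqrt d K α β γ
    have h2 : 0 < 1 / √(K * ((d : ℝ) - 1)) := by positivity
    linarith

end Contraction

namespace IsBernoulliFamily

variable {E Ω : Type*} [MeasurableSpace Ω] {P : Measure Ω} {X : E → Ω → ℝ} {p : E → unitInterval}

lemma measure_eq_one (h : IsBernoulliFamily P X p) (e : E) : P.real {ω | X e ω = 1} = p e := by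
  have h1 := (h.law e).map_eq
  have h2 : P.real {ω | X e ω = 1} = (P.map (X e)).real {1} := by
    rw [map_measureReal_apply (h.measurable e) (measurableSet_singleton _)]
    rfl
  rw [h2, h1, bernoulliMeasure_real_apply_of_mem_of_notMem] <;> simp

lemma measure_eq_zero (h : IsBernoulliFamily P X p) (e : E) :
    P.real {ω | X e ω = 0} = 1 - p e := by
  have h1 := (h.law e).map_eq
  have h2 : P.real {ω | X e ω = 0} = (P.map (X e)).real {0} := by
    rw [map_measureReal_apply (h.measurable e) (measurableSet_singleton _)]
    rfl
  rw [h2, h1, bernoulliMeasure_real_apply_of_notMem_of_mem] <;> simp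

/-- Lower bound for the probability of a configuration all of whose values are likely enough. -/
lemma pow_le_measure_forall_eq [Fintype E] (h : IsBernoulliFamily P X p) {x : E → ℝ} {δ : ℝ}
    (hδ : 0 ≤ δ) (hx : ∀ e, (x e = 1 ∧ δ ≤ p e) ∨ (x e = 0 ∧ δ ≤ 1 - p e)) :
    δ ^ Fintype.card E ≤ P.real {ω | ∀ e, X e ω = x e} := by
  have h1 : {ω | ∀ e, X e ω = x e} = ⋂ e ∈ Finset.univ, X e ⁻¹' {x e} := by
    ext ω; simp
  have h2 := h.indep.measure_inter_preimage_eq_mul Finset.univ (sets := fun e => {x e})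
    fun e _ => measurableSet_singleton _
  rw [h1, measureReal_def, h2, ENNReal.toReal_prod, ← Finset.card_univ, ← Finset.prod_const]
  refine Finset.prod_le_prod (fun _ _ => hδ) fun e _ => ?_
  rcases hx e with ⟨he, hle⟩ | ⟨he, hle⟩
  · rw [he]
    exact hle.trans_eq (h.measure_eq_one e).symm
  · rw [he]
    exact hle.trans_eq (h.measure_eq_zero e).symm

end IsBernoulliFamily

lemma descFactorial_lt_of_lt {k x y : ℕ} (hk : k + 1 ≤ y) (h : x < y) :
    x.descFactorial (k + 1) < y.descFactorial (k + 1) := by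
  obtain ⟨z, rfl⟩ := Nat.exists_eq_succ_of_ne_zero (by omega : y ≠ 0)
  refine (descFactorial_mono_left (k + 1) (Nat.lt_succ_iff.1 h)).trans_lt ?_
  rw [Nat.succ_descFactorial_succ, Nat.descFactorial_succ]
  exact Nat.mul_lt_mul_of_pos_right (by omega) (Nat.descFactorial_pos.2 (by omega))

section Planted

variable {d n K : ℕ} [NeZero d] {Ω : Type*} {α β γ : ℝ} {A : Ω → Tensor d n}

lemma le_card_community_of_separation (hK : 2 ≤ K) (hγ : 0 < γ) (hL : 0 < Real.log n)
    {c : Fin n → Fin K} {ω : Ω} (hA : IsHypergraphTensor (A ω)) (h0 : ∀ e : Edge d n, 0 ≤ A ω e.1)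
    (h : ω ∈ separationEvent γ (labelMatrix c) A) (i : Fin n) :
    d ≤ (community c (c i)).card := by
  by_contra hlt
  have : Nontrivial (Fin K) := Fin.nontrivial_iff_two_le.2 hK
  obtain ⟨l, hl⟩ := exists_ne (c i)
  have h1 := h i (c i) l (by simp [labelMatrix_apply]) hl
  have h2 : 0 ≤ multilinearOp (A ω) (labelMatrix c) i l := by
    rw [multilinearOp_eq_sum_edges hA]
    refine mul_nonneg (by positivity) (Finset.sum_nonneg fun r _ => Finset.sum_nonneg fun e _ =>
      mul_nonneg (h0 e) (Finset.prod_nonneg fun t _ => ?_))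
    rw [labelMatrix_apply]
    split_ifs <;> norm_num
  have h3 : multilinearOp (A ω) (labelMatrix c) i (c i) = 0 := by
    rw [multilinearOp_eq_sum_edges hA]
    refine mul_eq_zero_of_right _ (Finset.sum_eq_zero fun r _ => Finset.sum_eq_zero fun e he =>
      mul_eq_zero_of_right _ ?_)
    by_contra hne
    rw [← ne_eq, Finset.prod_ne_zero_iff] at hne
    apply hlt
    have hmem : ∀ t, e.1 t ∈ community c (c i) := by
      intro t
      rw [mem_community]
      by_cases ht : t = r
      · rw [ht, (Finset.mem_filter.1 he).2]
      · by_contra hcon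
        exact hne t (by simp [ht]) (by rw [labelMatrix_apply, if_neg hcon])
    calc d = (Finset.univ.image e.1).card := by
          rw [Finset.card_image_of_injective _ e.2.injective]; simp
      _ ≤ _ := Finset.card_le_card fun x hx => by
          obtain ⟨t, -, rfl⟩ := Finset.mem_image.1 hx
          exact hmem t
  have := mul_pos hγ hL
  linarith

open Classical in
/-- The tensor which has all hyperedges inside of the communities and no other ones. -/
noncomputable def plantedTensor (d : ℕ) [NeZero d] (c : Fin n → Fin K) : Tensor d n :=
  fun j => if Function.Injective j then (if ∀ t, c (j t) = c (j 0) then 1 else 0) else 0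

lemma multilinearOp_eq_plantedTensor {c : Fin n → Fin K} {B : Tensor d n}
    (hB : IsHypergraphTensor B) (h : ∀ e : Edge d n, B e.1 = plantedTensor d c e.1)
    (H : Matrix (Fin n) (Fin K) ℝ) : multilinearOp B H = multilinearOp (plantedTensor d c) H := by
  have h1 : IsHypergraphTensor (plantedTensor d c) := by
    have := isHypergraphTensor_meanTensor (d := d) 1 0 (labelMatrix c)
    rw [meanTensor_labelMatrix] at this
    exact this
  ext i k
  rw [multilinearOp_eq_sum_edges hB, multilinearOp_eq_sum_edges h1]
  simp_rw [h]

lemma plantedTensor_perm (c : Fin n → Fin K) (σ : Equiv.Perm (Fin K)) :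
    plantedTensor d (σ ∘ c) = plantedTensor d c := by
  ext j
  simp [plantedTensor]

lemma multilinearOp_plantedTensor_lt (hd : 2 ≤ d) {v c : Fin n → Fin K} {i : Fin n}
    (hcard : d ≤ (community c (c i)).card)
    (hv : 8 * (d - 1) * (Finset.univ.filter fun j => v j ≠ c j).card ≤
      (community c (c i)).card) {l : Fin K} (hl : l ≠ c i) :
    multilinearOp (plantedTensor d c) (labelMatrix v) i l <
      multilinearOp (plantedTensor d c) (labelMatrix v) i (c i) := by
  have hpl : ∀ k, multilinearOp (plantedTensor d c) (labelMatrix v) i k =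
      ((((community c (c i) ∩ community v k).erase i).card.descFactorial (d - 1) : ℕ) : ℝ) := by
    intro k
    have := multilinearOp_planted (d := d) 1 0 v c i k
    rw [zero_mul, zero_add, sub_zero, one_mul] at this
    exact this
  rw [hpl, hpl, Nat.cast_lt]
  set D := Finset.univ.filter fun j => v j ≠ c j with hD
  have h1 : ((community c (c i) ∩ community v l).erase i).card ≤ D.card := by
    refine Finset.card_le_card fun j hj => ?_
    rw [Finset.mem_erase, Finset.mem_inter, mem_community, mem_community] at hj
    rw [hD, Finset.mem_filter]
    refine ⟨Finset.mem_univ _, fun h => hl ?_⟩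
    rw [← hj.2.2, h, hj.2.1]
  have h2 : (community c (c i)).card ≤
      ((community c (c i) ∩ community v (c i)).erase i).card + D.card + 1 := by
    have h3 : community c (c i) ⊆
        insert i ((community c (c i) ∩ community v (c i)).erase i ∪ D) := by
      intro j hj
      rw [Finset.mem_insert, Finset.mem_union, Finset.mem_erase, Finset.mem_inter, hD,
        Finset.mem_filter, mem_community (c := v)]
      by_cases hji : j = i
      · exact Or.inl hji
      · by_cases hvj : v j = c i
        · exact Or.inr (Or.inl ⟨hji, hj, hvj⟩)
        · refine Or.inr (Or.inr ⟨Finset.mem_univ _, ?_⟩)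
          rwa [mem_community.1 hj]
    exact (Finset.card_le_card h3).trans ((Finset.card_insert_le _ _).trans
      (Nat.add_le_add_right (Finset.card_union_le _ _) 1))
  obtain ⟨e, rfl⟩ := Nat.exists_eq_add_of_le' hd
  rw [show e + 2 - 1 = e + 1 from rfl] at *
  generalize (community c (c i)).card = m at *
  generalize D.card = s at *
  generalize ((community c (c i) ∩ community v (c i)).erase i).card = y at *
  rcases Nat.eq_zero_or_pos s with rfl | hs
  · exact descFactorial_lt_of_lt (by omega) (by omega)
  · have h4 : 8 * (e + 1) ≤ 8 * (e + 1) * s := Nat.le_mul_of_pos_right _ hs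
    have h5 : 8 * s ≤ 8 * (e + 1) * s := by
      rw [mul_assoc]
      exact Nat.mul_le_mul_left _ (Nat.le_mul_of_pos_left _ (by omega))
    have h6 : 8 * (e + 1) + 8 * s ≤ 8 * (e + 1) * s + 8 := by nlinarith
    exact descFactorial_lt_of_lt (by omega) (by omega)

lemma planted_subset_recovery (hd : 2 ≤ d) (hK : 2 ≤ K) {c : Fin n → Fin K}
    (hc : labelMatrix c ∈ balanced n K) (hcard : ∀ k, d ≤ (community c k).card) {ω : Ω}
    (hA : IsHypergraphTensor (A ω)) (h : ∀ e : Edge d n, A ω e.1 = plantedTensor d c e.1)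
    (hθ : 0 ≤ theta d K α β γ) :
    ω ∈ recoveryEvent α β γ (labelMatrix c) A := by
  rintro H₀ _ σ hH₀ N hN H rfl hrun
  rw [relabel_labelMatrix] at hH₀ ⊢
  have hop := multilinearOp_eq_plantedTensor (c := σ ∘ c) hA (by rwa [plantedTensor_perm])
  have hcard' : ∀ k, d ≤ (community (σ ∘ c) k).card := fun k => by
    rw [community_perm]; exact hcard _
  have hcσ : labelMatrix (σ ∘ c) ∈ balanced n K := by
    rw [labelMatrix_mem_balanced] at hc ⊢
    exact fun k => by rw [community_perm]; exact hc _
  have hstep : ∀ j, 1 ≤ j → j ≤ N → ∀ v, H j = labelMatrix v →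
      (∀ i, 8 * (d - 1) * (Finset.univ.filter fun j => v j ≠ (σ ∘ c) j).card ≤
        (community (σ ∘ c) ((σ ∘ c) i)).card) → H (j + 1) = labelMatrix (σ ∘ c) := by
    intro j hj hjN v hv hvc
    have h1 := hrun.step j hj hjN
    obtain ⟨w, hw, -⟩ := exists_labelMatrix_of_balanced h1.1
    rw [hw, hop, hv] at h1
    rw [hw, eq_of_mem_proj h1 hcσ fun i l hl => multilinearOp_plantedTensor_lt hd (hcard' _) (hvc i) hl]
  have hall : ∀ j, j + 1 ≤ N → H (j + 2) = labelMatrix (σ ∘ c) := by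
    intro j
    induction j with
    | zero =>
      intro hj
      obtain ⟨v, hv, -⟩ := exists_labelMatrix_of_balanced hrun.init.1
      refine hstep 1 le_rfl hj v hv fun i => ?_
      have h1 := (norm_proj_sub_le hrun.init hcσ).trans
        (mul_le_mul_of_nonneg_left hH₀ zero_le_two)
      have h2 := pow_le_pow_left₀ (norm_nonneg _) h1 2
      have hd1 : (2 : ℝ) ≤ d := by exact_mod_cast hd
      have hdd : 0 < (d : ℝ) - 1 := by linarith
      have hK0 : (0 : ℝ) < K := by exact_mod_cast (by omega : 0 < K)
      have h3 : theta d K α β γ ^ 2 ≤ 1 / 16 * (1 / (K * ((d : ℝ) - 1))) := by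
        refine (pow_le_pow_left₀ hθ (theta_le_sqrt d K α β γ) 2).trans_eq ?_
        rw [mul_pow, div_pow 1 (√_), Real.sq_sqrt (by positivity)]
        norm_num
      rw [hv, labelMatrix_sub_norm_sq, mul_pow, mul_pow, Real.sq_sqrt (Nat.cast_nonneg n)] at h2
      have h4 := labelMatrix_mem_balanced.1 hcσ ((σ ∘ c) i)
      have h5 : theta d K α β γ ^ 2 * n ≤ 1 / 16 * (1 / (K * ((d : ℝ) - 1))) * n :=
        mul_le_mul_of_nonneg_right h3 (Nat.cast_nonneg n)
      have h6 : 1 / 16 * (1 / (K * ((d : ℝ) - 1))) * n * (16 * (d - 1)) = n / K := by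
        field_simp
      have h7 : (8 * ((d : ℝ) - 1) *
          ((Finset.univ.filter fun j => v j ≠ (σ ∘ c) j).card : ℝ)) ≤
          (community (σ ∘ c) ((σ ∘ c) i)).card := by
        rw [h4, ← h6]
        nlinarith
      have h8 : ((8 * (d - 1) * (Finset.univ.filter fun j => v j ≠ (σ ∘ c) j).card : ℕ) : ℝ) ≤
          (community (σ ∘ c) ((σ ∘ c) i)).card := by
        push_cast [(by omega : 1 ≤ d)]
        exact h7
      exact_mod_cast h8
    | succ j ih =>
      intro hj
      exact hstep (j + 2) (by omega) hj _ (ih (by omega)) fun i => by simp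
  have hN2 : 2 ≤ N := le_trans (Nat.le_add_left 2 _) hN
  have := hall (N - 1) (by omega)
  rwa [show N - 1 + 2 = N + 1 by omega] at this

end Planted

section Recovery

variable {d n K : ℕ} [NeZero d] {Ω : Type*} [MeasurableSpace Ω] {P : Measure Ω}
  [IsProbabilityMeasure P] {α β γ : ℝ} {A : Ω → Tensor d n} {Hstar : Matrix (Fin n) (Fin K) ℝ}

lemma one_sub_le_measure_recovery (hd : 2 ≤ d) (hK : 2 ≤ K) (hβ : 0 < β) (hαβ : β < α)
    (hγ : 0 < γ) {c₁ : ℝ}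
    (hn : Real.exp (logThreshold d K α β γ (lipConst d K α β)) < n)
    (h : IsLogHSBM α β Hstar P A)
    (hsep : 1 - (n : ℝ) ^ (-c₁) ≤ P.real (separationEvent γ Hstar A)) :
    1 - ((n : ℝ) ^ (-c₁) + (n : ℝ) ^ (-10 : ℝ)) ≤ P.real (recoveryEvent α β γ Hstar A) := by
  have hC : 0 < lipConst d K α β := lipConst_pos hd hβ
  have hlip := measure_lipschitzEvent_compl_le hd hK (one_lt_of_logThreshold_lt hC hγ hn).1 hβ hαβ h
  have hsub : separationEvent γ Hstar A ⊆
      recoveryEvent α β γ Hstar A ∪ (lipschitzEvent α β (lipConst d K α β) Hstar A)ᶜ := by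
    obtain ⟨c, rfl, hc⟩ := h.eq_labelMatrix
    intro ω hω
    by_cases hl : ω ∈ lipschitzEvent α β (lipConst d K α β) (labelMatrix c) A
    · exact Or.inl (separation_lipschitz_subset_recovery hd hK hαβ hC hγ hn
        (labelMatrix_mem_balanced.2 hc) ⟨hω, hl⟩)
    · exact Or.inr hl
  have := (measureReal_mono hsub (measure_ne_top P _)).trans (measureReal_union_le _ _)
  linarith

/-- Recovery has a positive probability, bounded below in terms of the parameters only. -/
lemma pow_le_measure_recovery (hd : 2 ≤ d) (hK : 2 ≤ K) (hn : 2 ≤ n) (hαβ : β < α) (hγ : 0 < γ)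
    (h : IsLogHSBM α β Hstar P A) (hsep : 0 < P.real (separationEvent γ Hstar A)) :
    (min (α * Real.log n / (n : ℝ) ^ (d - 1)) (1 - β * Real.log n / (n : ℝ) ^ (d - 1))) ^
      Fintype.card (Edge d n) ≤ P.real (recoveryEvent α β γ Hstar A) := by
  obtain ⟨c, rfl, hc⟩ := h.eq_labelMatrix
  obtain ⟨p, q, hp, hq, h⟩ := h
  have hL : 0 < Real.log n := by linarith [half_le_log hn]
  rw [← hp, ← hq]
  have hbal : labelMatrix c ∈ balanced n K := h.planted
  obtain ⟨ω, hω, h01⟩ : ∃ ω ∈ separationEvent γ (labelMatrix c) A,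
      ∀ e : Edge d n, A ω e.1 = 0 ∨ A ω e.1 = 1 := by
    by_contra! hcon
    have h1 := h.isBernoulliFamily.ae_forall
    have h2 : P.real (separationEvent γ (labelMatrix c) A) = 0 := by
      rw [measureReal_eq_zero_iff]
      refine measure_mono_null (fun ω hω => ?_) (ae_iff.1 h1)
      obtain ⟨e, he⟩ := hcon ω hω
      simp only [Set.mem_ofPred_eq, not_forall]
      exact ⟨e, fun h => h.elim he.1 he.2⟩
    exact hsep.ne' h2
  have hcard1 := le_card_community_of_separation hK hγ hL (h.isHypergraphTensor ω)
    (fun e => by rcases h01 e with h | h <;> simp [h]) hω ⟨0, by omega⟩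
  have hcard : ∀ k, d ≤ (community c k).card := by
    intro k
    have : (community c k).card = (community c (c ⟨0, by omega⟩)).card := by
      have := (hc k).trans (hc (c ⟨0, by omega⟩)).symm
      exact_mod_cast this
    rwa [this]
  refine (h.isBernoulliFamily.pow_le_measure_forall_eq
    (x := fun e => plantedTensor d c e.1) ?_ fun e => ?_).trans
    (measureReal_mono (fun ω hω => planted_subset_recovery hd hK hbal hcard
      (h.isHypergraphTensor ω) hω (theta_pos hd hK hαβ hγ).le) (measure_ne_top _ _))
  · exact le_min p.2.1 (sub_nonneg.2 q.2.2)
  · rw [edgeProb_labelMatrix]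
    simp only [plantedTensor, e.2.injective, if_true]
    by_cases he : ∀ t, c (e.1 t) = c (e.1 0)
    · simp only [he, implies_true, if_true]
      exact Or.inl ⟨trivial, min_le_left _ _⟩
    · simp only [he, if_false]
      exact Or.inr ⟨trivial, min_le_right _ _⟩

end Recovery

lemma exists_pos_forall_lt_le {f : ℕ → ℝ} (hf : ∀ n, 0 < f n) (N : ℕ) :
    ∃ c, 0 < c ∧ ∀ n < N, c ≤ f n := by
  induction N with
  | zero => exact ⟨1, one_pos, by simp⟩
  | succ N ih =>
    obtain ⟨c, hc, h⟩ := ih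
    refine ⟨min c (f N), lt_min hc (hf N), fun n hn => ?_⟩
    rcases Nat.lt_succ_iff_lt_or_eq.1 hn with h1 | rfl
    · exact (min_le_left _ _).trans (h n h1)
    · exact min_le_right _ _

lemma one_sub_rpow_neg_le {n : ℕ} (hn : 0 < n) (c : ℝ) :
    1 - (n : ℝ) ^ (-c) ≤ c * Real.log n := by
  rw [Real.rpow_def_of_pos (by exact_mod_cast hn)]
  have := Real.add_one_le_exp (Real.log n * -c)
  linarith

lemma exists_recovery (d K : ℕ) [NeZero d] (hd : 2 ≤ d) (hK : 2 ≤ K) {α β : ℝ} (hβ : 0 < β)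
    (hαβ : β < α) {γ : ℝ} (hγ : 0 < γ) {c₁ : ℝ} (hc₁ : 0 < c₁) :
    ∃ c : ℝ, 0 < c ∧ ∀ n : ℕ, Real.exp (logThreshold d K α β γ (lipConst d K α β)) < n →
      ∀ (Hstar : Matrix (Fin n) (Fin K) ℝ) (Ω : Type u) [MeasurableSpace Ω]
        (P : Measure Ω) [IsProbabilityMeasure P] (A : Ω → Tensor d n),
        IsLogHSBM α β Hstar P A →
        1 - (n : ℝ) ^ (-c₁) ≤ P.real (separationEvent γ Hstar A) →
          1 - (n : ℝ) ^ (-c) ≤ P.real (recoveryEvent α β γ Hstar A) := by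
  set c₂ := min c₁ 10 / 2 with hc₂
  have hc₂0 : 0 < c₂ := by positivity
  obtain ⟨N, hN⟩ : ∃ N : ℕ, ∀ n : ℕ, N ≤ n → (2 : ℝ) ≤ (n : ℝ) ^ c₂ :=
    Filter.eventually_atTop.1
      (((tendsto_rpow_atTop hc₂0).comp tendsto_natCast_atTop_atTop).eventually_ge_atTop 2)
  let δ : ℕ → ℝ := fun n =>
    (min (α * Real.log n / (n : ℝ) ^ (d - 1)) (1 - β * Real.log n / (n : ℝ) ^ (d - 1))) ^
      Fintype.card (Edge d n) / Real.log n
  obtain ⟨c₃, hc₃0, hc₃⟩ := exists_pos_forall_lt_le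
    (f := fun n => if 0 < δ n then δ n else 1) (fun n => by
      split_ifs with h
      · exact h
      · exact one_pos) N
  refine ⟨min c₂ c₃, lt_min hc₂0 hc₃0, fun n hn Hstar Ω _ P _ A h hsep => ?_⟩
  obtain ⟨hn2, -⟩ := one_lt_of_logThreshold_lt (lipConst_pos hd hβ) hγ hn
  have hn0 : (0 : ℝ) < n := by exact_mod_cast (by omega : 0 < n)
  have hn1 : (1 : ℝ) < n := by exact_mod_cast (by omega : 1 < n)
  have hL : 0 < Real.log n := Real.log_pos hn1
  rcases le_or_gt N n with hNn | hNn
  · refine le_trans ?_ (one_sub_le_measure_recovery hd hK hβ hαβ hγ hn h hsep)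
    have h1 : (n : ℝ) ^ (-c₁) ≤ (n : ℝ) ^ (-c₂) * (n : ℝ) ^ (-c₂) := by
      rw [← Real.rpow_add hn0]
      refine Real.rpow_le_rpow_of_exponent_le hn1.le ?_
      linarith [min_le_left c₁ 10]
    have h2 : (n : ℝ) ^ (-10 : ℝ) ≤ (n : ℝ) ^ (-c₂) * (n : ℝ) ^ (-c₂) := by
      rw [← Real.rpow_add hn0]
      refine Real.rpow_le_rpow_of_exponent_le hn1.le ?_
      linarith [min_le_right c₁ 10]
    have h3 : (n : ℝ) ^ (-c₂) ≤ 1 / 2 := by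
      rw [Real.rpow_neg hn0.le, ← one_div]
      exact one_div_le_one_div_of_le two_pos (hN n hNn)
    have h4 : (n : ℝ) ^ (-c₂) ≤ (n : ℝ) ^ (-(min c₂ c₃)) :=
      Real.rpow_le_rpow_of_exponent_le hn1.le (neg_le_neg (min_le_left _ _))
    have h5 : 0 < (n : ℝ) ^ (-c₂) := Real.rpow_pos_of_pos hn0 _
    nlinarith
  · have hsep0 : 0 < P.real (separationEvent γ Hstar A) := by
      have := Real.rpow_lt_one_of_one_lt_of_neg hn1 (neg_neg_of_pos hc₁)
      linarith
    refine le_trans ?_ (pow_le_measure_recovery hd hK hn2 hαβ hγ h hsep0)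
    have hδ : 0 < δ n := by
      obtain ⟨p, q, hp, hq, h⟩ := h
      have hqp : (q : ℝ) < p := by rw [hp, hq]; gcongr
      have hp0 : (0 : ℝ) < p := q.2.1.trans_lt hqp
      refine div_pos (pow_pos ?_ _) hL
      rw [← hp, ← hq]
      exact lt_min hp0 (by linarith [p.2.2])
    have h1 := hc₃ n hNn
    simp only [hδ, if_true] at h1
    calc 1 - (n : ℝ) ^ (-(min c₂ c₃)) ≤ min c₂ c₃ * Real.log n :=
          one_sub_rpow_neg_le (by omega) _
      _ ≤ δ n * Real.log n := by
          gcongr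
          exact (min_le_right _ _).trans h1
      _ = _ := div_mul_cancel₀ _ hL.ne'

end HSBM

theorem theorem2 (d K : ℕ) [NeZero d] (hd : 2 ≤ d) (hK : 2 ≤ K) (α β : ℝ) (hβ : 0 < β) (hαβ : β < α)
    (hthr : 1 < (√α - √β) ^ 2 / ((K : ℝ) ^ (d - 1) * ((d - 1).factorial : ℝ))) :
    ∃ C : ℝ, 0 < C ∧
      -- the constant `C`: Lipschitz bound for the multilinear operation
      (∀ n : ℕ, 2 ≤ n → ∀ (Hstar : Matrix (Fin n) (Fin K) ℝ) (Ω : Type u) [MeasurableSpace Ω]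
        (P : Measure Ω) [IsProbabilityMeasure P] (A : Ω → HSBM.Tensor d n),
        HSBM.IsLogHSBM α β Hstar P A →
          1 - (n : ℝ) ^ (-10 : ℝ) ≤ P.real (HSBM.lipschitzEvent α β C Hstar A)) ∧
      -- the constant `γ`: separation at the ground truth for all large `n`
      (∃ γ : ℝ, 0 < γ ∧ ∃ c : ℝ, 0 < c ∧ ∃ n₁ : ℕ, ∀ n : ℕ, n₁ ≤ n →
        ∀ (Hstar : Matrix (Fin n) (Fin K) ℝ) (Ω : Type u) [MeasurableSpace Ω]
        (P : Measure Ω) [IsProbabilityMeasure P] (A : Ω → HSBM.Tensor d n),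
        HSBM.IsLogHSBM α β Hstar P A →
          1 - (n : ℝ) ^ (-c) ≤ P.real (HSBM.separationEvent γ Hstar A)) ∧
      -- exact recovery, for every such `γ` and all `n` beyond the explicit threshold
      (∀ γ : ℝ, 0 < γ → ∀ c₁ : ℝ, 0 < c₁ → ∃ c : ℝ, 0 < c ∧ ∀ n : ℕ,
        Real.exp (HSBM.logThreshold d K α β γ C) < n →
        ∀ (Hstar : Matrix (Fin n) (Fin K) ℝ) (Ω : Type u) [MeasurableSpace Ω]
        (P : Measure Ω) [IsProbabilityMeasure P] (A : Ω → HSBM.Tensor d n),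
        HSBM.IsLogHSBM α β Hstar P A →
        1 - (n : ℝ) ^ (-c₁) ≤ P.real (HSBM.separationEvent γ Hstar A) →
          1 - (n : ℝ) ^ (-c) ≤ P.real (HSBM.recoveryEvent α β γ Hstar A)) :=
  ⟨HSBM.lipConst d K α β, HSBM.lipConst_pos hd hβ,
    fun _ hn _ _ _ _ _ _ h => HSBM.one_sub_le_measure_of_compl_le
      (HSBM.measure_lipschitzEvent_compl_le hd hK hn hβ hαβ h),
    HSBM.exists_separation d K hd hK hβ hαβ hthr,
    fun _ hγ _ hc₁ => HSBM.exists_recovery d K hd hK hβ hαβ hγ hc₁⟩
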